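/- **Theorem.** Let $H$ be a fixed graph on $r$ vertices. The *$H$-Free Bipartitioning Problem* asks, for a finite undirected graph $G=(V,E)$, whether $V$ can be partitioned into two non-empty sets $A,B$ such that neither of the induced subgraphs $G[A]$, $G[B]$ contains $H$ as an induced subgraph. There is a $2^{O(t^r)}\cdot n$ time algorithm that solves this problem on non-empty graphs with $n$ vertices and tree-width at most $t$, where $t\ge 1$ and a nice tree decomposition of width at most $t$ is given as part of the input. Here a *nice* tree decomposition is a rooted tree decomposition with bags $X_i$ in which every node $i$ is a leaf with $X_i=\emptyset$; or has exactly one child $j$, and $X_i=X_j\cup\{v\}$ with $v\notin X_j$ (introduce) or $X_j=X_i\cup\{v\}$ with $v\notin X_i$ (forget); or has exactly two children $j_1,j_2$, and $X_i=X_{j_1}=X_{j_2}$ (join). Precisely: there is a word-RAM program $P$, depending only on $H$, such that for every $K$ there is a constant $c$, depending only on $H$ and $K$, with the following property. Let $t,n\ge 1$, let $G$ be a graph on $n$ vertices, and let a nice tree decomposition of $G$ of width at most $t$ with at most $K\,t\,n$ nodes be given. Started on $G$ (given by adjacency lists) together with the decomposition (given by the root, the lists of children and the lists of bag elements), on a machine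 with words of $c\,(t^r+\lfloor\log_2 n\rfloor)$ bits, $P$ halts after at most $2^{c\,t^r}\cdot n$ steps, with output $1$ if $G$ has such a partition $A,B$, and with output $0$ otherwise. -/

import Mathlib

namespace HFreeBipartitioning

/-! # Word RAM: structured programs with a step count -/

/-- The arithmetic instructions of the word RAM. Subtraction is truncated at `0`, division is
integer division (with value `0` for the divisor `0`). -/
inductive BinOp
  | add | sub | mul | div

def BinOp.eval : BinOp → ℕ → ℕ → ℕ
  | add, a, b => a + b
  | sub, a, b => a - b
  | mul, a, b => a * b
  | div, a, b => a / b

/-- Programs. Registers are numbered; a program mentions only finitely many of them. The rest of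
the storage is a random access memory, which is addressed indirectly, through registers. -/
inductive Cmd
  /-- do nothing -/
  | skip
  /-- `R[x] := k` -/
  | const (x k : ℕ)
  /-- `R[x] := R[y] o R[z]` -/
  | arith (o : BinOp) (x y z : ℕ)
  /-- `R[x] := M[R[y]]` -/
  | load (x y : ℕ)
  /-- `M[R[x]] := R[y]` -/
  | store (x y : ℕ)
  /-- first `p`, then `q` -/
  | seq (p q : Cmd)
  /-- if `R[x] ≠ 0` then `p` else `q` -/
  | ite (x : ℕ) (p q : Cmd)
  /-- while `R[x] ≠ 0` do `p` -/
  | loop (x : ℕ) (p : Cmd)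

/-- A configuration: the contents of the registers and of the memory. -/
structure Config where
  reg : ℕ → ℕ
  mem : ℕ → ℕ

def Config.setReg (s : Config) (x v : ℕ) : Config := ⟨Function.update s.reg x v, s.mem⟩

def Config.setMem (s : Config) (a v : ℕ) : Config := ⟨s.reg, Function.update s.mem a v⟩

/-- `Exec w p s k s'`: on a machine with `w`-bit words, the program `p` started in configuration
`s` halts in configuration `s'` after exactly `k` steps. Every instruction and every evaluation of
a condition is one step. An instruction whose result does not fit into a word cannot be executed:
the run is then stuck, and `Exec` does not hold for any outcome. -/
inductive Exec (w : ℕ) : Cmd → Config → ℕ → Config → Prop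
  | skip (s : Config) : Exec w .skip s 1 s
  | const (s : Config) (x k : ℕ) (h : k < 2 ^ w) : Exec w (.const x k) s 1 (s.setReg x k)
  | arith (s : Config) (o : BinOp) (x y z : ℕ) (h : o.eval (s.reg y) (s.reg z) < 2 ^ w) :
      Exec w (.arith o x y z) s 1 (s.setReg x (o.eval (s.reg y) (s.reg z)))
  | load (s : Config) (x y : ℕ) (h : s.mem (s.reg y) < 2 ^ w) :
      Exec w (.load x y) s 1 (s.setReg x (s.mem (s.reg y)))
  | store (s : Config) (x y : ℕ) : Exec w (.store x y) s 1 (s.setMem (s.reg x) (s.reg y))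
  | seq {p q : Cmd} {s s' s'' : Config} {k l : ℕ} (hp : Exec w p s k s') (hq : Exec w q s' l s'') :
      Exec w (.seq p q) s (k + l) s''
  | ite_true {x : ℕ} {p q : Cmd} {s s' : Config} {k : ℕ} (hx : s.reg x ≠ 0)
      (hp : Exec w p s k s') : Exec w (.ite x p q) s (k + 1) s'
  | ite_false {x : ℕ} {p q : Cmd} {s s' : Config} {k : ℕ} (hx : s.reg x = 0)
      (hq : Exec w q s k s') : Exec w (.ite x p q) s (k + 1) s'
  | loop_stop {x : ℕ} {p : Cmd} {s : Config} (hx : s.reg x = 0) : Exec w (.loop x p) s 1 s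
  | loop_step {x : ℕ} {p : Cmd} {s s' s'' : Config} {k l : ℕ} (hx : s.reg x ≠ 0)
      (hp : Exec w p s k s') (hl : Exec w (.loop x p) s' l s'') :
      Exec w (.loop x p) s (k + l + 1) s''

/-- The initial configuration: the input is stored in the memory from address `0` on, all other
memory cells and all registers are `0`. -/
def Config.init (input : List ℕ) : Config := ⟨fun _ => 0, fun a => input.getD a 0⟩

/-- On a machine with `w`-bit words, the program `P` halts on `input` after at most `T` steps,
with the number `out` in register `0`. -/
def Cmd.Outputs (P : Cmd) (w : ℕ) (input : List ℕ) (T : ℕ) (out : ℕ) : Prop :=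
  ∃ k s, k ≤ T ∧ Exec w P (Config.init input) k s ∧ s.reg 0 = out

/-! # Nice tree decompositions -/

/-- A tree decomposition of `G` with node set `I`. -/
structure TreeDecomposition {V : Type*} (G : SimpleGraph V) (I : Type*) where
  tree : SimpleGraph I
  isTree : tree.IsTree
  bag : I → Finset V
  exists_mem_bag : ∀ v : V, ∃ i, v ∈ bag i
  exists_edge_bag : ∀ u v : V, G.Adj u v → ∃ i, u ∈ bag i ∧ v ∈ bag i
  connected : ∀ v : V, (tree.induce {i | v ∈ bag i}).Connected

/-- The width, i.e. the maximum of `|X_i| - 1` over all bags `X_i`, is at most `t`. -/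
def TreeDecomposition.WidthAtMost {V I : Type*} {G : SimpleGraph V} (D : TreeDecomposition G I)
    (t : ℕ) : Prop :=
  ∀ i, (D.bag i).card ≤ t + 1

/-- A tree decomposition with a distinguished root node. -/
structure RootedTreeDecomposition {V : Type*} (G : SimpleGraph V) (I : Type*) extends
    TreeDecomposition G I where
  root : I

/-- The children of the node `i`: its neighbours that are farther away from the root. -/
def RootedTreeDecomposition.children {V I : Type*} {G : SimpleGraph V}
    (D : RootedTreeDecomposition G I) (i : I) : Set I :=
  {j | D.tree.Adj i j ∧ D.tree.dist D.root j = D.tree.dist D.root i + 1}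

/-- Every node is a leaf node, an introduce node, a forget node or a join node. -/
def RootedTreeDecomposition.IsNice {V I : Type*} [DecidableEq V] {G : SimpleGraph V}
    (D : RootedTreeDecomposition G I) : Prop :=
  ∀ i : I,
    (D.children i = ∅ ∧ D.bag i = ∅) ∨
    (∃ j v, D.children i = {j} ∧ v ∉ D.bag j ∧ D.bag i = insert v (D.bag j)) ∨
    (∃ j v, D.children i = {j} ∧ v ∉ D.bag i ∧ D.bag j = insert v (D.bag i)) ∨
    (∃ j₁ j₂, j₁ ≠ j₂ ∧ D.children i = {j₁, j₂} ∧ D.bag i = D.bag j₁ ∧ D.bag i = D.bag j₂)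

/-! # The input of an algorithm -/

/-- The list `l` enumerates the elements of `S`, in some order and without repetitions. -/
def Enumerates {α : Type*} (l : List α) (S : Set α) : Prop :=
  l.Nodup ∧ ∀ a, a ∈ l ↔ a ∈ S

/-- A list of numbers is stored as its length followed by its entries. -/
def encodeList {m : ℕ} (l : List (Fin m)) : List ℕ :=
  l.length :: l.map Fin.val

/-- `input` represents the graph `G` with the rooted tree decomposition `D`: it consists of the
number of vertices, the number of nodes and the root, followed by the adjacency lists of the
vertices `0, 1, …, n - 1` of `G`, followed, for each of the nodes `0, 1, …, N - 1` in turn, by the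
list of its children and the list of the vertices in its bag. The order inside each of these lists
is arbitrary. -/
def Represents {n N : ℕ} (input : List ℕ) (G : SimpleGraph (Fin n))
    (D : RootedTreeDecomposition G (Fin N)) : Prop :=
  ∃ (nbrs : Fin n → List (Fin n)) (kids : Fin N → List (Fin N)) (bags : Fin N → List (Fin n)),
    (∀ v, Enumerates (nbrs v) (G.neighborSet v)) ∧
    (∀ i, Enumerates (kids i) (D.children i)) ∧
    (∀ i, Enumerates (bags i) (D.bag i)) ∧
    input = [n, N, (D.root : ℕ)] ++
      (List.finRange n).flatMap (fun v => encodeList (nbrs v)) ++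
      (List.finRange N).flatMap (fun i => encodeList (kids i) ++ encodeList (bags i))

/-! # The problem -/

/-- `G` is a yes-instance of the `H`-free bipartitioning problem: its vertex set can be partitioned
into two non-empty sets neither of which induces a graph with `H` as an induced subgraph. -/
def HasHFreeBipartition {W V : Type*} (H : SimpleGraph W) (G : SimpleGraph V) : Prop :=
  ∃ A B : Set V, A.Nonempty ∧ B.Nonempty ∧ Disjoint A B ∧ A ∪ B = Set.univ ∧
    ¬ H.IsIndContained (G.induce A) ∧ ¬ H.IsIndContained (G.induce B)

end HFreeBipartitioning

open HFreeBipartitioning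

/-!
The program is a dynamic program over the given tree decomposition.

Fix a two-colouring of a set `U` of vertices and a list `b` of the vertices of a bag. A partial copy
of `H` in one of the colours is an induced copy, inside that colour, of an induced subgraph of `H`.
The bag sees it as a pattern, namely for each vertex of `H` one of the digits `0` (not mapped),
`1` (mapped outside of the bag) and `p + 2` (mapped to entry `p` of the bag). With
`B = 2 + (largest bag)` there are `B ^ r` patterns, and the type of the colouring is the set of
the patterns of its partial copies, for both colours: a number below `S = 2 ^ (2 * B ^ r)`, which
is `2 ^ O(t ^ r)`. Types carry enough information:

* `realizable_bag`: the types of the colourings of a single bag are described by `BaseP`;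
* `realizable_union`: if `U₁` and `U₂` meet only inside of their bags, and no edges run between the
  rest of `U₁` and the rest of `U₂`, then the types of `U₁ ∪ U₂` are glued from those of `U₁` and
  of `U₂`, as described by `GlueP`;
* `hasHFreeBipartition_iff`: an `H`-free bipartition exists if and only if the whole graph has a
  type in which no pattern is a complete copy of `H` and both colours occur (`FinalP`).

In a rooted tree decomposition, the vertices below a node `i` are obtained from the bag of `i` by
glueing in the subtrees of its children one after the other. Hence one table, with a row of `S`
entries for each node and each number of subtrees already glued, can be filled in reverse
breadth-first order. Niceness enters only through the fact that a node has at most two children.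

On the word RAM, `BaseP`, `GlueP` and `FinalP` are first-order conditions with quantifiers over
numbers below `S`. Formulas of this kind (`Fm`) are compiled to programs whose running time is a
fixed power of `S` (`Fm.exec_compile`, `Fm.exists_time_le`); the surrounding program is verified
with the rules for the judgement `HT` of total correctness with a time bound. The adjacency matrix
is never initialized: the memory beyond the input is zero, so that only the edges have to be
entered, and there are at most `(t + 1) ^ 2` edges per bag.

For `r = 0` no graph is `H`-free, and the answer is always `0`.
-/

namespace HFreeBipartitioning

/-! ### Terms and bounded formulas, and their evaluation on the word RAM -/

/-- Arithmetic terms over registers and memory. -/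
inductive Tm
  | var (x : ℕ)
  | const (k : ℕ)
  | op (o : BinOp) (a b : Tm)
  | load (a : Tm)

namespace Tm

/-- The value of a term for register contents `ρ` and memory contents `μ`. -/
@[simp] def eval (ρ μ : ℕ → ℕ) : Tm → ℕ
  | var x => ρ x
  | const k => k
  | op o a b => o.eval (a.eval ρ μ) (b.eval ρ μ)
  | load a => μ (a.eval ρ μ)

/-- All registers of the term lie in the interval `(0, d)`. -/
@[simp] def WF (d : ℕ) : Tm → Prop
  | var x => 0 < x ∧ x < d
  | const _ => True
  | op _ a b => a.WF d ∧ b.WF d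
  | load a => a.WF d

/-- If all registers and memory cells hold at most `Q`, where `2 ≤ Q`, then the values of all
subterms are at most `Q ^ deg`. -/
@[simp] def deg : Tm → ℕ
  | var _ => 1
  | const k => k + 1
  | op _ a b => a.deg + b.deg + 1
  | load a => a.deg + 1

/-- The number of steps for the evaluation of a term. -/
@[simp] def time : Tm → ℕ
  | var _ => 2
  | const _ => 1
  | op _ a b => a.time + b.time + 1
  | load a => a.time + 1

/-- Evaluates a term into register `e`, with scratch registers above `e`. -/
def compile : Tm → ℕ → Cmd
  | var x, e => .seq (.const e 0) (.arith .add e x e)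
  | const k, e => .const e k
  | op o a b, e => .seq (.seq (a.compile e) (b.compile (e + 1))) (.arith o e e (e + 1))
  | load a, e => .seq (a.compile e) (.load e e)

end Tm

/-- The registers in `(0, d)` and all memory cells hold numbers of size at most `Q`. -/
def Bdd (Q d : ℕ) (s : Config) : Prop :=
  (∀ x, 0 < x → x < d → s.reg x ≤ Q) ∧ ∀ a, s.mem a ≤ Q

theorem Tm.eval_congr {d : ℕ} {ρ ρ' μ : ℕ → ℕ} (t : Tm) (ht : t.WF d)
    (h : ∀ x, 0 < x → x < d → ρ x = ρ' x) : t.eval ρ μ = t.eval ρ' μ := by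
  induction t with
  | var x => exact h x ht.1 ht.2
  | const k => rfl
  | op o a b iha ihb => simp [iha ht.1, ihb ht.2]
  | load a ih => simp [ih ht]

theorem BinOp.eval_le_pow {Q m n a b : ℕ} (hQ : 2 ≤ Q) (o : BinOp) (ha : a ≤ Q ^ m)
    (hb : b ≤ Q ^ n) : o.eval a b ≤ Q ^ (m + n + 1) := by
  have hm : 1 ≤ Q ^ m := Nat.one_le_pow _ _ (by omega)
  have hn : 1 ≤ Q ^ n := Nat.one_le_pow _ _ (by omega)
  have key : Q ^ m * Q ^ n * 2 ≤ Q ^ (m + n + 1) := by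
    rw [pow_succ, pow_add]; exact Nat.mul_le_mul_left _ hQ
  have h1 : Q ^ m ≤ Q ^ m * Q ^ n := Nat.le_mul_of_pos_right _ hn
  have h2 : Q ^ n ≤ Q ^ m * Q ^ n := Nat.le_mul_of_pos_left _ hm
  cases o with
  | add => simp only [BinOp.eval]; omega
  | sub => simp only [BinOp.eval]; omega
  | mul =>
    simp only [BinOp.eval]
    have := Nat.mul_le_mul ha hb
    omega
  | div =>
    simp only [BinOp.eval]
    have := Nat.div_le_self a b
    omega

theorem Tm.eval_le {Q d : ℕ} {s : Config} (hQ : 2 ≤ Q) (hs : Bdd Q d s) (t : Tm) (ht : t.WF d) :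
    t.eval s.reg s.mem ≤ Q ^ t.deg := by
  induction t with
  | var x => simpa using hs.1 x ht.1 ht.2
  | const k =>
    have h1 : k + 1 ≤ 2 ^ (k + 1) := (Nat.lt_two_pow_self).le
    have h2 : 2 ^ (k + 1) ≤ Q ^ (k + 1) := Nat.pow_le_pow_left hQ _
    simp only [eval, deg]; omega
  | op o a b iha ihb => exact BinOp.eval_le_pow hQ o (iha ht.1) (ihb ht.2)
  | load a ih =>
    refine (hs.2 _).trans ?_
    simpa using Nat.pow_le_pow_right (n := Q) (by omega) (show 1 ≤ a.deg + 1 by omega)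

theorem Tm.exec_compile {w Q d e : ℕ} (hQ : 2 ≤ Q) (hde : d ≤ e) (t : Tm) (ht : t.WF d)
    (hw : Q ^ t.deg < 2 ^ w) (s : Config) (hs : Bdd Q d s) :
    ∃ s', Exec w (t.compile e) s t.time s' ∧ s'.reg e = t.eval s.reg s.mem ∧ s'.mem = s.mem ∧
      ∀ x, x < e → s'.reg x = s.reg x := by
  induction t generalizing e s with
  | var x =>
    have hx : x ≠ e := by have := ht.2; omega
    have hv := Tm.eval_le hQ hs _ ht
    refine ⟨_, Exec.seq (Exec.const s e 0 (by positivity)) (Exec.arith _ .add e x e ?_), ?_,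
      rfl, ?_⟩
    · simpa [BinOp.eval, Config.setReg, Function.update_of_ne hx] using lt_of_le_of_lt hv hw
    · simp [BinOp.eval, Config.setReg, Function.update_of_ne hx]
    · intro y hy
      have : y ≠ e := by omega
      simp [Config.setReg, Function.update_of_ne this]
  | const k =>
    have hv := Tm.eval_le hQ hs _ ht
    refine ⟨_, Exec.const s e k (lt_of_le_of_lt hv hw), by simp [Config.setReg], rfl, ?_⟩
    intro y hy
    have : y ≠ e := by omega
    simp [Config.setReg, Function.update_of_ne this]
  | op o a b iha ihb =>
    have hv := Tm.eval_le hQ hs _ ht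
    have hQ1 : 0 < Q := by omega
    have hwa : Q ^ a.deg < 2 ^ w :=
      lt_of_le_of_lt (Nat.pow_le_pow_right hQ1 (by simp; omega)) hw
    have hwb : Q ^ b.deg < 2 ^ w :=
      lt_of_le_of_lt (Nat.pow_le_pow_right hQ1 (by simp; omega)) hw
    obtain ⟨s1, h1, r1, m1, f1⟩ := iha hde ht.1 hwa s hs
    have hs1 : Bdd Q d s1 :=
      ⟨fun x h0 hx => by rw [f1 x (by omega)]; exact hs.1 x h0 hx, by rw [m1]; exact hs.2⟩
    obtain ⟨s2, h2, r2, m2, f2⟩ := ihb (e := e + 1) (by omega) ht.2 hwb s1 hs1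
    have e2 : s2.reg (e + 1) = b.eval s.reg s.mem := by
      rw [r2, m1]
      exact Tm.eval_congr b ht.2 fun x _ hx => f1 x (by omega)
    have e1 : s2.reg e = a.eval s.reg s.mem := by rw [f2 e (by omega), r1]
    refine ⟨_, Exec.seq (Exec.seq h1 h2) (Exec.arith s2 o e e (e + 1) ?_), ?_, ?_, ?_⟩
    · rw [e1, e2]; exact lt_of_le_of_lt hv hw
    · simp [Config.setReg, e1, e2]
    · simp [Config.setReg, m1, m2]
    · intro y hy
      have : y ≠ e := by omega
      simp only [Config.setReg, Function.update_of_ne this]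
      rw [f2 y (by omega), f1 y hy]
  | load a ih =>
    have hv := Tm.eval_le hQ hs _ ht
    have hwa : Q ^ a.deg < 2 ^ w :=
      lt_of_le_of_lt (Nat.pow_le_pow_right (by omega) (by simp)) hw
    obtain ⟨s1, h1, r1, m1, f1⟩ := ih hde ht hwa s hs
    refine ⟨_, Exec.seq h1 (Exec.load s1 e e ?_), ?_, ?_, ?_⟩
    · rw [r1, m1]; exact lt_of_le_of_lt hv hw
    · simp [Config.setReg, r1, m1]
    · simp [Config.setReg, m1]
    · intro y hy
      have : y ≠ e := by omega
      simp only [Config.setReg, Function.update_of_ne this]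
      exact f1 y hy

/-- First-order formulas over terms. All quantifiers range over the numbers below the contents of
register `1`. -/
inductive Fm
  | nz (t : Tm)
  | neg (φ : Fm)
  | and (φ ψ : Fm)
  | ex (x : ℕ) (φ : Fm)

namespace Fm

/-- The truth value of a formula for register contents `ρ` and memory contents `μ`. The atom `nz t`
says that `t` is nonzero. -/
@[simp] def Eval (μ : ℕ → ℕ) : (ℕ → ℕ) → Fm → Prop
  | ρ, nz t => t.eval ρ μ ≠ 0
  | ρ, neg φ => ¬ φ.Eval μ ρ
  | ρ, and φ ψ => φ.Eval μ ρ ∧ ψ.Eval μ ρ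
  | ρ, ex x φ => ∃ v < ρ 1, φ.Eval μ (Function.update ρ x v)

/-- The free registers of the formula lie in `(0, d)`, and the quantifiers bind the registers
`d`, `d + 1`, … in the order of their nesting. -/
@[simp] def WF : ℕ → Fm → Prop
  | d, nz t => t.WF d
  | d, neg φ => φ.WF d
  | d, and φ ψ => φ.WF d ∧ ψ.WF d
  | d, ex x φ => x = d ∧ φ.WF (d + 1)

/-- The counterpart of `Tm.deg` for formulas. -/
@[simp] def deg : Fm → ℕ
  | nz t => t.deg
  | neg φ => φ.deg
  | and φ ψ => φ.deg + ψ.deg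
  | ex _ φ => φ.deg

/-- A bound for the number of steps for the evaluation of a formula whose quantifiers range
over `S` values. -/
@[simp] def time (S : ℕ) : Fm → ℕ
  | nz t => t.time + 2
  | neg φ => φ.time S + 2
  | and φ ψ => φ.time S + ψ.time S + 2
  | ex _ φ => S * (φ.time S + 5) + 3

/-- Evaluates a formula into register `0`, with scratch registers from `d` on. The counter of a
quantifier runs downwards and is set to `0` as soon as a witness is found. -/
def compile : Fm → ℕ → Cmd
  | nz t, d => .seq (t.compile d) (.ite d (.const 0 1) (.const 0 0))
  | neg φ, d => .seq (φ.compile d) (.ite 0 (.const 0 0) (.const 0 1))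
  | and φ ψ, d => .seq (φ.compile d) (.ite 0 (ψ.compile d) .skip)
  | ex _ φ, d =>
    .seq (.seq (.const d 0) (.arith .add d 1 d))
      (.loop d (.seq (.seq (.const (d + 1) 1) (.arith .sub d d (d + 1)))
        (.seq (φ.compile (d + 1)) (.ite 0 (.const d 0) .skip))))

end Fm

theorem Fm.eval_congr {d : ℕ} {ρ ρ' μ : ℕ → ℕ} (φ : Fm) (hd : 1 < d) (hφ : φ.WF d)
    (h : ∀ x, 0 < x → x < d → ρ x = ρ' x) : φ.Eval μ ρ ↔ φ.Eval μ ρ' := by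
  induction φ generalizing d ρ ρ' with
  | nz t => simp [Tm.eval_congr t hφ h]
  | neg φ ih => simp [ih hd hφ h]
  | and φ ψ ih1 ih2 => simp [ih1 hd hφ.1 h, ih2 hd hφ.2 h]
  | ex x φ ih =>
    simp only [Eval, h 1 one_pos hd]
    refine exists_congr fun v => and_congr_right fun _ => ?_
    refine ih (d := d + 1) (by omega) hφ.2 fun y h0 hy => ?_
    rcases eq_or_ne y x with rfl | hyx
    · simp
    · rw [Function.update_of_ne hyx, Function.update_of_ne hyx]
      exact h y h0 (by have := hφ.1; omega)

theorem Fm.deg_pos (φ : Fm) : 0 < φ.deg := by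
  induction φ with
  | nz t => cases t <;> simp [Tm.deg]
  | neg φ ih => simpa
  | and φ ψ ih1 ih2 => simp only [deg]; omega
  | ex x φ ih => simpa

/-- A compiled formula leaves its truth value in register `0` and changes neither the memory nor the
registers in `(0, d)`. -/
theorem Fm.exec_compile {w Q d : ℕ} (hQ : 2 ≤ Q) (hd : 1 < d) (φ : Fm) (hφ : φ.WF d)
    (hw : Q ^ φ.deg < 2 ^ w) (s : Config) (hs : Bdd Q d s) (hS : 1 ≤ s.reg 1) :
    ∃ k s', k ≤ φ.time (s.reg 1) ∧ Exec w (φ.compile d) s k s' ∧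
      (s'.reg 0 ≠ 0 ↔ φ.Eval s.mem s.reg) ∧ s'.mem = s.mem ∧
      ∀ x, 0 < x → x < d → s'.reg x = s.reg x := by
  have hQ1 : 0 < Q := by omega
  have hw1 : 1 < 2 ^ w := by
    have := Nat.one_le_pow φ.deg Q hQ1
    omega
  induction φ generalizing d s with
  | nz t =>
    obtain ⟨s1, h1, r1, m1, f1⟩ := Tm.exec_compile (e := d) hQ le_rfl t hφ hw s hs
    by_cases ht : t.eval s.reg s.mem = 0
    · refine ⟨_, _, ?_, Exec.seq h1 (Exec.ite_false (by rw [r1, ht])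
        (Exec.const s1 0 0 (by omega))), ?_, ?_, ?_⟩
      · simp
      · simp [Config.setReg, ht]
      · simp [Config.setReg, m1]
      · intro x h0 hx
        simp [Config.setReg, Function.update_of_ne h0.ne', f1 x hx]
    · refine ⟨_, _, ?_, Exec.seq h1 (Exec.ite_true (by rw [r1]; exact ht)
        (Exec.const s1 0 1 (by omega))), ?_, ?_, ?_⟩
      · simp
      · simp [Config.setReg, ht]
      · simp [Config.setReg, m1]
      · intro x h0 hx
        simp [Config.setReg, Function.update_of_ne h0.ne', f1 x hx]
  | neg φ ih =>
    obtain ⟨k, s1, hk, h1, r1, m1, f1⟩ := ih hd hφ hw s hs hS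
    by_cases ht : s1.reg 0 = 0
    · refine ⟨_, _, ?_, Exec.seq h1 (Exec.ite_false ht (Exec.const s1 0 1 (by omega))),
        ?_, ?_, ?_⟩
      · simpa using hk
      · simp [Config.setReg, ← r1, ht]
      · simp [Config.setReg, m1]
      · intro x h0 hx
        simp [Config.setReg, Function.update_of_ne h0.ne', f1 x h0 hx]
    · refine ⟨_, _, ?_, Exec.seq h1 (Exec.ite_true ht (Exec.const s1 0 0 (by omega))), ?_, ?_, ?_⟩
      · simpa using hk
      · simp [Config.setReg, ← r1, ht]
      · simp [Config.setReg, m1]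
      · intro x h0 hx
        simp [Config.setReg, Function.update_of_ne h0.ne', f1 x h0 hx]
  | and φ ψ ih1 ih2 =>
    have hwφ : Q ^ φ.deg < 2 ^ w := lt_of_le_of_lt (Nat.pow_le_pow_right hQ1 (by simp)) hw
    have hwψ : Q ^ ψ.deg < 2 ^ w := lt_of_le_of_lt (Nat.pow_le_pow_right hQ1 (by simp)) hw
    obtain ⟨k, s1, hk, h1, r1, m1, f1⟩ := ih1 hd hφ.1 hwφ s hs hS
    by_cases ht : s1.reg 0 = 0
    · refine ⟨_, _, ?_, Exec.seq h1 (Exec.ite_false ht (Exec.skip s1)), ?_, m1, f1⟩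
      · simp only [time]; omega
      · simp [← r1, ht]
    · have hs1 : Bdd Q d s1 :=
        ⟨fun x h0 hx => by rw [f1 x h0 hx]; exact hs.1 x h0 hx, by rw [m1]; exact hs.2⟩
      have e1 := f1 1 one_pos hd
      obtain ⟨l, s2, hl, h2, r2, m2, f2⟩ := ih2 hd hφ.2 hwψ s1 hs1 (by rw [e1]; exact hS)
      refine ⟨_, _, ?_, Exec.seq h1 (Exec.ite_true ht h2), ?_, by rw [m2, m1], ?_⟩
      · rw [e1] at hl
        simp only [time]; omega
      · rw [r2, m1, Fm.eval_congr ψ hd hφ.2 f1]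
        simp [← r1, ht]
      · intro x h0 hx
        rw [f2 x h0 hx, f1 x h0 hx]
  | ex x φ ih =>
    obtain ⟨rfl, hφ⟩ := hφ
    set S := s.reg 1 with hSdef
    have hSQ : S ≤ Q := hs.1 1 one_pos hd
    have hQw : Q < 2 ^ w := lt_of_le_of_lt
      (by simpa using Nat.pow_le_pow_right hQ1 (Fm.deg_pos φ)) hw
    -- The loop, started with the counter at `v`, searches for a witness below `v`.
    have main : ∀ v, v ≤ S → ∀ s1 : Config, s1.reg x = v → s1.mem = s.mem →
        (∀ y, 0 < y → y < x → s1.reg y = s.reg y) →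
        ∃ k s', k ≤ v * (φ.time S + 5) + 1 ∧
          Exec w (.loop x (.seq (.seq (.const (x + 1) 1) (.arith .sub x x (x + 1)))
            (.seq (φ.compile (x + 1)) (.ite 0 (.const x 0) .skip)))) s1 k s' ∧
          (v ≠ 0 → (s'.reg 0 ≠ 0 ↔ ∃ u < v, φ.Eval s.mem (Function.update s.reg x u))) ∧
          s'.mem = s.mem ∧ ∀ y, 0 < y → y < x → s'.reg y = s.reg y := by
      intro v
      induction v with
      | zero =>
        intro _ s1 hx1 hm1 hf1
        exact ⟨1, s1, by omega, Exec.loop_stop hx1, by simp, hm1, hf1⟩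
      | succ v ihv =>
        intro hv s1 hx1 hm1 hf1
        have a1 := Exec.const (w := w) s1 (x + 1) 1 hw1
        have a2 := Exec.arith (w := w) (s1.setReg (x + 1) 1) .sub x x (x + 1)
          (by simp [BinOp.eval, Config.setReg, hx1]; omega)
        set s2 := (s1.setReg (x + 1) 1).setReg x (BinOp.sub.eval ((s1.setReg (x + 1) 1).reg x)
          ((s1.setReg (x + 1) 1).reg (x + 1))) with hs2
        have x2 : s2.reg x = v := by simp [hs2, Config.setReg, BinOp.eval, hx1]
        have m2 : s2.mem = s.mem := by simp [hs2, Config.setReg, hm1]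
        have f2 : ∀ y, 0 < y → y < x → s2.reg y = s.reg y := by
          intro y h0 hy
          have h1 : y ≠ x := by omega
          have h2 : y ≠ x + 1 := by omega
          simp [hs2, Config.setReg, Function.update_of_ne h1, Function.update_of_ne h2,
            hf1 y h0 hy]
        have b2 : Bdd Q (x + 1) s2 := by
          refine ⟨fun y h0 hy => ?_, by rw [m2]; exact hs.2⟩
          rcases eq_or_ne y x with rfl | hyx
          · rw [x2]; omega
          · rw [f2 y h0 (by omega)]; exact hs.1 y h0 (by omega)
        have S2 : s2.reg 1 = S := f2 1 one_pos hd
        obtain ⟨k, s3, hk, h3, r3, m3, f3⟩ := ih (d := x + 1) (by omega) hφ hw s2 b2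
          (by rw [S2]; exact hS)
        rw [S2] at hk
        have ev : φ.Eval s2.mem s2.reg ↔ φ.Eval s.mem (Function.update s.reg x v) := by
          rw [m2]
          refine Fm.eval_congr (d := x + 1) φ (by omega) hφ fun y h0 hy => ?_
          rcases eq_or_ne y x with rfl | hyx
          · simp [x2]
          · rw [Function.update_of_ne hyx, f2 y h0 (by omega)]
        have x3 : s3.reg x = v := by rw [f3 x (by omega) (by omega), x2]
        have f3' : ∀ y, 0 < y → y < x → s3.reg y = s.reg y := fun y h0 hy => by
          rw [f3 y h0 (by omega), f2 y h0 hy]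
        have hne : s1.reg x ≠ 0 := by omega
        by_cases ht : s3.reg 0 = 0
        · obtain ⟨l, s4, hl, h4, r4, m4, f4⟩ := ihv (by omega) s3 x3 (m3.trans m2) f3'
          refine ⟨_, s4, ?_, Exec.loop_step hne (Exec.seq (Exec.seq a1 a2)
            (Exec.seq h3 (Exec.ite_false ht (Exec.skip s3)))) h4, ?_, m4, f4⟩
          · rw [Nat.succ_mul]; omega
          · intro _
            have nv : ¬ φ.Eval s.mem (Function.update s.reg x v) := by
              rw [← ev, ← r3]; simp [ht]
            rcases Nat.eq_zero_or_pos v with rfl | hv0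
            · have : s4 = s3 := by
                cases h4 with
                | loop_stop => rfl
                | loop_step hx => exact absurd x3 hx
              simp [this, ht, nv]
            · rw [r4 (by omega)]
              constructor
              · rintro ⟨u, hu, h⟩; exact ⟨u, by omega, h⟩
              · rintro ⟨u, hu, h⟩
                rcases eq_or_ne u v with rfl | huv
                · exact absurd h nv
                · exact ⟨u, by omega, h⟩
        · have yv : φ.Eval s.mem (Function.update s.reg x v) := by
            rw [← ev, ← r3]; exact ht
          refine ⟨_, s3.setReg x 0, ?_, Exec.loop_step hne (Exec.seq (Exec.seq a1 a2)
            (Exec.seq h3 (Exec.ite_true ht (Exec.const s3 x 0 (by omega)))))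
            (Exec.loop_stop (by simp [Config.setReg])), ?_, ?_, ?_⟩
          · rw [Nat.succ_mul]; omega
          · intro _
            have h0x : (0 : ℕ) ≠ x := by omega
            simp only [Config.setReg, Function.update_of_ne h0x]
            exact ⟨fun _ => ⟨v, by omega, yv⟩, fun _ => ht⟩
          · simp [Config.setReg, m3, m2]
          · intro y h0 hy
            have : y ≠ x := by omega
            simp [Config.setReg, Function.update_of_ne this, f3' y h0 hy]
    have h1x : (1 : ℕ) ≠ x := by omega
    obtain ⟨k, s', hk, h, r, m, f⟩ := main S le_rfl
      ((s.setReg x 0).setReg x S) (by simp [Config.setReg]) rfl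
      (fun y _ hy => by
        have : y ≠ x := by omega
        simp [Config.setReg, Function.update_of_ne this])
    have c := Exec.arith (w := w) (s.setReg x 0) .add x 1 x
      (by simpa [BinOp.eval, Config.setReg, Function.update_of_ne h1x] using lt_of_le_of_lt hSQ hQw)
    have e : BinOp.add.eval ((s.setReg x 0).reg 1) ((s.setReg x 0).reg x) = S := by
      simp [BinOp.eval, Config.setReg, Function.update_of_ne h1x, hSdef]
    rw [e] at c
    refine ⟨_, s', ?_, Exec.seq (Exec.seq (Exec.const s x 0 (by omega)) c) h, r (by omega), m, f⟩
    simp only [time]; omega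

/-- The time for the evaluation of a fixed formula is polynomial in the range of its quantifiers. -/
theorem Fm.exists_time_le (φ : Fm) : ∃ e, ∀ S, 2 ≤ S → φ.time S ≤ S ^ e := by
  have two : ∀ S k : ℕ, 2 ≤ S → k ≤ S ^ k := fun S k hS =>
    (Nat.lt_two_pow_self).le.trans (Nat.pow_le_pow_left hS k)
  have add : ∀ S a b x y : ℕ, 2 ≤ S → x ≤ S ^ a → y ≤ S ^ b → x + y ≤ S ^ (a + b + 1) :=
    fun S a b x y hS hx hy => BinOp.eval_le_pow hS .add hx hy
  induction φ with
  | nz t => exact ⟨t.time + 2, fun S hS => two S _ hS⟩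
  | neg φ ih =>
    obtain ⟨e, he⟩ := ih
    exact ⟨e + 2 + 1, fun S hS => add S _ _ _ _ hS (he S hS) (two S 2 hS)⟩
  | and φ ψ ih1 ih2 =>
    obtain ⟨e, he⟩ := ih1
    obtain ⟨e', he'⟩ := ih2
    exact ⟨_, fun S hS => add S _ _ _ _ hS (add S _ _ _ _ hS (he S hS) (he' S hS)) (two S 2 hS)⟩
  | ex x φ ih =>
    obtain ⟨e, he⟩ := ih
    refine ⟨1 + (e + 5 + 1) + 3 + 1, fun S hS => add S _ _ _ _ hS ?_ (two S 3 hS)⟩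
    rw [pow_add, pow_one]
    exact Nat.mul_le_mul_left _ (add S _ _ _ _ hS (he S hS) (two S 5 hS))

/-! ### Total correctness with a time bound -/

/-- Registers `1, …, 19` are program variables; register `0` and those from `20` on are scratch. -/
abbrev numVars : ℕ := 20

@[simp] theorem numVars_eq : numVars = 20 := rfl

/-- Equality of configurations up to the contents of scratch registers. -/
def Sim (σ s : Config) : Prop :=
  s.mem = σ.mem ∧ ∀ x, 0 < x → x < numVars → s.reg x = σ.reg x

/-- Total correctness: on a machine with words of `w` bits, the program `P` started in `σ` halts
within `T` steps, in a configuration that has property `Post` and whose variables and memory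
cells hold at most `Q`. Scratch registers are ignored before and after the run. -/
def HT (w Q : ℕ) (P : Cmd) (T : ℕ) (σ : Config) (Post : Config → Prop) : Prop :=
  ∃ σ', Post σ' ∧ Bdd Q numVars σ' ∧
    ∀ s, Sim σ s → ∃ k s', k ≤ T ∧ Exec w P s k s' ∧ Sim σ' s'

/-- `x := t` -/
def setTm (x : ℕ) (t : Tm) : Cmd :=
  .seq (t.compile numVars) (.seq (.const 0 0) (.arith .add x numVars 0))

/-- `M[a] := v` -/
def putTm (a v : Tm) : Cmd :=
  .seq (.seq (a.compile numVars) (v.compile (numVars + 1))) (.store numVars (numVars + 1))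

/-- if `φ` then `P` else `R` -/
def iteFm (φ : Fm) (P R : Cmd) : Cmd :=
  .seq (φ.compile numVars) (.ite 0 P R)

/-- for `x` from `0` to `y - 1` do `P` -/
def forLoop (x y : ℕ) (P : Cmd) : Cmd :=
  .seq (.seq (setTm x (.const 0)) (.arith .sub 0 y x))
    (.loop 0 (.seq P (.seq (setTm x (.op .add (.var x) (.const 1))) (.arith .sub 0 y x))))

variable {w Q : ℕ}

theorem HT.mono {P : Cmd} {T T' : ℕ} {σ : Config} {Post Post' : Config → Prop}
    (h : HT w Q P T σ Post) (hT : T ≤ T') (hP : ∀ σ', Bdd Q numVars σ' → Post σ' → Post' σ') :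
    HT w Q P T' σ Post' := by
  obtain ⟨σ', h1, h2, h3⟩ := h
  refine ⟨σ', hP σ' h2 h1, h2, fun s hs => ?_⟩
  obtain ⟨k, s', hk, h⟩ := h3 s hs
  exact ⟨k, s', hk.trans hT, h⟩

theorem HT.le {P : Cmd} {T T' : ℕ} {σ : Config} {Post : Config → Prop}
    (h : HT w Q P T σ Post) (hT : T ≤ T') : HT w Q P T' σ Post :=
  h.mono hT fun _ _ h => h

theorem HT.seq {P R : Cmd} {T U : ℕ} {σ : Config} {Post Post' : Config → Prop}
    (h : HT w Q P T σ Post') (h' : ∀ σ', Bdd Q numVars σ' → Post' σ' → HT w Q R U σ' Post) :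
    HT w Q (.seq P R) (T + U) σ Post := by
  obtain ⟨σ1, h1, h2, h3⟩ := h
  obtain ⟨σ2, h4, h5, h6⟩ := h' σ1 h2 h1
  refine ⟨σ2, h4, h5, fun s hs => ?_⟩
  obtain ⟨k, s', hk, e, hs'⟩ := h3 s hs
  obtain ⟨l, s'', hl, e', hs''⟩ := h6 s' hs'
  exact ⟨_, s'', by omega, Exec.seq e e', hs''⟩

theorem Bdd.of_sim {σ s : Config} (h : Bdd Q numVars σ) (hs : Sim σ s) : Bdd Q numVars s :=
  ⟨fun x h0 hx => by rw [hs.2 x h0 hx]; exact h.1 x h0 hx, by rw [hs.1]; exact h.2⟩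

theorem Bdd.setReg {σ : Config} (h : Bdd Q numVars σ) (x : ℕ) {v : ℕ} (hv : v ≤ Q) :
    Bdd Q numVars (σ.setReg x v) := by
  refine ⟨fun y h0 hy => ?_, h.2⟩
  rcases eq_or_ne y x with rfl | hyx
  · simpa [Config.setReg]
  · simpa [Config.setReg, Function.update_of_ne hyx] using h.1 y h0 hy

theorem Bdd.setMem {σ : Config} (h : Bdd Q numVars σ) (a : ℕ) {v : ℕ} (hv : v ≤ Q) :
    Bdd Q numVars (σ.setMem a v) := by
  refine ⟨h.1, fun b => ?_⟩
  rcases eq_or_ne b a with rfl | hb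
  · simpa [Config.setMem]
  · simpa [Config.setMem, Function.update_of_ne hb] using h.2 b

theorem Tm.eval_sim {σ s : Config} (hs : Sim σ s) (t : Tm) (ht : t.WF numVars) :
    t.eval s.reg s.mem = t.eval σ.reg σ.mem := by
  rw [hs.1]; exact Tm.eval_congr t ht hs.2

theorem HT.setTm (hQ : 2 ≤ Q) {x : ℕ} {t : Tm} {σ : Config} {Post : Config → Prop}
    (hσ : Bdd Q numVars σ) (hx : 0 < x ∧ x < numVars) (ht : t.WF numVars) (hw : Q ^ t.deg < 2 ^ w)
    (hv : t.eval σ.reg σ.mem ≤ Q) (hP : Post (σ.setReg x (t.eval σ.reg σ.mem))) :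
    HT w Q (setTm x t) (t.time + 2) σ Post := by
  refine ⟨_, hP, hσ.setReg x hv, fun s hs => ?_⟩
  obtain ⟨s1, h1, r1, m1, f1⟩ :=
    Tm.exec_compile (e := numVars) hQ le_rfl t ht hw s (hσ.of_sim hs)
  rw [Tm.eval_sim hs t ht] at r1
  have hle := Tm.eval_le hQ hσ t ht
  have hD : numVars ≠ 0 := by decide
  refine ⟨_, _, le_rfl, Exec.seq h1 (Exec.seq (Exec.const s1 0 0 (by positivity))
    (Exec.arith _ .add x numVars 0 ?_)), ?_, ?_⟩
  · simp only [BinOp.eval, Config.setReg, Function.update_self, Function.update_of_ne hD, r1]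
    omega
  · simp [Config.setReg, m1, hs.1]
  · intro y h0 hy
    have hy0 : y ≠ 0 := by omega
    rcases eq_or_ne y x with rfl | hyx
    · simp only [Config.setReg, BinOp.eval, Function.update_self, Function.update_of_ne hD, r1,
        add_zero]
    · simp only [Config.setReg, Function.update_of_ne hyx, Function.update_of_ne hy0]
      rw [f1 y hy, hs.2 y h0 hy]

theorem HT.putTm (hQ : 2 ≤ Q) {a v : Tm} {σ : Config} {Post : Config → Prop}
    (hσ : Bdd Q numVars σ) (ha : a.WF numVars) (hv : v.WF numVars) (hwa : Q ^ a.deg < 2 ^ w)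
    (hwv : Q ^ v.deg < 2 ^ w) (hvQ : v.eval σ.reg σ.mem ≤ Q)
    (hP : Post (σ.setMem (a.eval σ.reg σ.mem) (v.eval σ.reg σ.mem))) :
    HT w Q (putTm a v) (a.time + v.time + 1) σ Post := by
  refine ⟨_, hP, hσ.setMem _ hvQ, fun s hs => ?_⟩
  obtain ⟨s1, h1, r1, m1, f1⟩ :=
    Tm.exec_compile (e := numVars) hQ le_rfl a ha hwa s (hσ.of_sim hs)
  rw [Tm.eval_sim hs a ha] at r1
  have hs1 : Sim σ s1 :=
    ⟨m1.trans hs.1, fun x h0 hx => by rw [f1 x hx, hs.2 x h0 hx]⟩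
  obtain ⟨s2, h2, r2, m2, f2⟩ :=
    Tm.exec_compile (e := numVars + 1) hQ (Nat.le_succ _) v hv hwv s1 (hσ.of_sim hs1)
  rw [Tm.eval_sim hs1 v hv] at r2
  refine ⟨_, _, le_rfl, Exec.seq (Exec.seq h1 h2) (Exec.store s2 numVars (numVars + 1)), ?_, ?_⟩
  · rw [f2 _ (Nat.lt_succ_self _), r1, r2]
    simp [Config.setMem, m2, m1, hs.1]
  · intro y h0 hy
    simp only [Config.setMem]
    rw [f2 y (by omega), hs1.2 y h0 hy]

theorem HT.iteFm (hQ : 2 ≤ Q) {φ : Fm} {P R : Cmd} {σ : Config} {Post : Config → Prop} {T : ℕ}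
    (hσ : Bdd Q numVars σ) (hφ : φ.WF numVars) (hw : Q ^ φ.deg < 2 ^ w) (hS : 1 ≤ σ.reg 1)
    (hP : φ.Eval σ.mem σ.reg → HT w Q P T σ Post)
    (hR : ¬ φ.Eval σ.mem σ.reg → HT w Q R T σ Post) :
    HT w Q (iteFm φ P R) (φ.time (σ.reg 1) + (T + 1)) σ Post := by
  have key : ∀ s, Sim σ s → ∃ k s', k ≤ φ.time (σ.reg 1) ∧ Exec w (φ.compile numVars) s k s' ∧
      (s'.reg 0 ≠ 0 ↔ φ.Eval σ.mem σ.reg) ∧ Sim σ s' := by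
    intro s hs
    have h1 : s.reg 1 = σ.reg 1 := hs.2 1 (by decide) (by decide)
    obtain ⟨k, s1, hk, e1, r1, m1, f1⟩ :=
      Fm.exec_compile hQ (by decide) φ hφ hw s (hσ.of_sim hs) (by rw [h1]; exact hS)
    rw [h1] at hk
    refine ⟨k, s1, hk, e1, ?_, m1.trans hs.1, fun x h0 hx => by rw [f1 x h0 hx, hs.2 x h0 hx]⟩
    rw [r1, hs.1, Fm.eval_congr φ (by decide) hφ hs.2]
  by_cases h : φ.Eval σ.mem σ.reg
  · obtain ⟨σ', h1, h2, h3⟩ := hP h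
    refine ⟨σ', h1, h2, fun s hs => ?_⟩
    obtain ⟨k, s1, hk, e1, r1, hs1⟩ := key s hs
    obtain ⟨l, s2, hl, e2, hs2⟩ := h3 s1 hs1
    exact ⟨_, s2, by omega, Exec.seq e1 (Exec.ite_true (r1.2 h) e2), hs2⟩
  · obtain ⟨σ', h1, h2, h3⟩ := hR h
    refine ⟨σ', h1, h2, fun s hs => ?_⟩
    obtain ⟨k, s1, hk, e1, r1, hs1⟩ := key s hs
    obtain ⟨l, s2, hl, e2, hs2⟩ := h3 s1 hs1
    exact ⟨_, s2, by omega, Exec.seq e1 (Exec.ite_false (by simpa using mt r1.1 h) e2), hs2⟩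

/-- The rule for counting loops: `I k` holds before round `k`, with the counter already set
to `k`; round `k` takes at most `T k` steps. -/
theorem HT.forLoop (hQ : 2 ≤ Q) (hw : Q ^ 4 < 2 ^ w) {x y m : ℕ} {P : Cmd} {σ : Config}
    {Post : Config → Prop} {T : ℕ → ℕ} (I : ℕ → Config → Prop)
    (hσ : Bdd Q numVars σ) (hx : 0 < x ∧ x < numVars) (hy : 0 < y ∧ y < numVars) (hxy : y ≠ x)
    (hm : σ.reg y = m) (h0 : I 0 (σ.setReg x 0))
    (hstep : ∀ k σ', k < m → Bdd Q numVars σ' → σ'.reg x = k → σ'.reg y = m → I k σ' →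
      HT w Q P (T k) σ' fun σ'' => σ''.reg x = k ∧ σ''.reg y = m ∧ I (k + 1) (σ''.setReg x (k + 1)))
    (hend : ∀ σ', Bdd Q numVars σ' → I m σ' → Post σ') :
    HT w Q (forLoop x y P) (∑ k ∈ Finset.range m, (T k + 8) + 5) σ Post := by
  have hQw : Q < 2 ^ w := lt_of_le_of_lt (Nat.le_self_pow (by decide) Q) hw
  have hmQ : m ≤ Q := hm ▸ hσ.1 y hy.1 hy.2
  -- The loop is treated backwards, from the last rounds to the first ones.
  have main : ∀ j k, k + j = m → ∀ σ1, Bdd Q numVars σ1 → σ1.reg x = k → σ1.reg y = m → I k σ1 →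
      ∃ σ', Post σ' ∧ Bdd Q numVars σ' ∧ ∀ s, Sim σ1 s → s.reg 0 = j →
        ∃ l s', l ≤ ∑ i ∈ Finset.range j, (T (k + i) + 8) + 1 ∧
          Exec w (.loop 0 (.seq P (.seq (HFreeBipartitioning.setTm x (.op .add (.var x) (.const 1)))
            (.arith .sub 0 y x)))) s l s' ∧ Sim σ' s' := by
    intro j
    induction j with
    | zero =>
      intro k hk σ1 b1 _ _ i1
      obtain rfl : k = m := by omega
      exact ⟨σ1, hend σ1 b1 i1, b1, fun s hs h => ⟨1, s, by simp, Exec.loop_stop h, hs⟩⟩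
    | succ j ih =>
      intro k hk σ1 b1 x1 y1 i1
      obtain ⟨σ2, ⟨x2, y2, i2⟩, b2, h2⟩ := hstep k σ1 (by omega) b1 x1 y1 i1
      have hk1 : (Tm.op .add (.var x) (.const 1)).eval σ2.reg σ2.mem = k + 1 := by
        simp [BinOp.eval, x2]
      obtain ⟨σ3, e3, b3, h3⟩ := HT.setTm (w := w) (x := x) (t := .op .add (.var x) (.const 1))
        (Post := fun σ' => σ' = σ2.setReg x (k + 1)) hQ b2 hx
        (by simpa using hx) (by simpa using hw) (by rw [hk1]; omega) (by rw [hk1])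
      subst e3
      obtain ⟨σ', p, b, h4⟩ := ih (k + 1) (by omega) _ b3 (by simp [Config.setReg])
        (by simp [Config.setReg, Function.update_of_ne hxy, y2]) i2
      refine ⟨σ', p, b, fun s hs hs0 => ?_⟩
      obtain ⟨l2, s2, hl2, e2, hs2⟩ := h2 s hs
      obtain ⟨l3, s3, hl3, e3, hs3⟩ := h3 s2 hs2
      have rx : s3.reg x = k + 1 := by rw [hs3.2 x hx.1 hx.2]; simp [Config.setReg]
      have ry : s3.reg y = m := by
        rw [hs3.2 y hy.1 hy.2]; simp [Config.setReg, Function.update_of_ne hxy, y2]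
      have e4 := Exec.arith (w := w) s3 .sub 0 y x (by rw [rx, ry]; simp [BinOp.eval]; omega)
      rw [rx, ry] at e4
      obtain ⟨l5, s5, hl5, e5, hs5⟩ := h4 (s3.setReg 0 (BinOp.sub.eval m (k + 1)))
        ⟨hs3.1, fun z hz hz' => by
          rw [← hs3.2 z hz hz']; simp [Config.setReg, Function.update_of_ne hz.ne']⟩
        (by simp [Config.setReg, BinOp.eval]; omega)
      refine ⟨_, s5, ?_, Exec.loop_step (by omega) (Exec.seq e2 (Exec.seq e3 e4)) e5, hs5⟩
      rw [Finset.sum_range_succ']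
      simp only [Tm.time] at hl3
      have : ∑ i ∈ Finset.range j, (T (k + 1 + i) + 8) =
          ∑ i ∈ Finset.range j, (T (k + (i + 1)) + 8) :=
        Finset.sum_congr rfl fun i _ => by rw [show k + 1 + i = k + (i + 1) by ring]
      simp only [add_zero]
      omega
  obtain ⟨σ1, e1, b1, h1⟩ := HT.setTm (w := w) (x := x) (t := .const 0)
    (Post := fun σ' => σ' = σ.setReg x 0) hQ hσ hx trivial
    (lt_of_le_of_lt (Nat.pow_le_pow_right (by omega) (by simp)) hw) (by simp) (by simp)
  subst e1
  obtain ⟨σ', p, b, h4⟩ := main m 0 (by omega) _ b1 (by simp [Config.setReg])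
    (by simp [Config.setReg, Function.update_of_ne hxy, hm]) h0
  refine ⟨σ', p, b, fun s hs => ?_⟩
  obtain ⟨l1, s1, hl1, e1, hs1⟩ := h1 s hs
  have rx : s1.reg x = 0 := by rw [hs1.2 x hx.1 hx.2]; simp [Config.setReg]
  have ry : s1.reg y = m := by
    rw [hs1.2 y hy.1 hy.2]; simp [Config.setReg, Function.update_of_ne hxy, hm]
  have e2 := Exec.arith (w := w) s1 .sub 0 y x (by rw [rx, ry]; simp [BinOp.eval]; omega)
  rw [rx, ry] at e2
  obtain ⟨l5, s5, hl5, e5, hs5⟩ := h4 (s1.setReg 0 (BinOp.sub.eval m 0))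
    ⟨hs1.1, fun z hz hz' => by
      rw [← hs1.2 z hz hz']; simp [Config.setReg, Function.update_of_ne hz.ne']⟩
    (by simp [Config.setReg, BinOp.eval])
  refine ⟨_, s5, ?_, Exec.seq (Exec.seq e1 e2) e5, hs5⟩
  simp only [Tm.time] at hl1
  simp only [zero_add] at hl5
  omega

/-! ### Partial copies of `H` and the type of a two-colouring -/

/-- The digit number `h` of `f` in base `B`. -/
def dig (B f h : ℕ) : ℕ := f / B ^ h % B

/-- The bit number `g` of `s` is set. -/
def bit (s g : ℕ) : Prop := s / 2 ^ g % 2 = 1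

/-- The position of colour `a` in a list of two blocks of length `F`. -/
def off (F : ℕ) (a : Bool) : ℕ := a.toNat * F

/-- What a bag `b` sees of one entry of a partial map into the vertices: `0` if the map is undefined
there, `1` if its value is outside of the bag, and `p + 2` if its value is entry `p` of the bag. -/
def pcode {V : Type*} [DecidableEq V] (b : List V) : Option V → ℕ
  | none => 0
  | some v => if v ∈ b then b.idxOf v + 2 else 1

section Types

variable {V : Type*} [DecidableEq V] {r : ℕ} (G : SimpleGraph V) (H : SimpleGraph (Fin r)) (B : ℕ)

/-- There is a partial copy of `H` in colour `a` inside of `U`, i.e. an induced copy of an induced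
subgraph of `H`, which the bag `b` sees as the pattern with the digits of `f`. -/
def HasPattern (U : Set V) (b : List V) (χ : V → Bool) (a : Bool) (f : ℕ) : Prop :=
  ∃ φ : Fin r → Option V, (∀ h v, φ h = some v → v ∈ U ∧ χ v = a) ∧
    (∀ h h' u v, h ≠ h' → φ h = some u → φ h' = some v → u ≠ v ∧ (H.Adj h h' ↔ G.Adj u v)) ∧
    ∀ h : Fin r, dig B f h = pcode b (φ h)

/-- The number `s` is the type of the colouring `χ` of `U`: its bits list the patterns of the two
colours. -/
def IsType (U : Set V) (b : List V) (χ : V → Bool) (s : ℕ) : Prop :=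
  s < 2 ^ (2 * B ^ r) ∧
    ∀ a f, f < B ^ r → (bit s (off (B ^ r) a + f) ↔ HasPattern G H B U b χ a f)

/-- The type of some colouring of `U`. -/
def Realizable (U : Set V) (b : List V) (s : ℕ) : Prop := ∃ χ, IsType G H B U b χ s

end Types

/-- The numerical description of the types of the colourings of a single bag with `len` entries,
where `adj` is the adjacency of the entries. -/
def BaseP {r : ℕ} (H : SimpleGraph (Fin r)) (B len : ℕ) (adj : ℕ → ℕ → Prop) (s : ℕ) : Prop :=
  (∀ p < len, (bit s (off (B ^ r) false + (p + 2)) ↔ ¬ bit s (off (B ^ r) true + (p + 2)))) ∧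
    ∀ a, ∀ f < B ^ r, (bit s (off (B ^ r) a + f) ↔
      (∀ h : Fin r, dig B f h ≠ 1 ∧ dig B f h < len + 2 ∧
        (dig B f h ≠ 0 → bit s (off (B ^ r) a + dig B f h))) ∧
      ∀ h h' : Fin r, h ≠ h' → dig B f h ≠ 0 → dig B f h' ≠ 0 →
        dig B f h ≠ dig B f h' ∧ (H.Adj h h' ↔ adj (dig B f h - 2) (dig B f h' - 2)))

/-- How the bag entries of a partial map into `U₁ ∪ U₂` and of its restrictions to `U₁` and `U₂` are
related; `eqv p q` says that entry `p` of the first bag is entry `q` of the second one. The four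
cases are: undefined, with a value only in `U₁`, only in `U₂`, and in both. -/
def GlueDigit (len₁ len₂ : ℕ) (eqv : ℕ → ℕ → Prop) (d₁ d₂ d : ℕ) : Prop :=
  (d₁ = 0 ∧ d₂ = 0 ∧ d = 0) ∨
  (d₁ ≠ 0 ∧ d₂ = 0 ∧ d = d₁ ∧ (2 ≤ d₁ → ∀ q < len₂, ¬ eqv (d₁ - 2) q)) ∨
  (d₁ = 0 ∧ d₂ ≠ 0 ∧ d = 1 ∧ (2 ≤ d₂ → ∀ p < len₁, ¬ eqv p (d₂ - 2))) ∨
  (2 ≤ d₁ ∧ 2 ≤ d₂ ∧ eqv (d₁ - 2) (d₂ - 2) ∧ d = d₁)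

/-- The numerical description of how a type for `U₁` and a type for `U₂` are glued to a type
for `U₁ ∪ U₂`. -/
def GlueP {r : ℕ} (H : SimpleGraph (Fin r)) (B len₁ len₂ : ℕ) (eqv : ℕ → ℕ → Prop)
    (s₁ s₂ s : ℕ) : Prop :=
  (∀ p < len₁, ∀ q < len₂, eqv p q → ∀ a,
    (bit s₁ (off (B ^ r) a + (p + 2)) ↔ bit s₂ (off (B ^ r) a + (q + 2)))) ∧
  ∀ a, ∀ f < B ^ r, (bit s (off (B ^ r) a + f) ↔
    ∃ f₁ < B ^ r, ∃ f₂ < B ^ r, bit s₁ (off (B ^ r) a + f₁) ∧ bit s₂ (off (B ^ r) a + f₂) ∧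
      (∀ h : Fin r, GlueDigit len₁ len₂ eqv (dig B f₁ h) (dig B f₂ h) (dig B f h)) ∧
      ∀ h h' : Fin r, H.Adj h h' → dig B f₁ h ≠ 0 → dig B f₂ h = 0 → dig B f₁ h' = 0 →
        dig B f₂ h' = 0)

/-- A type without complete copies of `H` in which both colours occur. -/
def FinalP (r B s : ℕ) : Prop :=
  (∀ a, ∀ f < B ^ r, bit s (off (B ^ r) a + f) → ∃ h : Fin r, dig B f h = 0) ∧
    ∀ a, ∃ d < B, d ≠ 0 ∧ bit s (off (B ^ r) a + d)

theorem bit_iff_testBit (s g : ℕ) : bit s g ↔ s.testBit g = true := by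
  rw [Nat.testBit_eq_decide_div_mod_eq, decide_eq_true_iff, bit]

theorem exists_forall_dig_eq {r B : ℕ} (d : Fin r → ℕ) (hd : ∀ h, d h < B) :
    ∃ f < B ^ r, ∀ h : Fin r, dig B f h = d h := by
  refine ⟨finFunctionFinEquiv fun h => ⟨d h, hd h⟩, Fin.is_lt _, fun h => ?_⟩
  have := congrFun (finFunctionFinEquiv.symm_apply_apply fun h => (⟨d h, hd h⟩ : Fin B)) h
  exact congrArg Fin.val this

theorem dig_of_lt {B d : ℕ} (hd : d < B) (h : ℕ) : dig B d h = if h = 0 then d else 0 := by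
  unfold dig
  split_ifs with h0
  · simp [h0, Nat.mod_eq_of_lt hd]
  · have : d < B ^ h := lt_of_lt_of_le hd (Nat.le_self_pow h0 B)
    simp [Nat.div_eq_of_lt this]

section Types

variable {V : Type*} [DecidableEq V] {r : ℕ} {G : SimpleGraph V} {H : SimpleGraph (Fin r)} {B : ℕ}
  {U U₁ U₂ : Set V} {b b₁ b₂ : List V} {χ χ' : V → Bool} {s s₁ s₂ : ℕ} {a : Bool} {f : ℕ}

theorem pcode_lt (hB : b.length + 2 ≤ B) (o : Option V) : pcode b o < B := by
  cases o with
  | none => simp [pcode]; omega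
  | some v =>
    simp only [pcode]
    split_ifs with h
    · have := List.idxOf_lt_length_of_mem h
      omega
    · omega

theorem pcode_eq_zero {o : Option V} : pcode b o = 0 ↔ o = none := by
  cases o with
  | none => simp [pcode]
  | some v => simp only [pcode]; split_ifs <;> simp

theorem pcode_getElem (hb : b.Nodup) {p : ℕ} (hp : p < b.length) :
    pcode b (some b[p]) = p + 2 := by
  simp [pcode, List.getElem_mem, hb.idxOf_getElem p hp]

theorem pcode_eq_add_two (hb : b.Nodup) {p : ℕ} (hp : p < b.length) {v : V} :
    pcode b (some v) = p + 2 ↔ v = b[p] := by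
  constructor
  · intro h
    simp only [pcode] at h
    split_ifs at h with hv
    · obtain rfl : b.idxOf v = p := by omega
      simp
    · omega
  · rintro rfl
    exact pcode_getElem hb hp

theorem HasPattern.congr (h : ∀ v ∈ U, χ v = χ' v) :
    HasPattern G H B U b χ a f ↔ HasPattern G H B U b χ' a f := by
  refine exists_congr fun φ => and_congr_left fun _ => ?_
  refine forall_congr' fun i => forall_congr' fun v => imp_congr_right fun _ => ?_
  exact and_congr_right fun hv => by rw [h v hv]

theorem IsType.congr (h : ∀ v ∈ U, χ v = χ' v) (hs : IsType G H B U b χ s) :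
    IsType G H B U b χ' s :=
  ⟨hs.1, fun a f hf => (hs.2 a f hf).trans (HasPattern.congr h)⟩

variable (G H B U b χ) in
theorem exists_isType : ∃ s, IsType G H B U b χ s := by
  classical
  refine ⟨Nat.ofBits fun g : Fin (2 * B ^ r) =>
    decide (HasPattern G H B U b χ (decide (B ^ r ≤ g)) (g % B ^ r)), Nat.ofBits_lt_two_pow _, ?_⟩
  intro a f hf
  have hlt : off (B ^ r) a + f < 2 * B ^ r := by cases a <;> simp [off] <;> omega
  rw [bit_iff_testBit, Nat.testBit_ofBits_lt _ _ hlt, decide_eq_true_iff]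
  cases a
  · have h1 : ¬ B ^ r ≤ f := by omega
    simp [off, h1, Nat.mod_eq_of_lt hf]
  · simp [off, Nat.mod_eq_of_lt hf]

/-- The patterns of the partial copies of `H` with a single vertex are the one-digit numbers. -/
theorem hasPattern_single (hr : 0 < r) {d : ℕ} (hd : d < B) (hd0 : d ≠ 0) :
    HasPattern G H B U b χ a d ↔ ∃ v ∈ U, χ v = a ∧ pcode b (some v) = d := by
  constructor
  · rintro ⟨φ, h1, -, h3⟩
    have h := h3 ⟨0, hr⟩
    rw [dig_of_lt hd, if_pos rfl] at h
    cases hφ : φ ⟨0, hr⟩ with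
    | none => rw [hφ] at h; exact absurd h hd0
    | some v =>
      rw [hφ] at h
      exact ⟨v, (h1 _ v hφ).1, (h1 _ v hφ).2, h.symm⟩
  · rintro ⟨v, hv, hχ, hp⟩
    refine ⟨fun h => if (h : ℕ) = 0 then some v else none, ?_, ?_, ?_⟩
    · intro h u hu
      dsimp only at hu
      split_ifs at hu
      cases hu
      exact ⟨hv, hχ⟩
    · intro h h' u u' hne hu hu'
      dsimp only at hu hu'
      split_ifs at hu hu' with h0 h0'
      exact absurd (Fin.ext (h0.trans h0'.symm)) hne
    · intro h
      rw [dig_of_lt hd]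
      dsimp only
      split_ifs
      · exact hp.symm
      · rfl

theorem bit_single (hr : 0 < r) (hs : IsType G H B U b χ s) {d : ℕ} (hd : d < B) (hd0 : d ≠ 0) :
    bit s (off (B ^ r) a + d) ↔ ∃ v ∈ U, χ v = a ∧ pcode b (some v) = d := by
  rw [hs.2 a d (lt_of_lt_of_le hd (Nat.le_self_pow hr.ne' B)), hasPattern_single hr hd hd0]

/-- The type of a colouring determines the colours of the bag. -/
theorem bit_color (hr : 0 < r) (hs : IsType G H B U b χ s) (hb : b.Nodup) (hU : ∀ v ∈ b, v ∈ U)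
    (hB : b.length + 2 ≤ B) {p : ℕ} (hp : p < b.length) :
    bit s (off (B ^ r) a + (p + 2)) ↔ χ b[p] = a := by
  rw [bit_single hr hs (by omega) (by omega)]
  constructor
  · rintro ⟨v, _, hχ, hv⟩
    rw [pcode_eq_add_two hb hp] at hv
    rw [← hv]; exact hχ
  · intro h
    exact ⟨_, hU _ (List.getElem_mem hp), h, pcode_getElem hb hp⟩

theorem hasPattern_bag (hb : b.Nodup)
    {adj : ℕ → ℕ → Prop} (hadj : ∀ p q (hp : p < b.length) (hq : q < b.length),
      adj p q ↔ G.Adj b[p] b[q])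
    (hcol : ∀ p (hp : p < b.length), bit s (off (B ^ r) a + (p + 2)) ↔ χ b[p] = a) :
    HasPattern G H B {v | v ∈ b} b χ a f ↔
      (∀ h : Fin r, dig B f h ≠ 1 ∧ dig B f h < b.length + 2 ∧
        (dig B f h ≠ 0 → bit s (off (B ^ r) a + dig B f h))) ∧
      ∀ h h' : Fin r, h ≠ h' → dig B f h ≠ 0 → dig B f h' ≠ 0 →
        dig B f h ≠ dig B f h' ∧ (H.Adj h h' ↔ adj (dig B f h - 2) (dig B f h' - 2)) := by
  constructor
  · rintro ⟨φ, h1, h2, h3⟩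
    -- Every digit of the pattern is `0` or names an entry of the bag.
    have key : ∀ h, (φ h = none ∧ dig B f h = 0) ∨
        ∃ p, ∃ hp : p < b.length, φ h = some b[p] ∧ dig B f h = p + 2 := by
      intro h
      cases hφ : φ h with
      | none => exact Or.inl ⟨rfl, by rw [h3, hφ]; rfl⟩
      | some v =>
        have hv : v ∈ b := (h1 h v hφ).1
        obtain ⟨p, hp, rfl⟩ := List.getElem_of_mem hv
        exact Or.inr ⟨p, hp, rfl, by rw [h3, hφ, pcode_getElem hb hp]⟩
    constructor
    · intro h
      rcases key h with ⟨_, h0⟩ | ⟨p, hp, hφ, hd⟩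
      · rw [h0]; simp
      · rw [hd]
        exact ⟨by omega, by omega, fun _ => (hcol p hp).2 (h1 h _ hφ).2⟩
    · intro h h' hne hd hd'
      rcases key h with ⟨_, h0⟩ | ⟨p, hp, hφ, hdp⟩
      · exact absurd h0 hd
      rcases key h' with ⟨_, h0⟩ | ⟨q, hq, hφ', hdq⟩
      · exact absurd h0 hd'
      obtain ⟨huv, hA⟩ := h2 h h' _ _ hne hφ hφ'
      rw [hdp, hdq, Nat.add_sub_cancel, Nat.add_sub_cancel, hadj p q hp hq]
      refine ⟨?_, hA⟩
      intro hpq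
      obtain rfl : p = q := by omega
      exact huv rfl
  · rintro ⟨h1, h2⟩
    have key : ∀ h : Fin r, ∀ v, (if dig B f h = 0 then none else b[dig B f h - 2]?) = some v →
        dig B f h ≠ 0 ∧ ∃ hp : dig B f h - 2 < b.length, v = b[dig B f h - 2] := by
      intro h v hv
      split_ifs at hv with h0
      refine ⟨h0, ?_⟩
      have hp : dig B f h - 2 < b.length := by have := h1 h; omega
      rw [List.getElem?_eq_getElem hp] at hv
      exact ⟨hp, (Option.some.inj hv).symm⟩
    refine ⟨fun h => if dig B f h = 0 then none else b[dig B f h - 2]?, ?_, ?_, ?_⟩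
    · intro h v hv
      obtain ⟨h0, hp, rfl⟩ := key h v hv
      refine ⟨List.getElem_mem hp, (hcol _ hp).1 ?_⟩
      have e : dig B f h - 2 + 2 = dig B f h := by have := h1 h; omega
      rw [e]
      exact (h1 h).2.2 h0
    · intro h h' u v hne hu hv
      obtain ⟨h0, hp, rfl⟩ := key h u hu
      obtain ⟨h0', hq, rfl⟩ := key h' v hv
      obtain ⟨hd, hA⟩ := h2 h h' hne h0 h0'
      refine ⟨fun e => hd ?_, hA.trans (hadj _ _ hp hq)⟩
      have := (hb.getElem_inj_iff (hi := hp) (hj := hq)).1 e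
      have := h1 h
      have := h1 h'
      omega
    · intro h
      have := h1 h
      dsimp only
      split_ifs with h0
      · simpa [pcode] using h0
      · have hp : dig B f h - 2 < b.length := by omega
        rw [List.getElem?_eq_getElem hp, pcode_getElem hb hp]
        omega

theorem realizable_bag (hr : 0 < r) (hb : b.Nodup) (hB : b.length + 2 ≤ B)
    {adj : ℕ → ℕ → Prop} (hadj : ∀ p q (hp : p < b.length) (hq : q < b.length),
      adj p q ↔ G.Adj b[p] b[q]) (hs : s < 2 ^ (2 * B ^ r)) :
    Realizable G H B {v | v ∈ b} b s ↔ BaseP H B b.length adj s := by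
  classical
  constructor
  · rintro ⟨χ, hχ⟩
    have hcol : ∀ a p (hp : p < b.length), bit s (off (B ^ r) a + (p + 2)) ↔ χ b[p] = a :=
      fun a p hp => bit_color hr hχ hb (fun v hv => hv) hB hp
    refine ⟨fun p hp => ?_, fun a f hf => ?_⟩
    · rw [hcol _ p hp, hcol _ p hp]; simp
    · rw [hχ.2 a f hf, hasPattern_bag hb hadj (hcol a)]
  · rintro ⟨h1, h2⟩
    set χ : V → Bool := fun v => decide (bit s (off (B ^ r) true + (b.idxOf v + 2))) with hχ
    have hcol : ∀ a p (hp : p < b.length), bit s (off (B ^ r) a + (p + 2)) ↔ χ b[p] = a := by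
      intro a p hp
      simp only [hχ, hb.idxOf_getElem p hp]
      cases a
      · rw [h1 p hp]; simp
      · simp
    exact ⟨χ, hs, fun a f hf => by rw [h2 a f hf, hasPattern_bag hb hadj (hcol a)]⟩

/-- A partial copy of `H` in `U₁ ∪ U₂` is the same as a pair of matching partial copies in `U₁` and
in `U₂` such that no edge of `H` runs between the parts that belong to only one of the two. -/
theorem hasPattern_union (hb₁ : b₁.Nodup) (hb₂ : b₂.Nodup) (hB₁ : b₁.length + 2 ≤ B)
    (hB₂ : b₂.length + 2 ≤ B) (hU₁ : ∀ v ∈ b₁, v ∈ U₁) (hU₂ : ∀ v ∈ b₂, v ∈ U₂)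
    (hI : ∀ v ∈ U₁, v ∈ U₂ → v ∈ b₁ ∧ v ∈ b₂)
    (hE : ∀ u ∈ U₁, u ∉ U₂ → ∀ v ∈ U₂, v ∉ U₁ → ¬ G.Adj u v)
    {eqv : ℕ → ℕ → Prop} (heqv : ∀ p q (hp : p < b₁.length) (hq : q < b₂.length),
      eqv p q ↔ b₁[p] = b₂[q]) :
    HasPattern G H B (U₁ ∪ U₂) b₁ χ a f ↔
      ∃ f₁ < B ^ r, ∃ f₂ < B ^ r, HasPattern G H B U₁ b₁ χ a f₁ ∧ HasPattern G H B U₂ b₂ χ a f₂ ∧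
        (∀ h : Fin r,
          GlueDigit b₁.length b₂.length eqv (dig B f₁ h) (dig B f₂ h) (dig B f h)) ∧
        ∀ h h' : Fin r, H.Adj h h' → dig B f₁ h ≠ 0 → dig B f₂ h = 0 → dig B f₁ h' = 0 →
          dig B f₂ h' = 0 := by
  classical
  constructor
  · rintro ⟨φ, h1, h2, h3⟩
    set φ₁ : Fin r → Option V := fun h => (φ h).filter fun v => decide (v ∈ U₁) with hφ₁
    set φ₂ : Fin r → Option V := fun h => (φ h).filter fun v => decide (v ∈ U₂) with hφ₂
    have s1 : ∀ h v, φ₁ h = some v ↔ φ h = some v ∧ v ∈ U₁ := by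
      intro h v; simp [hφ₁, Option.filter_eq_some_iff]
    have s2 : ∀ h v, φ₂ h = some v ↔ φ h = some v ∧ v ∈ U₂ := by
      intro h v; simp [hφ₂, Option.filter_eq_some_iff]
    obtain ⟨f₁, hf₁, e₁⟩ := exists_forall_dig_eq (fun h => pcode b₁ (φ₁ h)) fun h => pcode_lt hB₁ _
    obtain ⟨f₂, hf₂, e₂⟩ := exists_forall_dig_eq (fun h => pcode b₂ (φ₂ h)) fun h => pcode_lt hB₂ _
    refine ⟨f₁, hf₁, f₂, hf₂, ⟨φ₁, ?_, ?_, e₁⟩, ⟨φ₂, ?_, ?_, e₂⟩, ?_, ?_⟩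
    · intro h v hv
      rw [s1] at hv
      exact ⟨hv.2, (h1 h v hv.1).2⟩
    · intro h h' u v hne hu hv
      rw [s1] at hu hv
      exact h2 h h' u v hne hu.1 hv.1
    · intro h v hv
      rw [s2] at hv
      exact ⟨hv.2, (h1 h v hv.1).2⟩
    · intro h h' u v hne hu hv
      rw [s2] at hu hv
      exact h2 h h' u v hne hu.1 hv.1
    · intro h
      rw [e₁, e₂, h3]
      cases hφ : φ h with
      | none =>
        have n1 : φ₁ h = none := by simp [hφ₁, hφ]
        have n2 : φ₂ h = none := by simp [hφ₂, hφ]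
        rw [n1, n2]
        exact Or.inl ⟨rfl, rfl, rfl⟩
      | some v =>
        have hv := (h1 h v hφ).1
        by_cases v1 : v ∈ U₁
        · have n1 : φ₁ h = some v := (s1 h v).2 ⟨hφ, v1⟩
          by_cases v2 : v ∈ U₂
          · have n2 : φ₂ h = some v := (s2 h v).2 ⟨hφ, v2⟩
            obtain ⟨m1, m2⟩ := hI v v1 v2
            obtain ⟨p, hp, hpv⟩ := List.getElem_of_mem m1
            obtain ⟨q, hq, hqv⟩ := List.getElem_of_mem m2
            have c1 : pcode b₁ (some v) = p + 2 := (pcode_eq_add_two hb₁ hp).2 hpv.symm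
            have c2 : pcode b₂ (some v) = q + 2 := (pcode_eq_add_two hb₂ hq).2 hqv.symm
            rw [n1, n2, c1, c2]
            refine Or.inr (Or.inr (Or.inr ⟨by omega, by omega, ?_, rfl⟩))
            rw [Nat.add_sub_cancel, Nat.add_sub_cancel, heqv p q hp hq, hpv, hqv]
          · have n2 : φ₂ h = none := by
              simp [hφ₂, hφ, v2]
            rw [n1, n2]
            refine Or.inr (Or.inl ⟨?_, rfl, rfl, ?_⟩)
            · rw [Ne, pcode_eq_zero]; simp
            · intro hle q hq
              obtain ⟨p, hp⟩ : ∃ p, pcode b₁ (some v) = p + 2 := ⟨_, (Nat.sub_add_cancel hle).symm⟩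
              have hpl : p < b₁.length := by
                have := pcode_lt (B := b₁.length + 2) le_rfl (some v)
                omega
              rw [hp, Nat.add_sub_cancel, heqv p q hpl hq, ← (pcode_eq_add_two hb₁ hpl).1 hp]
              rintro rfl
              exact v2 (hU₂ _ (List.getElem_mem hq))
        · have v2 : v ∈ U₂ := hv.resolve_left v1
          have n1 : φ₁ h = none := by simp [hφ₁, hφ, v1]
          have n2 : φ₂ h = some v := (s2 h v).2 ⟨hφ, v2⟩
          rw [n1, n2]
          refine Or.inr (Or.inr (Or.inl ⟨rfl, ?_, ?_, ?_⟩))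
          · rw [Ne, pcode_eq_zero]; simp
          · have : v ∉ b₁ := fun hm => v1 (hU₁ v hm)
            simp [pcode, this]
          · intro hle p hp
            obtain ⟨q, hq⟩ : ∃ q, pcode b₂ (some v) = q + 2 := ⟨_, (Nat.sub_add_cancel hle).symm⟩
            have hql : q < b₂.length := by
              have := pcode_lt (B := b₂.length + 2) le_rfl (some v)
              omega
            rw [hq, Nat.add_sub_cancel, heqv p q hp hql, ← (pcode_eq_add_two hb₂ hql).1 hq]
            rintro rfl
            exact v1 (hU₁ _ (List.getElem_mem hp))
    · intro h h' hadj d1 d2 d1'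
      rw [e₁, Ne, pcode_eq_zero] at d1
      rw [e₂, pcode_eq_zero] at d2
      rw [e₁, pcode_eq_zero] at d1'
      rw [e₂, pcode_eq_zero]
      by_contra d2'
      obtain ⟨u, hu⟩ := Option.ne_none_iff_exists'.1 d1
      obtain ⟨v, hv⟩ := Option.ne_none_iff_exists'.1 d2'
      rw [s1] at hu
      rw [s2] at hv
      have u2 : u ∉ U₂ := fun hm => by
        have := (s2 h u).2 ⟨hu.1, hm⟩
        rw [d2] at this; cases this
      have v1 : v ∉ U₁ := fun hm => by
        have := (s1 h' v).2 ⟨hv.1, hm⟩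
        rw [d1'] at this; cases this
      exact hE u hu.2 u2 v hv.2 v1 ((h2 h h' u v hadj.ne hu.1 hv.1).2.1 hadj)
  · rintro ⟨f₁, -, f₂, -, ⟨φ₁, p1, p2, p3⟩, ⟨φ₂, q1, q2, q3⟩, hg, hh⟩
    -- The glueing conditions say that the two partial maps agree on `U₁ ∩ U₂`.
    have agree : ∀ h u v, φ₁ h = some u → φ₂ h = some v → u = v := by
      intro h u v hu hv
      rcases hg h with ⟨g, -, -⟩ | ⟨-, g, -⟩ | ⟨g, -, -⟩ | ⟨g1, g2, g, -⟩
      · rw [p3, hu, pcode_eq_zero] at g; cases g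
      · rw [q3, hv, pcode_eq_zero] at g; cases g
      · rw [p3, hu, pcode_eq_zero] at g; cases g
      · obtain ⟨p, hp⟩ : ∃ p, dig B f₁ h = p + 2 := ⟨_, (Nat.sub_add_cancel g1).symm⟩
        obtain ⟨q, hq⟩ : ∃ q, dig B f₂ h = q + 2 := ⟨_, (Nat.sub_add_cancel g2).symm⟩
        have hc1 : pcode b₁ (some u) = p + 2 := by rw [← hu, ← p3]; exact hp
        have hc2 : pcode b₂ (some v) = q + 2 := by rw [← hv, ← q3]; exact hq
        have hpl : p < b₁.length := by
          have := pcode_lt (b := b₁) (B := b₁.length + 2) le_rfl (some u); omega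
        have hql : q < b₂.length := by
          have := pcode_lt (b := b₂) (B := b₂.length + 2) le_rfl (some v); omega
        rwa [hp, hq, Nat.add_sub_cancel, Nat.add_sub_cancel, heqv p q hpl hql,
          ← (pcode_eq_add_two hb₁ hpl).1 hc1, ← (pcode_eq_add_two hb₂ hql).1 hc2] at g
    have ag1 : ∀ h v, φ₁ h = some v → v ∈ U₂ → φ₂ h = some v := by
      intro h v hv v2
      obtain ⟨m1, m2⟩ := hI v (p1 h v hv).1 v2
      obtain ⟨p, hp, hpv⟩ := List.getElem_of_mem m1
      obtain ⟨q, hq, hqv⟩ := List.getElem_of_mem m2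
      have c1 : dig B f₁ h = p + 2 := by
        rw [p3, hv]; exact (pcode_eq_add_two hb₁ hp).2 hpv.symm
      rcases hg h with ⟨g1, -, -⟩ | ⟨-, -, -, g⟩ | ⟨g1, -, -⟩ | ⟨-, g2, g, -⟩
      · omega
      · refine absurd ?_ (g (by omega) q hq)
        rw [c1, Nat.add_sub_cancel, heqv p q hp hq, hpv, hqv]
      · omega
      · cases hw : φ₂ h with
        | none => rw [q3, hw] at g2; simp [pcode] at g2
        | some u => rw [agree h v u hv hw]
    have ag2 : ∀ h v, φ₂ h = some v → v ∈ U₁ → φ₁ h = some v := by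
      intro h v hv v1
      obtain ⟨m1, m2⟩ := hI v v1 (q1 h v hv).1
      obtain ⟨p, hp, hpv⟩ := List.getElem_of_mem m1
      obtain ⟨q, hq, hqv⟩ := List.getElem_of_mem m2
      have c2 : dig B f₂ h = q + 2 := by
        rw [q3, hv]; exact (pcode_eq_add_two hb₂ hq).2 hqv.symm
      rcases hg h with ⟨-, g2, -⟩ | ⟨-, g2, -⟩ | ⟨-, -, -, g⟩ | ⟨g1, -, g, -⟩
      · omega
      · omega
      · refine absurd ?_ (g (by omega) p hp)
        rw [c2, Nat.add_sub_cancel, heqv p q hp hq, hpv, hqv]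
      · cases hw : φ₁ h with
        | none => rw [p3, hw] at g1; simp [pcode] at g1
        | some u => rw [agree h u v hw hv]
    have both : ∀ h v, (φ₁ h).or (φ₂ h) = some v →
        φ₁ h = some v ∨
        (φ₁ h = none ∧ φ₂ h = some v ∧ v ∉ U₁) := by
      intro h v hv
      cases hu : φ₁ h with
      | some u =>
        rw [hu] at hv
        obtain rfl : u = v := by simpa using hv
        exact Or.inl rfl
      | none =>
        rw [hu] at hv
        have hv : φ₂ h = some v := by simpa using hv
        exact Or.inr ⟨rfl, hv, fun h1 => by rw [ag2 h v hv h1] at hu; cases hu⟩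
    -- An element from the first part only and one from the second part only.
    have cross : ∀ h h' u v, φ₁ h = some u → φ₁ h' = none → φ₂ h' = some v → v ∉ U₁ →
        φ₂ h = none → u ≠ v ∧ (H.Adj h h' ↔ G.Adj u v) := by
      intro h h' u v hu hn hv v1 hn2
      have u1 := (p1 h u hu).1
      have u2 : u ∉ U₂ := fun hm => by rw [ag1 h u hu hm] at hn2; cases hn2
      refine ⟨fun e => v1 (e ▸ u1), iff_of_false (fun hadj => ?_)
        (hE u u1 u2 v (q1 h' v hv).1 v1)⟩
      have := hh h h' hadj (by rw [p3, hu, Ne, pcode_eq_zero]; simp)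
        (by rw [q3, hn2]; rfl) (by rw [p3, hn]; rfl)
      rw [q3, hv, pcode_eq_zero] at this
      cases this
    refine ⟨fun h => (φ₁ h).or (φ₂ h), ?_, ?_, ?_⟩
    · intro h v hv
      rcases both h v hv with g | ⟨-, g, -⟩
      · exact ⟨Or.inl (p1 h v g).1, (p1 h v g).2⟩
      · exact ⟨Or.inr (q1 h v g).1, (q1 h v g).2⟩
    · intro h h' u v hne hu hv
      rcases both h u hu with gu | ⟨nu, gu, u1⟩ <;>
        rcases both h' v hv with gv | ⟨nv, gv, v1⟩
      · exact p2 h h' u v hne gu gv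
      · cases hw : φ₂ h with
        | none => exact cross h h' u v gu nv gv v1 hw
        | some u' =>
          obtain rfl := agree h u u' gu hw
          exact q2 h h' u v hne hw gv
      · cases hw : φ₂ h' with
        | none =>
          have := cross h' h v u gv nu gu u1 hw
          exact ⟨this.1.symm, by rw [H.adj_comm, G.adj_comm]; exact this.2⟩
        | some v' =>
          obtain rfl := agree h' v v' gv hw
          exact q2 h h' u v hne gu hw
      · exact q2 h h' u v hne gu gv
    · intro h
      dsimp only
      rcases hg h with ⟨g1, g2, g⟩ | ⟨g1, -, g, -⟩ | ⟨g1, g2, g, -⟩ | ⟨g1, -, -, g⟩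
      · rw [p3, pcode_eq_zero] at g1
        rw [q3, pcode_eq_zero] at g2
        rw [g, g1, g2]; rfl
      · rw [p3, Ne, pcode_eq_zero] at g1
        obtain ⟨u, hu⟩ := Option.ne_none_iff_exists'.1 g1
        rw [g, p3, hu]; rfl
      · rw [p3, pcode_eq_zero] at g1
        rw [q3, Ne, pcode_eq_zero] at g2
        obtain ⟨v, hv⟩ := Option.ne_none_iff_exists'.1 g2
        have : v ∉ b₁ := fun hm => by
          rw [ag2 h v hv (hU₁ v hm)] at g1; cases g1
        rw [g, g1, hv]
        simp [pcode, this]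
      · have g1 : dig B f₁ h ≠ 0 := by omega
        rw [p3, Ne, pcode_eq_zero] at g1
        obtain ⟨u, hu⟩ := Option.ne_none_iff_exists'.1 g1
        rw [g, p3, hu]; rfl

theorem realizable_union (hr : 0 < r) (hb₁ : b₁.Nodup) (hb₂ : b₂.Nodup) (hB₁ : b₁.length + 2 ≤ B)
    (hB₂ : b₂.length + 2 ≤ B) (hU₁ : ∀ v ∈ b₁, v ∈ U₁) (hU₂ : ∀ v ∈ b₂, v ∈ U₂)
    (hI : ∀ v ∈ U₁, v ∈ U₂ → v ∈ b₁ ∧ v ∈ b₂)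
    (hE : ∀ u ∈ U₁, u ∉ U₂ → ∀ v ∈ U₂, v ∉ U₁ → ¬ G.Adj u v)
    {eqv : ℕ → ℕ → Prop} (heqv : ∀ p q (hp : p < b₁.length) (hq : q < b₂.length),
      eqv p q ↔ b₁[p] = b₂[q]) (hs : s < 2 ^ (2 * B ^ r)) :
    Realizable G H B (U₁ ∪ U₂) b₁ s ↔
      ∃ s₁ < 2 ^ (2 * B ^ r), ∃ s₂ < 2 ^ (2 * B ^ r), Realizable G H B U₁ b₁ s₁ ∧
        Realizable G H B U₂ b₂ s₂ ∧ GlueP H B b₁.length b₂.length eqv s₁ s₂ s := by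
  classical
  constructor
  · rintro ⟨χ, hχ⟩
    obtain ⟨s₁, h₁⟩ := exists_isType G H B U₁ b₁ χ
    obtain ⟨s₂, h₂⟩ := exists_isType G H B U₂ b₂ χ
    refine ⟨s₁, h₁.1, s₂, h₂.1, ⟨χ, h₁⟩, ⟨χ, h₂⟩, ?_, ?_⟩
    · intro p hp q hq hpq a
      rw [bit_color hr h₁ hb₁ hU₁ hB₁ hp, bit_color hr h₂ hb₂ hU₂ hB₂ hq, (heqv p q hp hq).1 hpq]
    · intro a f hf
      rw [hχ.2 a f hf, hasPattern_union hb₁ hb₂ hB₁ hB₂ hU₁ hU₂ hI hE heqv]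
      refine exists_congr fun f₁ => and_congr_right fun hf₁ => exists_congr fun f₂ =>
        and_congr_right fun hf₂ => ?_
      rw [h₁.2 a f₁ hf₁, h₂.2 a f₂ hf₂]
  · rintro ⟨s₁, -, s₂, -, ⟨χ₁, h₁⟩, ⟨χ₂, h₂⟩, hc, hg⟩
    set χ : V → Bool := fun v => if v ∈ U₁ then χ₁ v else χ₂ v with hχ
    have e₁ : ∀ v ∈ U₁, χ₁ v = χ v := fun v hv => by simp [hχ, hv]
    have e₂ : ∀ v ∈ U₂, χ₂ v = χ v := by
      intro v hv
      by_cases v1 : v ∈ U₁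
      · obtain ⟨m1, m2⟩ := hI v v1 hv
        obtain ⟨p, hp, hpv⟩ := List.getElem_of_mem m1
        obtain ⟨q, hq, hqv⟩ := List.getElem_of_mem m2
        have := hc p hp q hq ((heqv p q hp hq).2 (by rw [hpv, hqv])) (χ₁ v)
        rw [bit_color hr h₁ hb₁ hU₁ hB₁ hp, bit_color hr h₂ hb₂ hU₂ hB₂ hq, hpv, hqv] at this
        simp [hχ, v1, this.1 rfl]
      · simp [hχ, v1]
    have h₁ := h₁.congr e₁
    have h₂ := h₂.congr e₂
    refine ⟨χ, hs, fun a f hf => ?_⟩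
    rw [hg a f hf, hasPattern_union hb₁ hb₂ hB₁ hB₂ hU₁ hU₂ hI hE heqv]
    refine exists_congr fun f₁ => and_congr_right fun hf₁ => exists_congr fun f₂ =>
      and_congr_right fun hf₂ => ?_
    rw [h₁.2 a f₁ hf₁, h₂.2 a f₂ hf₂]

variable (B χ a) in
theorem isIndContained_iff_hasPattern (hB : b.length + 2 ≤ B) :
    H.IsIndContained (G.induce {v | χ v = a}) ↔
      ∃ f < B ^ r, HasPattern G H B Set.univ b χ a f ∧ ∀ h : Fin r, dig B f h ≠ 0 := by
  constructor
  · rintro ⟨e⟩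
    obtain ⟨f, hf, hd⟩ := exists_forall_dig_eq (fun h => pcode b (some (e h : V)))
      fun h => pcode_lt hB _
    refine ⟨f, hf, ⟨fun h => some (e h : V), ?_, ?_, hd⟩, ?_⟩
    · rintro h v hv
      cases hv
      exact ⟨trivial, (e h).2⟩
    · rintro h h' u v hne hu hv
      cases hu; cases hv
      refine ⟨fun he => hne (e.injective (Subtype.ext he)), ?_⟩
      rw [← e.map_adj_iff]; rfl
    · intro h
      rw [hd, Ne, pcode_eq_zero]; simp
  · rintro ⟨f, -, ⟨φ, h1, h2, h3⟩, h0⟩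
    have : ∀ h, ∃ v, φ h = some v := fun h => by
      have := h0 h
      rw [h3, Ne, pcode_eq_zero] at this
      exact Option.ne_none_iff_exists'.1 this
    choose e he using this
    refine ⟨⟨⟨fun h => ⟨e h, (h1 h _ (he h)).2⟩, ?_⟩, ?_⟩⟩
    · intro h h' hh
      by_contra hne
      exact (h2 h h' _ _ hne (he h) (he h')).1 (congrArg Subtype.val hh)
    · intro h h'
      rcases eq_or_ne h h' with rfl | hne
      · simp
      · exact (h2 h h' _ _ hne (he h) (he h')).2.symm

theorem hasHFreeBipartition_iff (hr : 0 < r) (hB : b.length + 2 ≤ B) :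
    HasHFreeBipartition H G ↔
      ∃ s < 2 ^ (2 * B ^ r), Realizable G H B Set.univ b s ∧ FinalP r B s := by
  classical
  -- The two conditions of `FinalP` for the type of a given colouring.
  have copies : ∀ χ s, IsType G H B Set.univ b χ s → ∀ a,
      ((∀ f < B ^ r, bit s (off (B ^ r) a + f) → ∃ h : Fin r, dig B f h = 0) ↔
        ¬ H.IsIndContained (G.induce {v | χ v = a})) := by
    intro χ s hs a
    rw [isIndContained_iff_hasPattern B χ a hB]
    push Not
    refine forall_congr' fun f => forall_congr' fun hf => ?_
    rw [hs.2 a f hf]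
  have nonempty : ∀ χ s, IsType G H B Set.univ b χ s → ∀ a,
      ((∃ d < B, d ≠ 0 ∧ bit s (off (B ^ r) a + d)) ↔ {v | χ v = a}.Nonempty) := by
    intro χ s hs a
    constructor
    · rintro ⟨d, hd, hd0, h⟩
      rw [bit_single hr hs hd hd0] at h
      obtain ⟨v, -, hv, -⟩ := h
      exact ⟨v, hv⟩
    · rintro ⟨v, hv⟩
      refine ⟨pcode b (some v), pcode_lt hB _, by rw [Ne, pcode_eq_zero]; simp, ?_⟩
      rw [bit_single hr hs (pcode_lt hB _) (by rw [Ne, pcode_eq_zero]; simp)]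
      exact ⟨v, trivial, hv, rfl⟩
  constructor
  · rintro ⟨X, Y, hX, hY, hd, hu, hX', hY'⟩
    set χ : V → Bool := fun v => decide (v ∈ X) with hχ
    have e1 : {v | χ v = true} = X := by ext v; simp [hχ]
    have e2 : {v | χ v = false} = Y := by
      ext v
      have h1 : v ∈ X ∪ Y := hu ▸ Set.mem_univ v
      have h2 : v ∈ X → v ∉ Y := fun h h' => Set.disjoint_left.1 hd h h'
      simp only [hχ, Set.mem_ofPred_eq, decide_eq_false_iff_not]
      constructor
      · exact fun h => h1.resolve_left h
      · exact fun h h' => h2 h' h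
    obtain ⟨s, hs⟩ := exists_isType G H B Set.univ b χ
    refine ⟨s, hs.1, ⟨χ, hs⟩, fun a => ?_, fun a => ?_⟩
    · rw [copies χ s hs]
      cases a
      · rwa [e2]
      · rwa [e1]
    · rw [nonempty χ s hs]
      cases a
      · rwa [e2]
      · rwa [e1]
  · rintro ⟨s, -, ⟨χ, hs⟩, h1, h2⟩
    refine ⟨{v | χ v = true}, {v | χ v = false}, (nonempty χ s hs _).1 (h2 _),
      (nonempty χ s hs _).1 (h2 _), ?_, ?_, (copies χ s hs _).1 (h1 _),
      (copies χ s hs _).1 (h1 _)⟩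
    · rw [Set.disjoint_left]
      intro v h h'
      simp only [Set.mem_ofPred_eq] at h h'
      rw [h] at h'; cases h'
    · ext v
      simp

end Types

/-! ### Subtrees of a rooted tree decomposition -/

namespace RootedTreeDecomposition

variable {V I : Type*} {G : SimpleGraph V} (D : RootedTreeDecomposition G I)

/-- The nodes of the subtree below the node `j`. -/
def Desc (j : I) : Set I := {x | Relation.ReflTransGen (fun a b => b ∈ D.children a) j x}

/-- The vertices in the bags of a set of nodes. -/
def covered (S : Set I) : Set V := {v | ∃ x ∈ S, v ∈ D.bag x}

/-- The node `i` together with the subtrees below the nodes of the list `l`. -/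
def partialSubtree (i : I) (l : List I) : Set I := {x | x = i ∨ ∃ j ∈ l, x ∈ D.Desc j}

variable {D}

theorem root_notMem_children (i : I) : D.root ∉ D.children i := by
  rintro ⟨_, h⟩
  simp at h

theorem exists_parent {j : I} (hj : j ≠ D.root) : ∃ i, j ∈ D.children i := by
  obtain ⟨p, hp⟩ := D.isTree.1.exists_walk_length_eq_dist j D.root
  cases p with
  | nil => exact absurd rfl hj
  | @cons _ i _ hadj p =>
    refine ⟨i, hadj.symm, ?_⟩
    have h1 := D.tree.dist_le p
    rw [SimpleGraph.Walk.length_cons, D.tree.dist_comm] at hp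
    rw [D.tree.dist_comm] at h1
    have h2 := D.isTree.dist_eq_dist_add_one_of_adj D.root hadj
    omega

theorem parent_unique {i i' j : I} (h : j ∈ D.children i) (h' : j ∈ D.children i') : i = i' := by
  have key : ∀ i, j ∈ D.children i → ∃ p : D.tree.Walk D.root j, p.IsPath ∧ p.penultimate = i := by
    rintro i ⟨hadj, hd⟩
    obtain ⟨p, hp⟩ := D.isTree.1.exists_walk_length_eq_dist D.root i
    refine ⟨p.concat hadj, ?_, by simp⟩
    apply SimpleGraph.Walk.isPath_of_length_eq_dist
    rw [SimpleGraph.Walk.length_concat, hp, hd]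
  obtain ⟨p, hp, rfl⟩ := key i h
  obtain ⟨q, hq, rfl⟩ := key i' h'
  rw [(D.isTree.existsUnique_path D.root j).unique hp hq]

theorem Desc.dist_le {j x : I} (h : x ∈ D.Desc j) :
    D.tree.dist D.root j ≤ D.tree.dist D.root x ∧
      (D.tree.dist D.root j = D.tree.dist D.root x → j = x) := by
  change Relation.ReflTransGen _ j x at h
  induction h with
  | refl => simp
  | tail _ hc ih =>
    have := hc.2
    exact ⟨by omega, fun h => by omega⟩

theorem notMem_desc {i j : I} (h : j ∈ D.children i) : i ∉ D.Desc j := by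
  intro hi
  have := (Desc.dist_le hi).1
  have := h.2
  omega

theorem desc_disjoint {i j j' x : I} (h : j ∈ D.children i) (h' : j' ∈ D.children i) (hne : j ≠ j')
    (hx : x ∈ D.Desc j) : x ∉ D.Desc j' := by
  intro hx'
  have hd : D.tree.dist D.root j = D.tree.dist D.root j' := by rw [h.2, h'.2]
  -- Parents are unique, so two ancestors of the same node are comparable.
  have := Relation.ReflTransGen.total_of_right_unique
    (r := Function.swap fun a b => b ∈ D.children a) (fun _ _ _ => parent_unique)
    (Relation.reflTransGen_swap.2 hx) (Relation.reflTransGen_swap.2 hx')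
  rcases this with h | h
  · exact hne ((Desc.dist_le (Relation.reflTransGen_swap.1 h)).2 hd.symm).symm
  · exact hne ((Desc.dist_le (Relation.reflTransGen_swap.1 h)).2 hd)

theorem mem_desc_root (x : I) : x ∈ D.Desc D.root := by
  generalize hn : D.tree.dist D.root x = n
  induction n generalizing x with
  | zero =>
    rw [D.isTree.1.dist_eq_zero_iff] at hn
    rw [← hn]; exact Relation.ReflTransGen.refl
  | succ n ih =>
    obtain ⟨i, hi⟩ := exists_parent (D := D) (j := x) (by rintro rfl; simp at hn)
    exact (ih i (by have := hi.2; omega)).tail hi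

theorem eq_of_adj_desc {j x y : I} (hadj : D.tree.Adj x y) (hx : x ∈ D.Desc j)
    (hy : y ∉ D.Desc j) : x = j ∧ j ∈ D.children y := by
  rcases D.isTree.dist_eq_dist_add_one_of_adj D.root hadj with h | h
  · have hc : x ∈ D.children y := ⟨hadj.symm, h⟩
    rcases Relation.ReflTransGen.cases_tail hx with rfl | ⟨z, hz, hzx⟩
    · exact ⟨rfl, hc⟩
    · rw [parent_unique hzx hc] at hz
      exact absurd hz hy
  · exact absurd (hx.tail ⟨hadj, h⟩) hy

/-- A vertex that occurs both inside and outside of the subtree below `j` is in the bags of `j` and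
of its parent. -/
theorem mem_bag_of_crossing {i j x y : I} {v : V} (hj : j ∈ D.children i) (hx : x ∈ D.Desc j)
    (hvx : v ∈ D.bag x) (hy : y ∉ D.Desc j) (hvy : v ∈ D.bag y) : v ∈ D.bag i ∧ v ∈ D.bag j := by
  obtain ⟨p⟩ := (D.connected v).preconnected ⟨x, hvx⟩ ⟨y, hvy⟩
  obtain ⟨d, -, h1, h2⟩ := p.exists_boundary_dart {z | (z : I) ∈ D.Desc j} hx hy
  obtain ⟨e, hc⟩ := eq_of_adj_desc (D := D) (x := d.fst) (y := d.snd) d.adj h1 h2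
  have e' := parent_unique hc hj
  exact ⟨e' ▸ d.snd.2, e ▸ d.fst.2⟩

theorem covered_partialSubtree_inter {i j : I} {l : List I} (hl : ∀ j ∈ l, j ∈ D.children i)
    (hj : j ∈ D.children i) (hjl : j ∉ l) {v : V} (h1 : v ∈ D.covered (D.partialSubtree i l))
    (h2 : v ∈ D.covered (D.Desc j)) : v ∈ D.bag i ∧ v ∈ D.bag j := by
  obtain ⟨y, hy, hvy⟩ := h1
  obtain ⟨x, hx, hvx⟩ := h2
  refine mem_bag_of_crossing hj hx hvx ?_ hvy
  rcases hy with rfl | ⟨j', hj', hy⟩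
  · exact notMem_desc hj
  · exact desc_disjoint (hl j' hj') hj (by rintro rfl; exact hjl hj') hy

theorem not_adj_of_covered {i j : I} {l : List I} (hj : j ∈ D.children i) {u v : V}
    (hu : u ∉ D.covered (D.Desc j))
    (hv : v ∈ D.covered (D.Desc j)) (hv' : v ∉ D.covered (D.partialSubtree i l)) :
    ¬ G.Adj u v := by
  intro hadj
  obtain ⟨k, hk, hk'⟩ := D.exists_edge_bag u v hadj
  by_cases hkj : k ∈ D.Desc j
  · exact hu ⟨k, hkj, hk⟩
  · obtain ⟨x, hx, hvx⟩ := hv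
    exact hv' ⟨i, Or.inl rfl, (mem_bag_of_crossing hj hx hvx hkj hk').1⟩

theorem covered_partialSubtree_nil (i : I) :
    D.covered (D.partialSubtree i []) = {v | v ∈ D.bag i} := by
  ext v
  simp [covered, partialSubtree]

theorem covered_partialSubtree_append (i j : I) (l : List I) :
    D.covered (D.partialSubtree i (l ++ [j])) =
      D.covered (D.partialSubtree i l) ∪ D.covered (D.Desc j) := by
  ext v
  constructor
  · rintro ⟨x, rfl | ⟨k, hk, hx⟩, hv⟩
    · exact Or.inl ⟨x, Or.inl rfl, hv⟩
    · rcases List.mem_append.1 hk with hk | hk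
      · exact Or.inl ⟨x, Or.inr ⟨k, hk, hx⟩, hv⟩
      · rw [List.mem_singleton] at hk
        subst hk
        exact Or.inr ⟨x, hx, hv⟩
  · rintro (⟨x, rfl | ⟨k, hk, hx⟩, hv⟩ | ⟨x, hx, hv⟩)
    · exact ⟨x, Or.inl rfl, hv⟩
    · exact ⟨x, Or.inr ⟨k, List.mem_append_left _ hk, hx⟩, hv⟩
    · exact ⟨x, Or.inr ⟨j, by simp, hx⟩, hv⟩

theorem partialSubtree_eq_desc {i : I} {l : List I} (hl : ∀ j, j ∈ l ↔ j ∈ D.children i) :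
    D.partialSubtree i l = D.Desc i := by
  ext x
  constructor
  · rintro (rfl | ⟨j, hj, hx⟩)
    · exact Relation.ReflTransGen.refl
    · exact Relation.ReflTransGen.head ((hl j).1 hj) hx
  · intro hx
    rcases Relation.ReflTransGen.cases_head hx with rfl | ⟨j, hj, hx⟩
    · exact Or.inl rfl
    · exact Or.inr ⟨j, (hl j).2 hj, hx⟩

theorem covered_desc_root : D.covered (D.Desc D.root) = Set.univ := by
  ext v
  obtain ⟨i, hi⟩ := D.exists_mem_bag v
  simpa using ⟨i, mem_desc_root i, hi⟩

end RootedTreeDecomposition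

/-! ### Breadth-first order -/

/-- The queue of a breadth-first search in a tree after `k` nodes have been expanded. -/
def bfs (kids : ℕ → List ℕ) (root : ℕ) : ℕ → List ℕ
  | 0 => [root]
  | k + 1 => bfs kids root k ++ kids ((bfs kids root k).getD k 0)

/-- The lists `kids i` are the lists of children of the nodes of a tree with node set
`{0, …, N - 1}`. -/
structure IsTreeOn (N root : ℕ) (kids : ℕ → List ℕ) : Prop where
  root_lt : root < N
  kids_lt : ∀ i < N, ∀ j ∈ kids i, j < N
  nodup : ∀ i < N, (kids i).Nodup
  root_notMem : ∀ i < N, root ∉ kids i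
  parent_unique : ∀ i < N, ∀ i' < N, ∀ j, j ∈ kids i → j ∈ kids i' → i = i'
  closure : ∀ S : Set ℕ, root ∈ S → (∀ i < N, i ∈ S → ∀ j ∈ kids i, j ∈ S) → ∀ i < N, i ∈ S

namespace IsTreeOn

variable {N root : ℕ} {kids : ℕ → List ℕ} (h : IsTreeOn N root kids)
include h

theorem bfs_inv {k : ℕ} (hk : k ≤ N) :
    (bfs kids root k).Nodup ∧ (∀ x ∈ bfs kids root k, x < N) ∧
      bfs kids root k = root :: ((bfs kids root k).take k).flatMap kids ∧
      k ≤ (bfs kids root k).length ∧ (k < N → k < (bfs kids root k).length) := by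
  have last : ∀ k ≤ N, (bfs kids root k).Nodup → (∀ x ∈ bfs kids root k, x < N) →
      bfs kids root k = root :: ((bfs kids root k).take k).flatMap kids →
      k ≤ (bfs kids root k).length → k < N → k < (bfs kids root k).length := by
    intro k _ hnd hlt heq hle hkN
    refine lt_of_le_of_ne hle fun he => ?_
    -- An exhausted queue is closed under children, so that it contains all nodes.
    have hall : ∀ i < N, i ∈ bfs kids root k := by
      refine h.closure {x | x ∈ bfs kids root k} ?_ ?_
      · change root ∈ bfs kids root k
        rw [heq]; simp
      · intro i _ hi j hj
        change j ∈ bfs kids root k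
        rw [heq, List.take_of_length_le he.ge]
        exact List.mem_cons_of_mem _ (List.mem_flatMap.2 ⟨i, hi, hj⟩)
    have hsub : List.range N ⊆ bfs kids root k := fun i hi => hall i (List.mem_range.1 hi)
    have := (List.nodup_range.subperm hsub).length_le
    rw [List.length_range] at this
    omega
  induction k with
  | zero =>
    refine ⟨by simp [bfs], ?_, by simp [bfs], by simp, by simp [bfs]⟩
    intro x hx
    obtain rfl : x = root := by simpa [bfs] using hx
    exact h.root_lt
  | succ k ih =>
    obtain ⟨hnd, hlt, heq, hle, hl⟩ := ih (by omega)
    have hkl := hl (by omega)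
    have hx : (bfs kids root k).getD k 0 = (bfs kids root k)[k] := by
      simp [List.getD_eq_getElem?_getD, List.getElem?_eq_getElem hkl]
    have htake : (bfs kids root (k + 1)).take (k + 1) = (bfs kids root k).take (k + 1) := by
      simp [bfs, List.take_append_of_le_length hkl]
    have hstep : bfs kids root (k + 1) =
        root :: ((bfs kids root (k + 1)).take (k + 1)).flatMap kids := by
      rw [htake, List.take_succ_eq_append_getElem hkl, List.flatMap_append]
      calc bfs kids root (k + 1)
          = bfs kids root k ++ kids (bfs kids root k)[k] := by rw [bfs, hx]
        _ = root :: ((bfs kids root k).take k).flatMap kids ++ kids (bfs kids root k)[k] :=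
            congrArg (· ++ kids (bfs kids root k)[k]) heq
        _ = _ := by simp
    have hxN : (bfs kids root k)[k] < N := hlt _ (List.getElem_mem hkl)
    have hlt' : ∀ x ∈ bfs kids root (k + 1), x < N := by
      intro x hx'
      rw [bfs, hx] at hx'
      rcases List.mem_append.1 hx' with h1 | h1
      · exact hlt x h1
      · exact h.kids_lt _ hxN x h1
    have hsub : ∀ x ∈ (bfs kids root k).take (k + 1), x < N := fun x hx =>
      hlt x (List.mem_of_mem_take hx)
    have hnd' : (bfs kids root (k + 1)).Nodup := by
      rw [hstep, htake, List.nodup_cons, List.nodup_flatMap]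
      refine ⟨?_, fun x hx => h.nodup x (hsub x hx), ?_⟩
      · intro hr
        obtain ⟨i, hi, hr⟩ := List.mem_flatMap.1 hr
        exact h.root_notMem i (hsub i hi) hr
      · have hnt : ((bfs kids root k).take (k + 1)).Nodup := hnd.sublist (List.take_sublist _ _)
        refine hnt.imp_of_mem fun {i i'} hi hi' hne => ?_
        intro j hj hj'
        exact hne (h.parent_unique i (hsub i hi) i' (hsub i' hi') j hj hj')
    have hle' : k + 1 ≤ (bfs kids root (k + 1)).length := by
      simp only [bfs, List.length_append]; omega
    exact ⟨hnd', hlt', hstep, hle', last _ hk hnd' hlt' hstep hle'⟩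

theorem length_bfs_le {k : ℕ} (hk : k ≤ N) : (bfs kids root k).length ≤ N := by
  obtain ⟨hnd, hlt, -⟩ := h.bfs_inv hk
  have hsub : bfs kids root k ⊆ List.range N := fun i hi => List.mem_range.2 (hlt i hi)
  simpa using (hnd.subperm hsub).length_le

theorem length_bfs : (bfs kids root N).length = N :=
  le_antisymm (h.length_bfs_le le_rfl) (h.bfs_inv le_rfl).2.2.2.1

omit h in
theorem bfs_getD_of_le {k m e : ℕ} (hkm : k ≤ m) (he : e < (bfs kids root k).length) :
    (bfs kids root m).getD e 0 = (bfs kids root k).getD e 0 := by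
  induction m, hkm using Nat.le_induction with
  | base => rfl
  | succ m hm ih =>
    have : ∀ k m, k ≤ m → (bfs kids root k).length ≤ (bfs kids root m).length := by
      intro k m hkm
      induction m, hkm using Nat.le_induction with
      | base => rfl
      | succ m _ ih => simp only [bfs, List.length_append]; omega
    rw [← ih, bfs, List.getD_append _ _ _ _ (lt_of_lt_of_le he (this k m hm))]

theorem bfs_lt (k : ℕ) (hk : k < N) : (bfs kids root N).getD k 0 < N := by
  have hl : k < (bfs kids root N).length := by rw [h.length_bfs]; exact hk
  rw [List.getD_eq_getElem _ _ hl]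
  exact (h.bfs_inv le_rfl).2.1 _ (List.getElem_mem hl)

/-- The children of a node come later in the breadth-first order. -/
theorem exists_bfs_kid {k j : ℕ} (hk : k < N) (hj : j ∈ kids ((bfs kids root N).getD k 0)) :
    ∃ k', k < k' ∧ k' < N ∧ (bfs kids root N).getD k' 0 = j := by
  have hkl := (h.bfs_inv hk.le).2.2.2.2 hk
  rw [bfs_getD_of_le hk.le hkl] at hj
  obtain ⟨e, he, rfl⟩ := List.getElem_of_mem hj
  have hlen : (bfs kids root k).length + e < (bfs kids root (k + 1)).length := by
    simp only [bfs, List.length_append]; omega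
  refine ⟨(bfs kids root k).length + e, by omega,
    lt_of_lt_of_le hlen (h.length_bfs_le (by omega)), ?_⟩
  rw [bfs_getD_of_le (by omega) hlen, bfs, List.getD_append_right _ _ _ _ (by omega),
    Nat.add_sub_cancel_left, List.getD_eq_getElem _ _ he]

theorem mem_bfs {i : ℕ} (hi : i < N) : ∃ k < N, (bfs kids root N).getD k 0 = i := by
  obtain ⟨hnd, hlt, -⟩ := h.bfs_inv le_rfl
  have hsub : bfs kids root N ⊆ List.range N := fun i hi => List.mem_range.2 (hlt i hi)
  have hp := (hnd.subperm hsub).perm_of_length_le (by rw [h.length_bfs, List.length_range])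
  have := hp.mem_iff.2 (List.mem_range.2 hi)
  obtain ⟨k, hk, e⟩ := List.getElem_of_mem this
  exact ⟨k, by rwa [h.length_bfs] at hk, by rw [List.getD_eq_getElem _ _ hk, e]⟩

end IsTreeOn

/-! ### The transitions of the dynamic program as bounded formulas -/

namespace Fm

/-- Truth. -/
def tt : Fm := nz (.const 1)

/-- Implication. -/
def imp (φ ψ : Fm) : Fm := neg (and φ (neg ψ))

/-- Disjunction. -/
def or (φ ψ : Fm) : Fm := neg (and (neg φ) (neg ψ))

/-- Equivalence. -/
def iff (φ ψ : Fm) : Fm := and (imp φ ψ) (imp ψ φ)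

/-- Equality of two terms. -/
def eq (a b : Tm) : Fm := neg (nz (.op .add (.op .sub a b) (.op .sub b a)))

/-- Strict inequality of two terms. -/
def lt (a b : Tm) : Fm := nz (.op .sub b a)

/-- There is `x < t` with `φ`. -/
def exLt (x : ℕ) (t : Tm) (φ : Fm) : Fm := ex x (and (lt (.var x) t) φ)

/-- `φ` holds for all `x < t`. -/
def allLt (x : ℕ) (t : Tm) (φ : Fm) : Fm := neg (exLt x t (neg φ))

/-- Conjunction over a finite list. -/
def conj {α : Type*} (l : List α) (φ : α → Fm) : Fm := l.foldr (fun a ψ => and (φ a) ψ) tt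

variable {μ ρ : ℕ → ℕ} {d : ℕ}

@[simp] theorem eval_tt : tt.Eval μ ρ := by simp [tt]

@[simp] theorem eval_imp {φ ψ : Fm} : (imp φ ψ).Eval μ ρ ↔ (φ.Eval μ ρ → ψ.Eval μ ρ) := by
  simp [imp]

@[simp] theorem eval_or {φ ψ : Fm} : (or φ ψ).Eval μ ρ ↔ (φ.Eval μ ρ ∨ ψ.Eval μ ρ) := by
  simp only [or, Eval]; tauto

@[simp] theorem eval_iff {φ ψ : Fm} : (iff φ ψ).Eval μ ρ ↔ (φ.Eval μ ρ ↔ ψ.Eval μ ρ) := by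
  simp only [iff, Eval, eval_imp]; tauto

@[simp] theorem eval_eq {a b : Tm} : (eq a b).Eval μ ρ ↔ a.eval ρ μ = b.eval ρ μ := by
  simp only [eq, Eval, Tm.eval, BinOp.eval]; omega

@[simp] theorem eval_lt {a b : Tm} : (lt a b).Eval μ ρ ↔ a.eval ρ μ < b.eval ρ μ := by
  simp only [lt, Eval, Tm.eval, BinOp.eval]; omega

@[simp] theorem eval_conj {α : Type*} {l : List α} {φ : α → Fm} :
    (conj l φ).Eval μ ρ ↔ ∀ a ∈ l, (φ a).Eval μ ρ := by
  induction l with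
  | nil => simp [conj]
  | cons a l ih => simpa [conj] using fun _ => ih

theorem eval_exLt {x m : ℕ} {t : Tm} {φ : Fm} (ht : t.WF x) (hm : t.eval ρ μ = m)
    (hle : m ≤ ρ 1) :
    (exLt x t φ).Eval μ ρ ↔ ∃ v < m, φ.Eval μ (Function.update ρ x v) := by
  have h : ∀ v, t.eval (Function.update ρ x v) μ = m := fun v => by
    rw [← hm]
    exact Tm.eval_congr t ht fun y _ hy => Function.update_of_ne hy.ne _ _
  simp only [exLt, Eval, eval_lt, Tm.eval, h, Function.update_self]
  exact exists_congr fun v => ⟨fun h => h.2, fun h => ⟨by omega, h⟩⟩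

theorem eval_allLt {x m : ℕ} {t : Tm} {φ : Fm} (ht : t.WF x) (hm : t.eval ρ μ = m)
    (hle : m ≤ ρ 1) :
    (allLt x t φ).Eval μ ρ ↔ ∀ v < m, φ.Eval μ (Function.update ρ x v) := by
  simp [allLt, eval_exLt ht hm hle]

@[simp] theorem wf_tt : tt.WF d := by simp [tt]

@[simp] theorem wf_imp {φ ψ : Fm} : (imp φ ψ).WF d ↔ φ.WF d ∧ ψ.WF d := by simp [imp]

@[simp] theorem wf_or {φ ψ : Fm} : (or φ ψ).WF d ↔ φ.WF d ∧ ψ.WF d := by simp [or]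

@[simp] theorem wf_iff {φ ψ : Fm} : (iff φ ψ).WF d ↔ φ.WF d ∧ ψ.WF d := by
  simp [iff]; tauto

@[simp] theorem wf_eq {a b : Tm} : (eq a b).WF d ↔ a.WF d ∧ b.WF d := by simp [eq]; tauto

@[simp] theorem wf_lt {a b : Tm} : (lt a b).WF d ↔ b.WF d ∧ a.WF d := by simp [lt]

@[simp] theorem wf_exLt {x : ℕ} {t : Tm} {φ : Fm} :
    (exLt x t φ).WF d ↔ x = d ∧ t.WF (d + 1) ∧ (0 < x ∧ x < d + 1) ∧ φ.WF (d + 1) := by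
  simp [exLt]; tauto

@[simp] theorem wf_allLt {x : ℕ} {t : Tm} {φ : Fm} :
    (allLt x t φ).WF d ↔ x = d ∧ t.WF (d + 1) ∧ (0 < x ∧ x < d + 1) ∧ φ.WF (d + 1) := by
  simp [allLt]

@[simp] theorem wf_conj {α : Type*} {l : List α} {φ : α → Fm} :
    (conj l φ).WF d ↔ ∀ a ∈ l, (φ a).WF d := by
  induction l with
  | nil => simp [conj]
  | cons a l ih => simpa [conj] using fun _ => ih

end Fm

/-- Sum of two terms. -/
abbrev Tm.add (a b : Tm) : Tm := .op .add a b

/-- Truncated difference of two terms. -/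
abbrev Tm.sub (a b : Tm) : Tm := .op .sub a b

/-- Product of two terms. -/
abbrev Tm.mul (a b : Tm) : Tm := .op .mul a b

/-- Quotient of two terms. -/
abbrev Tm.div (a b : Tm) : Tm := .op .div a b

/-! The program variables are used as follows. Register `1` holds the number `S` of types, `2` and
`3` the numbers of vertices and of nodes, `4` the address of the table of list addresses, `5` that
of the powers of two, `6` that of the queue, `7` that of the adjacency matrix, `8` that of the table
of the dynamic program, `9` and `10` hold `B` and `F = B ^ r`. Registers `11` to `15` are counters,
bounds of loops and temporary values (`13` holds the current type), `16` and `17` hold the addresses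
of two bags and `18` and `19` the indices of two rows of the table. -/

/-- The power `B ^ h`. -/
def powTm : ℕ → Tm
  | 0 => .const 1
  | h + 1 => .mul (powTm h) (.var 9)

/-- The digit number `h` of `f` in base `B`. -/
def digTm (f : Tm) (h : ℕ) : Tm :=
  .sub (.div f (powTm h)) (.mul (.var 9) (.div f (powTm (h + 1))))

/-- The position of colour `a`. -/
def offTm : Bool → Tm
  | false => .const 0
  | true => .var 10

/-- The quotient of `s` by a power of two, whose last bit is bit number `off F a + g` of `s`. -/
def shiftTm (s : Tm) (a : Bool) (g : Tm) : Tm :=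
  .div s (.load (.add (.var 5) (.add (offTm a) g)))

/-- The bit number `off F a + g` of `s` is set. -/
def bitFm (s : Tm) (a : Bool) (g : Tm) : Fm :=
  .nz (.sub (shiftTm s a g) (.mul (.const 2) (.div (shiftTm s a g) (.const 2))))

/-- The entry number `p` of the list stored at address `l`. -/
def entryTm (l p : Tm) : Tm := .load (.add (.add l (.const 1)) p)

/-- The adjacency of the vertices `u` and `v`. -/
def adjFm (u v : Tm) : Fm := .nz (.load (.add (.var 7) (.add (.mul u (.var 2)) v)))

/-- The type `s` is marked in row `p` of the table. -/
def rowFm (p s : Tm) : Fm := .nz (.load (.add (.var 8) (.add (.mul p (.var 1)) s)))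

/-- The two colours. -/
abbrev colors : List Bool := [false, true]

open Classical in
/-- The formula for `BaseP`, for the type in register `13` and the bag at the address in
register `16`. -/
noncomputable def baseFm {r : ℕ} (H : SimpleGraph (Fin r)) : Fm :=
  .and
    (.allLt 20 (.load (.var 16)) (.iff (bitFm (.var 13) false (.add (.var 20) (.const 2)))
      (.neg (bitFm (.var 13) true (.add (.var 20) (.const 2))))))
    (.conj colors fun a => .allLt 20 (.var 10) (.iff (bitFm (.var 13) a (.var 20)) (.and
      (.conj (List.finRange r) fun h => .and (.neg (.eq (digTm (.var 20) h) (.const 1)))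
        (.and (.lt (digTm (.var 20) h) (.add (.load (.var 16)) (.const 2)))
          (.imp (.nz (digTm (.var 20) h)) (bitFm (.var 13) a (digTm (.var 20) h)))))
      (.conj (List.finRange r) fun h => .conj (List.finRange r) fun h' =>
        if h = h' then .tt else
          .imp (.nz (digTm (.var 20) h)) (.imp (.nz (digTm (.var 20) h'))
            (.and (.neg (.eq (digTm (.var 20) h) (digTm (.var 20) h')))
              (.iff (if H.Adj h h' then .tt else .neg .tt)
                (adjFm (entryTm (.var 16) (.sub (digTm (.var 20) h) (.const 2)))
                  (entryTm (.var 16) (.sub (digTm (.var 20) h') (.const 2)))))))))))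

/-- Entry `p` of the bag at the address in register `16` is entry `q` of the bag at the address in
register `17`. -/
def eqvFm (p q : Tm) : Fm := .eq (entryTm (.var 16) p) (entryTm (.var 17) q)

/-- The formula for `GlueDigit`. -/
def glueDigitFm (d₁ d₂ d : Tm) : Fm :=
  .or (.and (.eq d₁ (.const 0)) (.and (.eq d₂ (.const 0)) (.eq d (.const 0))))
  (.or (.and (.nz d₁) (.and (.eq d₂ (.const 0)) (.and (.eq d d₁) (.imp (.lt (.const 1) d₁)
    (.allLt 25 (.load (.var 17)) (.neg (eqvFm (.sub d₁ (.const 2)) (.var 25))))))))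
  (.or (.and (.eq d₁ (.const 0)) (.and (.nz d₂) (.and (.eq d (.const 1)) (.imp (.lt (.const 1) d₂)
    (.allLt 25 (.load (.var 16)) (.neg (eqvFm (.var 25) (.sub d₂ (.const 2)))))))))
  (.and (.lt (.const 1) d₁) (.and (.lt (.const 1) d₂)
    (.and (eqvFm (.sub d₁ (.const 2)) (.sub d₂ (.const 2))) (.eq d d₁))))))

open Classical in
/-- The formula for `GlueP`, for the types in the registers `20`, `21` and `13`. -/
noncomputable def glueFm {r : ℕ} (H : SimpleGraph (Fin r)) : Fm :=
  .and
    (.allLt 22 (.load (.var 16)) (.allLt 23 (.load (.var 17)) (.imp (eqvFm (.var 22) (.var 23))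
      (.conj colors fun a => .iff (bitFm (.var 20) a (.add (.var 22) (.const 2)))
        (bitFm (.var 21) a (.add (.var 23) (.const 2)))))))
    (.conj colors fun a => .allLt 22 (.var 10) (.iff (bitFm (.var 13) a (.var 22))
      (.exLt 23 (.var 10) (.exLt 24 (.var 10) (.and (bitFm (.var 20) a (.var 23))
        (.and (bitFm (.var 21) a (.var 24)) (.and
          (.conj (List.finRange r) fun h =>
            glueDigitFm (digTm (.var 23) h) (digTm (.var 24) h) (digTm (.var 22) h))
          (.conj (List.finRange r) fun h => .conj (List.finRange r) fun h' =>
            if H.Adj h h' then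
              .imp (.nz (digTm (.var 23) h)) (.imp (.eq (digTm (.var 24) h) (.const 0))
                (.imp (.eq (digTm (.var 23) h') (.const 0))
                  (.eq (digTm (.var 24) h') (.const 0))))
            else .tt))))))))

/-- The type in register `13` arises by glueing from types in the rows of the table given by the
registers `18` and `19`. -/
noncomputable def joinFm {r : ℕ} (H : SimpleGraph (Fin r)) : Fm :=
  .ex 20 (.ex 21 (.and (rowFm (.var 18) (.var 20)) (.and (rowFm (.var 19) (.var 21)) (glueFm H))))

/-- The row of the table given by register `18` contains a type with `FinalP`. -/
def finalFm (r : ℕ) : Fm :=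
  .ex 20 (.and (rowFm (.var 18) (.var 20)) (.and
    (.conj colors fun a => .allLt 21 (.var 10) (.imp (bitFm (.var 20) a (.var 21))
      (.neg (.conj (List.finRange r) fun h => .nz (digTm (.var 21) h)))))
    (.conj colors fun a => .exLt 21 (.var 9)
      (.and (.nz (.var 21)) (bitFm (.var 20) a (.var 21))))))

theorem powTm_wf {d : ℕ} (hd : 9 < d) (h : ℕ) : (powTm h).WF d := by
  induction h with
  | zero => trivial
  | succ h ih => exact ⟨ih, by decide, hd⟩

theorem digTm_wf {d : ℕ} (hd : 9 < d) {f : Tm} (hf : f.WF d) (h : ℕ) : (digTm f h).WF d :=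
  ⟨⟨hf, powTm_wf hd h⟩, ⟨by decide, hd⟩, hf, powTm_wf hd (h + 1)⟩

theorem bitFm_wf {d : ℕ} (hd : 10 < d) {s g : Tm} (hs : s.WF d) (hg : g.WF d) (a : Bool) :
    (bitFm s a g).WF d := by
  have : (offTm a).WF d := by cases a <;> simp [offTm, hd]
  simp [bitFm, shiftTm, hs, hg, this]; omega

theorem baseFm_wf {r : ℕ} (H : SimpleGraph (Fin r)) : (baseFm H).WF numVars := by
  have hd : ∀ h : ℕ, (digTm (.var 20) h).WF 21 := digTm_wf (by decide) (by simp)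
  have hb : ∀ a g, g.WF 21 → (bitFm (.var 13) a g).WF 21 := fun a g hg =>
    bitFm_wf (by decide) (by simp) hg a
  simp only [baseFm, Fm.WF, Fm.wf_allLt, Fm.wf_conj, Fm.wf_iff]
  refine ⟨⟨trivial, by simp, by simp, hb _ _ (by simp), hb _ _ (by simp)⟩, fun a _ =>
    ⟨trivial, by simp, by simp, hb _ _ (by simp), fun h _ => ?_, fun h _ h' _ => ?_⟩⟩
  · simp [hd, hb]
  · split_ifs <;> simp [hd, adjFm, entryTm]

theorem glueDigitFm_wf {d₁ d₂ d : Tm} (h₁ : d₁.WF 25) (h₂ : d₂.WF 25) (h : d.WF 25)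
    (h₁' : d₁.WF 26) (h₂' : d₂.WF 26) : (glueDigitFm d₁ d₂ d).WF 25 := by
  simp [glueDigitFm, eqvFm, entryTm, h₁, h₂, h, h₁', h₂']

theorem joinFm_wf {r : ℕ} (H : SimpleGraph (Fin r)) : (joinFm H).WF numVars := by
  simp only [joinFm, glueFm, Fm.WF, Fm.wf_allLt, Fm.wf_exLt, Fm.wf_conj, Fm.wf_iff, Fm.wf_imp]
  have hb : ∀ s a g d, 10 < d → s.WF d → g.WF d → (bitFm s a g).WF d := fun s a g d hd hs hg =>
    bitFm_wf hd hs hg a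
  refine ⟨trivial, trivial, by simp [rowFm], by simp [rowFm],
    ⟨trivial, by simp, by simp, trivial, by simp, by simp,
    by simp [eqvFm, entryTm], fun a _ => ⟨hb _ _ _ _ (by simp) (by simp) (by simp),
      hb _ _ _ _ (by simp) (by simp) (by simp)⟩⟩, fun a _ => ⟨trivial, by simp, by simp,
      hb _ _ _ _ (by simp) (by simp) (by simp), trivial, by simp, by simp, trivial,
      by simp, by simp,
      hb _ _ _ _ (by simp) (by simp) (by simp), hb _ _ _ _ (by simp) (by simp) (by simp),
      fun h _ => ?_, fun h _ h' _ => ?_⟩⟩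
  · refine glueDigitFm_wf ?_ ?_ ?_ ?_ ?_ <;> exact digTm_wf (by decide) (by simp) _
  · have hd : ∀ x h, 0 < x → x < 25 → (digTm (.var x) h).WF 25 := fun x h h0 hx =>
      digTm_wf (by decide) (by simp [h0, hx]) _
    split_ifs <;> simp [hd]

theorem finalFm_wf (r : ℕ) : (finalFm r).WF numVars := by
  simp only [finalFm, Fm.WF, Fm.wf_allLt, Fm.wf_exLt, Fm.wf_conj, Fm.wf_imp]
  refine ⟨trivial, by simp [rowFm], fun a _ => ⟨trivial, by simp, by simp,
    bitFm_wf (by simp) (by simp) (by simp) a, fun h _ => digTm_wf (by decide) (by simp) _⟩,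
    fun a _ => ⟨trivial, by simp, by simp, by simp, bitFm_wf (by simp) (by simp) (by simp) a⟩⟩

/-- The registers `1`, `5`, `9` and `10` hold the number of types, the address of the powers of two,
and the numbers `B` and `B ^ r`. -/
structure Ctx (r B : ℕ) (ρ μ : ℕ → ℕ) : Prop where
  types : ρ 1 = 2 ^ (2 * B ^ r)
  base : ρ 9 = B
  pats : ρ 10 = B ^ r
  pow : ∀ g < 2 * B ^ r, μ (ρ 5 + g) = 2 ^ g

section Eval

variable {r B : ℕ} {ρ μ : ℕ → ℕ}

theorem Ctx.update (hc : Ctx r B ρ μ) {x : ℕ} (hx : 20 ≤ x) (v : ℕ) :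
    Ctx r B (Function.update ρ x v) μ := by
  have h1 : (1 : ℕ) ≠ x := by omega
  have h5 : (5 : ℕ) ≠ x := by omega
  have h9 : (9 : ℕ) ≠ x := by omega
  have h10 : (10 : ℕ) ≠ x := by omega
  refine ⟨?_, ?_, ?_, ?_⟩
  · rw [Function.update_of_ne h1, hc.types]
  · rw [Function.update_of_ne h9, hc.base]
  · rw [Function.update_of_ne h10, hc.pats]
  · rw [Function.update_of_ne h5]; exact hc.pow

theorem Ctx.pats_le (hc : Ctx r B ρ μ) : B ^ r ≤ ρ 1 := by
  rw [hc.types]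
  have := Nat.lt_two_pow_self (n := 2 * B ^ r)
  omega

theorem Ctx.base_le (hc : Ctx r B ρ μ) (hr : 0 < r) : B ≤ ρ 1 :=
  (Nat.le_self_pow hr.ne' B).trans hc.pats_le

theorem Ctx.eval_exLt (hc : Ctx r B ρ μ) {x : ℕ} (hx : 10 < x) (φ : Fm) :
    (Fm.exLt x (.var 10) φ).Eval μ ρ ↔ ∃ v < B ^ r, φ.Eval μ (Function.update ρ x v) :=
  Fm.eval_exLt (ρ := ρ) ⟨by decide, hx⟩ hc.pats hc.pats_le

theorem Ctx.eval_allLt (hc : Ctx r B ρ μ) {x : ℕ} (hx : 10 < x) (φ : Fm) :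
    (Fm.allLt x (.var 10) φ).Eval μ ρ ↔ ∀ v < B ^ r, φ.Eval μ (Function.update ρ x v) :=
  Fm.eval_allLt (ρ := ρ) ⟨by decide, hx⟩ hc.pats hc.pats_le

theorem eval_powTm (hB : ρ 9 = B) (h : ℕ) : (powTm h).eval ρ μ = B ^ h := by
  induction h with
  | zero => rfl
  | succ h ih => simp [powTm, ih, BinOp.eval, hB, pow_succ]

theorem eval_digTm (hc : Ctx r B ρ μ) (f : Tm) (h : ℕ) :
    (digTm f h).eval ρ μ = dig B (f.eval ρ μ) h := by
  simp only [digTm, Tm.eval, eval_powTm hc.base, BinOp.eval, hc.base, dig]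
  rw [pow_succ, ← Nat.div_div_eq_div_mul, Nat.mod_eq_sub]

theorem eval_bitFm (hc : Ctx r B ρ μ) {s g : Tm} (a : Bool) (hg : g.eval ρ μ < B ^ r) :
    (bitFm s a g).Eval μ ρ ↔ bit (s.eval ρ μ) (off (B ^ r) a + g.eval ρ μ) := by
  have h1 : (offTm a).eval ρ μ = off (B ^ r) a := by
    cases a <;> simp [offTm, off, hc.pats]
  have h2 : off (B ^ r) a + g.eval ρ μ < 2 * B ^ r := by
    cases a <;> simp only [off, Bool.toNat_false, Bool.toNat_true] <;> omega
  simp only [bitFm, Fm.Eval, shiftTm, Tm.eval, BinOp.eval, h1, hc.pow _ h2, bit]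
  omega

theorem dig_lt (hB : 0 < B) (f h : ℕ) : dig B f h < B := Nat.mod_lt _ hB

theorem lt_pow_of_lt_base (hr : 0 < r) {d : ℕ} (hd : d < B) : d < B ^ r :=
  lt_of_lt_of_le hd (Nat.le_self_pow hr.ne' B)

theorem eval_baseFm (H : SimpleGraph (Fin r)) (hr : 0 < r) (hc : Ctx r B ρ μ)
    (hB : μ (ρ 16) + 2 ≤ B) :
    (baseFm H).Eval μ ρ ↔ BaseP H B (μ (ρ 16)) (fun p q =>
      μ (ρ 7 + (μ (ρ 16 + 1 + p) * ρ 2 + μ (ρ 16 + 1 + q))) ≠ 0) (ρ 13) := by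
  have hB1 := hc.base_le hr
  have hB0 : 0 < B := by omega
  simp only [baseFm, Fm.Eval, Fm.eval_conj]
  refine and_congr ?_ ?_
  · rw [Fm.eval_allLt (m := μ (ρ 16)) (by simp) rfl (by omega)]
    refine forall_congr' fun p => imp_congr_right fun hp => ?_
    have hc' := hc.update (x := 20) le_rfl p
    have hlt : p + 2 < B ^ r := lt_pow_of_lt_base hr (by omega)
    rw [Fm.eval_iff, Fm.Eval, eval_bitFm hc' _ (by simpa [BinOp.eval]),
      eval_bitFm hc' _ (by simpa [BinOp.eval])]
    simp [BinOp.eval]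
  · have hcol : ∀ P : Bool → Prop, (∀ a ∈ colors, P a) ↔ ∀ a, P a := fun P => by simp
    rw [hcol]
    refine forall_congr' fun a => ?_
    rw [hc.eval_allLt (by decide)]
    refine forall_congr' fun f => imp_congr_right fun hf => ?_
    have hc' := hc.update (x := 20) le_rfl f
    rw [Fm.eval_iff, eval_bitFm hc' _ (by simpa)]
    simp only [Fm.Eval, Fm.eval_conj, List.mem_finRange, true_imp_iff]
    refine iff_congr (by simp) (and_congr ?_ ?_)
    · refine forall_congr' fun h => ?_
      have hlt := lt_pow_of_lt_base (r := r) hr (dig_lt hB0 f h)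
      rw [Fm.eval_imp, eval_bitFm hc' _ (by simpa [eval_digTm hc'])]
      simp [eval_digTm hc', BinOp.eval]
    · refine forall_congr' fun h => forall_congr' fun h' => ?_
      split_ifs with he hA
      · simp [he]
      · simp [he, hA, eval_digTm hc', BinOp.eval, adjFm, entryTm]
      · simp [he, hA, eval_digTm hc', BinOp.eval, adjFm, entryTm]

theorem eval_glueDigitFm (h16 : μ (ρ 16) ≤ ρ 1) (h17 : μ (ρ 17) ≤ ρ 1)
    {d₁ d₂ d : Tm} (h₁ : d₁.WF 25) (h₂ : d₂.WF 25) :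
    (glueDigitFm d₁ d₂ d).Eval μ ρ ↔ GlueDigit (μ (ρ 16)) (μ (ρ 17))
      (fun p q => μ (ρ 16 + 1 + p) = μ (ρ 17 + 1 + q))
      (d₁.eval ρ μ) (d₂.eval ρ μ) (d.eval ρ μ) := by
  have e : ∀ t : Tm, t.WF 25 → ∀ v, t.eval (Function.update ρ 25 v) μ = t.eval ρ μ :=
    fun t ht v => Tm.eval_congr t ht fun y _ hy => Function.update_of_ne hy.ne _ _
  simp only [glueDigitFm, Fm.eval_or, Fm.Eval, Fm.eval_eq, Fm.eval_imp, Fm.eval_lt,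
    Fm.eval_allLt (m := μ (ρ 16)) (t := .load (.var 16)) (x := 25) (by simp) rfl h16,
    Fm.eval_allLt (m := μ (ρ 17)) (t := .load (.var 17)) (x := 25) (by simp) rfl h17,
    eqvFm, entryTm, Tm.eval, BinOp.eval, e _ h₁, e _ h₂, Function.update_self]
  simp only [ne_eq, Nat.reduceEqDiff, not_false_eq_true, Function.update_of_ne]
  rfl

theorem eval_glueFm (H : SimpleGraph (Fin r)) (hr : 0 < r) (hc : Ctx r B ρ μ)
    (h16 : μ (ρ 16) + 2 ≤ B) (h17 : μ (ρ 17) + 2 ≤ B) :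
    (glueFm H).Eval μ ρ ↔ GlueP H B (μ (ρ 16)) (μ (ρ 17))
      (fun p q => μ (ρ 16 + 1 + p) = μ (ρ 17 + 1 + q)) (ρ 20) (ρ 21) (ρ 13) := by
  have hB1 := hc.base_le hr
  have hcol : ∀ P : Bool → Prop, (∀ a ∈ colors, P a) ↔ ∀ a, P a := fun P => by simp
  simp only [glueFm, Fm.Eval, Fm.eval_conj]
  refine and_congr ?_ ?_
  · rw [Fm.eval_allLt (m := μ (ρ 16)) (by simp) rfl (by omega)]
    refine forall_congr' fun p => imp_congr_right fun hp => ?_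
    rw [Fm.eval_allLt (m := μ (ρ 17)) (by simp) (by simp) (by simp; omega)]
    refine forall_congr' fun q => imp_congr_right fun hq => ?_
    have hc' := (hc.update (x := 22) (by decide) p).update (x := 23) (by decide) q
    have hp' : p + 2 < B ^ r := lt_pow_of_lt_base hr (by omega)
    have hq' : q + 2 < B ^ r := lt_pow_of_lt_base hr (by omega)
    rw [Fm.eval_imp, Fm.eval_conj, hcol]
    refine imp_congr (by simp [eqvFm, entryTm, BinOp.eval]) (forall_congr' fun a => ?_)
    rw [Fm.eval_iff, eval_bitFm hc' _ (by simpa [BinOp.eval]),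
      eval_bitFm hc' _ (by simpa [BinOp.eval])]
    simp [BinOp.eval]
  · rw [hcol]
    refine forall_congr' fun a => ?_
    rw [hc.eval_allLt (by decide)]
    refine forall_congr' fun f => imp_congr_right fun hf => ?_
    have hc1 := hc.update (x := 22) (by decide) f
    rw [Fm.eval_iff, eval_bitFm hc1 _ (by simpa),
      hc1.eval_exLt (by decide)]
    refine iff_congr (by simp) (exists_congr fun f₁ => and_congr_right fun hf₁ => ?_)
    have hc2 := hc1.update (x := 23) (by decide) f₁
    rw [hc2.eval_exLt (by decide)]
    refine exists_congr fun f₂ => and_congr_right fun hf₂ => ?_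
    have hc3 := hc2.update (x := 24) (by decide) f₂
    simp only [Fm.Eval, Fm.eval_conj, List.mem_finRange, true_imp_iff]
    rw [eval_bitFm hc3 _ (by simpa), eval_bitFm hc3 _ (by simpa)]
    refine and_congr (by simp) (and_congr (by simp) (and_congr ?_ ?_))
    · refine forall_congr' fun h => ?_
      rw [eval_glueDigitFm (by simp; omega) (by simp; omega)
        (digTm_wf (by decide) (by simp) _) (digTm_wf (by decide) (by simp) _)]
      simp [eval_digTm hc3]
    · refine forall_congr' fun h => forall_congr' fun h' => ?_
      split_ifs with hA
      · simp [hA, eval_digTm hc3]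
      · simp [hA]

theorem eval_joinFm (H : SimpleGraph (Fin r)) (hr : 0 < r) (hc : Ctx r B ρ μ)
    (h16 : μ (ρ 16) + 2 ≤ B) (h17 : μ (ρ 17) + 2 ≤ B) :
    (joinFm H).Eval μ ρ ↔ ∃ s₁ < ρ 1, ∃ s₂ < ρ 1, μ (ρ 8 + (ρ 18 * ρ 1 + s₁)) ≠ 0 ∧
      μ (ρ 8 + (ρ 19 * ρ 1 + s₂)) ≠ 0 ∧ GlueP H B (μ (ρ 16)) (μ (ρ 17))
      (fun p q => μ (ρ 16 + 1 + p) = μ (ρ 17 + 1 + q)) s₁ s₂ (ρ 13) := by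
  simp only [joinFm, Fm.Eval]
  refine exists_congr fun s₁ => and_congr_right fun _ => ?_
  have e1 : Function.update ρ 20 s₁ 1 = ρ 1 := by simp
  rw [e1]
  refine exists_congr fun s₂ => and_congr_right fun _ => ?_
  have hc' := (hc.update (x := 20) le_rfl s₁).update (x := 21) (by decide) s₂
  rw [eval_glueFm H hr hc' (by simpa) (by simpa)]
  simp [rowFm, BinOp.eval]

theorem eval_finalFm (hr : 0 < r) (hc : Ctx r B ρ μ) :
    (finalFm r).Eval μ ρ ↔ ∃ s < ρ 1, μ (ρ 8 + (ρ 18 * ρ 1 + s)) ≠ 0 ∧ FinalP r B s := by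
  have hB1 := hc.base_le hr
  have hcol : ∀ P : Bool → Prop, (∀ a ∈ colors, P a) ↔ ∀ a, P a := fun P => by simp
  simp only [finalFm, Fm.Eval, Fm.eval_conj]
  refine exists_congr fun s => and_congr_right fun _ => ?_
  have hc1 := hc.update (x := 20) le_rfl s
  refine and_congr (by simp [rowFm, BinOp.eval]) (and_congr ?_ ?_)
  · rw [hcol]
    refine forall_congr' fun a => ?_
    rw [hc1.eval_allLt (by decide)]
    refine forall_congr' fun f => imp_congr_right fun hf => ?_
    have hc2 := hc1.update (x := 21) (by decide) f
    rw [Fm.eval_imp, eval_bitFm hc2 _ (by simpa)]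
    simp [eval_digTm hc2]
  · rw [hcol]
    refine forall_congr' fun a => ?_
    rw [Fm.eval_exLt (ρ := Function.update ρ 20 s) (m := B) (t := .var 9) (by simp) hc1.base
      (by simpa)]
    refine exists_congr fun d => and_congr_right fun hd => ?_
    have hc2 := hc1.update (x := 21) (by decide) d
    rw [Fm.Eval, eval_bitFm hc2 _ (by simpa using lt_pow_of_lt_base hr hd)]
    simp

end Eval

/-! ### The input and the memory layout -/

/-- The address of list number `q` in the input. -/
def ptr (lst : ℕ → List ℕ) (q : ℕ) : ℕ := 3 + ∑ i ∈ Finset.range q, ((lst i).length + 1)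

/-- The input consists of three numbers and `n + 2 * N` lists: the neighbours of the vertices and,
for each node, its children and its bag. -/
def inputOf (n N root : ℕ) (lst : ℕ → List ℕ) : List ℕ :=
  [n, N, root] ++ (List.range (n + 2 * N)).flatMap fun q => (lst q).length :: lst q

/-- The input, followed by the table of the addresses of its lists. -/
def withPtrs (n N root : ℕ) (lst : ℕ → List ℕ) : List ℕ :=
  inputOf n N root lst ++ (List.range (n + 2 * N)).map (ptr lst)

theorem length_flatMap_range (f : ℕ → List ℕ) (m : ℕ) :
    ((List.range m).flatMap f).length = ∑ i ∈ Finset.range m, (f i).length := by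
  induction m with
  | zero => simp
  | succ m ih => simp [List.range_succ, Finset.sum_range_succ, ih]

theorem getD_flatMap_range (f : ℕ → List ℕ) {m q e : ℕ} (hq : q < m) (he : e < (f q).length) :
    ((List.range m).flatMap f).getD (∑ i ∈ Finset.range q, (f i).length + e) 0 =
      (f q).getD e 0 := by
  induction m with
  | zero => omega
  | succ m ih =>
    rw [List.range_succ, List.flatMap_append]
    rcases Nat.lt_succ_iff_lt_or_eq.1 hq with h | rfl
    · rw [List.getD_append, ih h]
      rw [length_flatMap_range]
      have h1 : ∑ i ∈ Finset.range (q + 1), (f i).length ≤ ∑ i ∈ Finset.range m, (f i).length :=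
        Finset.sum_le_sum_of_subset (Finset.range_mono h)
      rw [Finset.sum_range_succ] at h1
      omega
    · rw [List.getD_append_right _ _ _ _ (by rw [length_flatMap_range]; omega),
        length_flatMap_range, Nat.add_sub_cancel_left]
      simp

theorem ptr_succ (lst : ℕ → List ℕ) (q : ℕ) :
    ptr lst (q + 1) = ptr lst q + ((lst q).length + 1) := by
  simp [ptr, Finset.sum_range_succ]; omega

theorem ptr_mono (lst : ℕ → List ℕ) : Monotone (ptr lst) :=
  monotone_nat_of_le_succ fun q => by rw [ptr_succ]; omega

theorem ptr_add_lt {lst : ℕ → List ℕ} {q m c : ℕ} (hq : q < m) (hc : c ≤ (lst q).length) :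
    ptr lst q + c < ptr lst m := by
  have := ptr_mono lst (show q + 1 ≤ m by omega)
  rw [ptr_succ] at this
  omega

/-- Different positions in the lists have different addresses. -/
theorem ptr_add_inj {lst : ℕ → List ℕ} {q q' c c' : ℕ} (hc : c ≤ (lst q).length)
    (hc' : c' ≤ (lst q').length) (h : ptr lst q + c = ptr lst q' + c') : q = q' ∧ c = c' := by
  rcases lt_trichotomy q q' with hq | rfl | hq
  · have := ptr_add_lt hq hc
    omega
  · exact ⟨rfl, by omega⟩
  · have := ptr_add_lt hq hc'
    omega

theorem length_inputOf (n N root : ℕ) (lst : ℕ → List ℕ) :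
    (inputOf n N root lst).length = ptr lst (n + 2 * N) := by
  rw [inputOf, List.length_append, length_flatMap_range, ptr]
  simp

theorem getD_inputOf {n N root : ℕ} {lst : ℕ → List ℕ} {q e : ℕ} (hq : q < n + 2 * N)
    (he : e ≤ (lst q).length) :
    (inputOf n N root lst).getD (ptr lst q + e) 0 = ((lst q).length :: lst q).getD e 0 := by
  have h := getD_flatMap_range (fun q => (lst q).length :: lst q) hq
    (show e < ((lst q).length :: lst q).length by simp; omega)
  simp only [List.length_cons] at h
  rw [inputOf, List.getD_append_right _ _ _ _ (by simp [ptr]; omega), ← h]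
  congr 1
  simp [ptr]; omega

/-- What the memory `μ` contains of the input and of the table of list addresses. -/
structure HoldsInput (n N root : ℕ) (lst : ℕ → List ℕ) (μ : ℕ → ℕ) : Prop where
  root_eq : μ 2 = root
  ptr_eq : ∀ q < n + 2 * N, μ (ptr lst (n + 2 * N) + q) = ptr lst q
  len_eq : ∀ q < n + 2 * N, μ (ptr lst q) = (lst q).length
  entry_eq : ∀ q < n + 2 * N, ∀ e < (lst q).length, μ (ptr lst q + 1 + e) = (lst q).getD e 0

theorem length_withPtrs (n N root : ℕ) (lst : ℕ → List ℕ) :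
    (withPtrs n N root lst).length = ptr lst (n + 2 * N) + (n + 2 * N) := by
  simp [withPtrs, length_inputOf]

theorem holdsInput_of_withPtrs {n N root : ℕ} {lst : ℕ → List ℕ} {μ : ℕ → ℕ}
    (h : ∀ a < (withPtrs n N root lst).length, μ a = (withPtrs n N root lst).getD a 0) :
    HoldsInput n N root lst μ := by
  have hl := length_withPtrs n N root lst
  have hi := length_inputOf n N root lst
  have h3 : 3 ≤ ptr lst (n + 2 * N) := by simp [ptr]
  refine ⟨?_, fun q hq => ?_, fun q hq => ?_, fun q hq e he => ?_⟩
  · rw [h 2 (by omega), withPtrs, List.getD_append _ _ _ _ (by omega)]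
    rfl
  · rw [h _ (by omega), withPtrs, List.getD_append_right _ _ _ _ (by omega), hi,
      Nat.add_sub_cancel_left]
    simp [List.getD_eq_getElem?_getD, List.getElem?_range hq]
  · have hlt := ptr_add_lt hq (Nat.zero_le (lst q).length)
    have := getD_inputOf (root := root) hq (Nat.zero_le (lst q).length)
    rw [h _ (by omega), withPtrs, List.getD_append _ _ _ _ (by omega)]
    simpa using this
  · have hlt := ptr_add_lt hq (show e + 1 ≤ (lst q).length by omega)
    have := getD_inputOf (root := root) hq (show e + 1 ≤ (lst q).length by omega)
    rw [h _ (by omega), withPtrs, List.getD_append _ _ _ _ (by omega), add_assoc, add_comm 1 e,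
      this]
    simp

/-! ### Rules for sequences of assignments -/

@[simp] theorem Config.setReg_reg (σ : Config) (x v y : ℕ) :
    (σ.setReg x v).reg y = if y = x then v else σ.reg y := by
  simp [Config.setReg, Function.update_apply]

@[simp] theorem Config.setReg_mem (σ : Config) (x v : ℕ) : (σ.setReg x v).mem = σ.mem := rfl

@[simp] theorem Config.setMem_reg (σ : Config) (a v : ℕ) : (σ.setMem a v).reg = σ.reg := rfl

theorem Config.setMem_mem (σ : Config) (a v b : ℕ) :
    (σ.setMem a v).mem b = if b = a then v else σ.mem b := by
  simp [Config.setMem, Function.update_apply]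

/-- Words are long enough for all terms of degree at most `40` over numbers up to `Q`. -/
structure Wide (w Q : ℕ) : Prop where
  two_le : 2 ≤ Q
  pow_lt : ∀ d ≤ 40, Q ^ d < 2 ^ w

section Rules

variable {w Q : ℕ} {σ : Config} {Post : Config → Prop} {P R : Cmd} {T U x y v l m : ℕ} {t a : Tm}

theorem Wide.set (hw : Wide w Q) (v : ℕ) (hσ : Bdd Q numVars σ)
    (hv : t.eval σ.reg σ.mem = v) (hvQ : v ≤ Q) (hP : Post (σ.setReg x v))
    (hx : 0 < x ∧ x < numVars := by decide) (ht : t.WF numVars := by simp)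
    (hd : t.deg ≤ 40 := by simp) : HT w Q (setTm x t) (t.time + 2) σ Post :=
  HT.setTm hw.two_le hσ hx ht (hw.pow_lt _ hd) (hv ▸ hvQ) (hv ▸ hP)

theorem Wide.put (hw : Wide w Q) (l v : ℕ) (hσ : Bdd Q numVars σ)
    (hl : a.eval σ.reg σ.mem = l) (hv : t.eval σ.reg σ.mem = v) (hvQ : v ≤ Q)
    (hP : Post (σ.setMem l v)) (ha : a.WF numVars := by simp) (ht : t.WF numVars := by simp)
    (hda : a.deg ≤ 40 := by simp) (hd : t.deg ≤ 40 := by simp) :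
    HT w Q (putTm a t) (a.time + t.time + 1) σ Post :=
  HT.putTm hw.two_le hσ ha ht (hw.pow_lt _ hda) (hw.pow_lt _ hd) (hv ▸ hvQ) (hl ▸ hv ▸ hP)

theorem Wide.set_seq (hw : Wide w Q) (v : ℕ) (hσ : Bdd Q numVars σ)
    (hv : t.eval σ.reg σ.mem = v) (hvQ : v ≤ Q)
    (hP : Bdd Q numVars (σ.setReg x v) → HT w Q P T (σ.setReg x v) Post)
    (hx : 0 < x ∧ x < numVars := by decide) (ht : t.WF numVars := by simp)
    (hd : t.deg ≤ 40 := by simp) :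
    HT w Q (.seq (setTm x t) P) (t.time + 2 + T) σ Post :=
  HT.seq (Post' := fun σ' => σ' = σ.setReg x v) (hw.set v hσ hv hvQ rfl hx ht hd)
    fun _ _ h => h ▸ hP (hσ.setReg x hvQ)

theorem Wide.put_seq (hw : Wide w Q) (l v : ℕ) (hσ : Bdd Q numVars σ)
    (hl : a.eval σ.reg σ.mem = l) (hv : t.eval σ.reg σ.mem = v) (hvQ : v ≤ Q)
    (hP : Bdd Q numVars (σ.setMem l v) → HT w Q P T (σ.setMem l v) Post)
    (ha : a.WF numVars := by simp) (ht : t.WF numVars := by simp)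
    (hda : a.deg ≤ 40 := by simp) (hd : t.deg ≤ 40 := by simp) :
    HT w Q (.seq (putTm a t) P) (a.time + t.time + 1 + T) σ Post :=
  HT.seq (Post' := fun σ' => σ' = σ.setMem l v) (hw.put l v hσ hl hv hvQ rfl ha ht hda hd)
    fun _ _ h => h ▸ hP (hσ.setMem l hvQ)

theorem Wide.loop (hw : Wide w Q) (m : ℕ) (T : ℕ → ℕ) (I : ℕ → Config → Prop)
    (hσ : Bdd Q numVars σ) (hm : σ.reg y = m) (h0 : I 0 (σ.setReg x 0))
    (hstep : ∀ k σ', k < m → Bdd Q numVars σ' → σ'.reg x = k → σ'.reg y = m → I k σ' →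
      HT w Q P (T k) σ' fun σ'' => σ''.reg x = k ∧ σ''.reg y = m ∧ I (k + 1) (σ''.setReg x (k + 1)))
    (hend : ∀ σ', Bdd Q numVars σ' → I m σ' → Post σ')
    (hx : 0 < x ∧ x < numVars := by decide) (hy : 0 < y ∧ y < numVars := by decide)
    (hxy : y ≠ x := by decide) :
    HT w Q (forLoop x y P) (∑ k ∈ Finset.range m, (T k + 8) + 5) σ Post :=
  HT.forLoop hw.two_le (hw.pow_lt 4 (by decide)) I hσ hx hy hxy hm h0 hstep hend

theorem Wide.loop_seq (hw : Wide w Q) (m : ℕ) (T : ℕ → ℕ) (I : ℕ → Config → Prop)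
    (hσ : Bdd Q numVars σ) (hm : σ.reg y = m) (h0 : I 0 (σ.setReg x 0))
    (hstep : ∀ k σ', k < m → Bdd Q numVars σ' → σ'.reg x = k → σ'.reg y = m → I k σ' →
      HT w Q P (T k) σ' fun σ'' => σ''.reg x = k ∧ σ''.reg y = m ∧ I (k + 1) (σ''.setReg x (k + 1)))
    (hend : ∀ σ', Bdd Q numVars σ' → I m σ' → HT w Q R U σ' Post)
    (hx : 0 < x ∧ x < numVars := by decide) (hy : 0 < y ∧ y < numVars := by decide)
    (hxy : y ≠ x := by decide) :
    HT w Q (.seq (forLoop x y P) R) (∑ k ∈ Finset.range m, (T k + 8) + 5 + U) σ Post :=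
  HT.seq (hw.loop m T I hσ hm h0 hstep (fun _ _ h => h) hx hy hxy) hend

end Rules

/-- The memory contains the list `l`, followed by zeros. -/
def MemIs (σ : Config) (l : List ℕ) : Prop := ∀ a, σ.mem a = l.getD a 0

theorem MemIs.append {σ : Config} {l : List ℕ} (h : MemIs σ l) {a : ℕ} (ha : a = l.length) (v : ℕ) :
    MemIs (σ.setMem a v) (l ++ [v]) := by
  intro b
  subst ha
  rw [Config.setMem_mem]
  split_ifs with hb
  · subst hb
    rw [List.getD_append_right _ _ _ _ le_rfl]; simp
  · rw [h b]
    rcases lt_or_ge b l.length with hlt | hge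
    · rw [List.getD_append _ _ _ _ hlt]
    · rw [List.getD_append_right _ _ _ _ hge, List.getD_eq_default _ _ hge,
        List.getD_eq_default _ _ (by simp; omega)]

theorem MemIs.holdsInput {σ : Config} {n N root : ℕ} {lst : ℕ → List ℕ} {l : List ℕ}
    (h : MemIs σ (withPtrs n N root lst ++ l)) : HoldsInput n N root lst σ.mem :=
  holdsInput_of_withPtrs fun a ha => by rw [h a, List.getD_append _ _ _ _ ha]

/-! ### The table of list addresses -/

/-- Computes the length of the input into register `4` and appends the table of list addresses. -/
def ptrCmd : Cmd :=
  .seq (setTm 2 (.load (.const 0))) <| .seq (setTm 3 (.load (.const 1))) <|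
  .seq (setTm 4 (.const 3)) <| .seq (setTm 15 (.add (.var 2) (.mul (.const 2) (.var 3)))) <|
  .seq (forLoop 11 15 (setTm 4 (.add (.var 4) (.add (.load (.var 4)) (.const 1))))) <|
  .seq (setTm 14 (.const 3)) <|
  forLoop 11 15 <| .seq (putTm (.add (.var 4) (.var 11)) (.var 14)) <|
    setTm 14 (.add (.var 14) (.add (.load (.var 14)) (.const 1)))

section Phases

variable {w Q n N root : ℕ} {lst : ℕ → List ℕ} {σ : Config}

theorem ht_ptrCmd (hw : Wide w Q) (hσ : Bdd Q numVars σ) (hm : MemIs σ (inputOf n N root lst))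
    (hQ : ptr lst (n + 2 * N) + (n + 2 * N) ≤ Q) :
    HT w Q ptrCmd ((n + 2 * N) * 45 + 60) σ fun σ' =>
      σ'.reg 2 = n ∧ σ'.reg 3 = N ∧ σ'.reg 4 = ptr lst (n + 2 * N) ∧
        σ'.reg 15 = n + 2 * N ∧ MemIs σ' (withPtrs n N root lst) := by
  have h3 : 3 ≤ ptr lst (n + 2 * N) := by simp [ptr]
  have hlen : ∀ q < n + 2 * N, (inputOf n N root lst).getD (ptr lst q) 0 = (lst q).length :=
    fun q hq => by simpa using getD_inputOf (root := root) hq (Nat.zero_le _)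
  have hptr : ∀ q ≤ n + 2 * N, ptr lst q ≤ Q := fun q hq => by
    have := ptr_mono lst hq
    omega
  refine HT.le (hw.set_seq n hσ (by simp [hm 0, inputOf]) (by omega)
    fun b1 => hw.set_seq N b1 (by simp [hm 1, inputOf]) (by omega)
    fun b2 => hw.set_seq 3 b2 (by simp) (by omega)
    fun b3 => hw.set_seq (n + 2 * N) b3 (by simp [BinOp.eval]) (by omega)
    fun b4 => hw.loop_seq (n + 2 * N) (fun _ => 10) (fun k σ' => σ'.reg 2 = n ∧ σ'.reg 3 = N ∧
        σ'.reg 4 = ptr lst k ∧ σ'.reg 15 = n + 2 * N ∧ MemIs σ' (inputOf n N root lst))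
      b4 (by simp) (by simpa [ptr, MemIs] using hm)
      (fun k σ' hk b x1 y1 ⟨i2, i3, i4, i15, im⟩ => (hw.set (ptr lst (k + 1)) b
        (by simp [BinOp.eval, i4, im _, -List.getD_eq_getElem?_getD, hlen k hk, ptr_succ])
        (hptr _ hk) (by simpa [i2, i3, x1, y1, MemIs] using im)).le (by simp))
    fun σ5 b5 ⟨i2, i3, i4, i15, im⟩ => hw.set_seq 3 b5 (by simp) (by omega)
    fun b6 => hw.loop (n + 2 * N) (fun _ => 18) (fun k σ' => σ'.reg 2 = n ∧ σ'.reg 3 = N ∧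
        σ'.reg 4 = ptr lst (n + 2 * N) ∧ σ'.reg 15 = n + 2 * N ∧ σ'.reg 14 = ptr lst k ∧
        MemIs σ' (inputOf n N root lst ++ (List.range k).map (ptr lst)))
      b6 (by simp [i15]) (by simpa [i2, i3, i4, i15, ptr, MemIs] using im)
      (fun k σ' hk b x1 y1 ⟨i2, i3, i4, i15, i14, im⟩ =>
        (hw.put_seq (ptr lst (n + 2 * N) + k) (ptr lst k) b (by simp [BinOp.eval, i4, x1])
          (by simp [i14]) (hptr _ hk.le) fun b' => by
            have im' := im.append (a := ptr lst (n + 2 * N) + k) (by simp [length_inputOf])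
              (ptr lst k)
            have hl : (σ'.setMem (ptr lst (n + 2 * N) + k) (ptr lst k)).mem (ptr lst k) =
                (lst k).length := by
              have := ptr_add_lt hk (Nat.zero_le (lst k).length)
              rw [im', List.append_assoc, List.getD_append _ _ _ _
                (by rw [length_inputOf]; omega), hlen k hk]
            exact hw.set (ptr lst (k + 1)) b' (by simp [BinOp.eval, i14, hl, ptr_succ]) (hptr _ hk)
              (by simpa [i2, i3, i4, i15, i14, x1, List.range_succ, MemIs] using im'))
        |>.le (by simp))
      (fun σ' _ ⟨i2, i3, i4, i15, _, im⟩ => ⟨i2, i3, i4, i15, im⟩))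
    (by simp; omega)

end Phases

/-! ### Powers of two, breadth-first queue and adjacency matrix -/

/-- The two configurations agree on all registers outside of `l`. -/
def Same (l : List ℕ) (σ σ' : Config) : Prop := ∀ y, y ∉ l → σ'.reg y = σ.reg y

theorem Same.refl (l : List ℕ) (σ : Config) : Same l σ σ := fun _ _ => rfl

theorem Same.setReg {l : List ℕ} {σ σ' : Config} (h : Same l σ σ') {x : ℕ} (hx : x ∈ l) (v : ℕ) :
    Same l σ (σ'.setReg x v) := fun y hy => by
  have : y ≠ x := fun e => hy (e ▸ hx)
  rw [Config.setReg_reg, if_neg this, h y hy]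

theorem Same.setMem {l : List ℕ} {σ σ' : Config} (h : Same l σ σ') (a v : ℕ) :
    Same l σ (σ'.setMem a v) := h

theorem Same.trans {l : List ℕ} {σ σ' σ'' : Config} (h : Same l σ σ') (h' : Same l σ' σ'') :
    Same l σ σ'' := fun y hy => (h' y hy).trans (h y hy)

theorem Same.mono {l l' : List ℕ} {σ σ' : Config} (h : Same l σ σ') (hl : l ⊆ l') :
    Same l' σ σ' := fun y hy => h y fun hm => hy (hl hm)

theorem Same.eq {l : List ℕ} {σ σ' : Config} (h : Same l σ σ') {y v : ℕ} (hv : σ.reg y = v)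
    (hy : y ∉ l := by decide) : σ'.reg y = v := (h y hy).trans hv

/-- The address of the list of children of node `i`. -/
def kidsTm (i : Tm) : Tm := .load (.add (.var 4) (.add (.var 2) (.mul (.const 2) i)))

/-- The address of the bag of node `i`. -/
def bagTm (i : Tm) : Tm :=
  .load (.add (.var 4) (.add (.var 2) (.add (.mul (.const 2) i) (.const 1))))

/-- The largest size of one of the first `k` bags, plus `2`. -/
def baseOf (n : ℕ) (lst : ℕ → List ℕ) (k : ℕ) : ℕ :=
  ((Finset.range k).sup fun i => (lst (n + (2 * i + 1))).length + 2) ⊔ 2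

theorem baseOf_succ (n : ℕ) (lst : ℕ → List ℕ) (k : ℕ) :
    baseOf n lst (k + 1) = baseOf n lst k +
      ((lst (n + (2 * k + 1))).length + 2 - baseOf n lst k) := by
  have h : baseOf n lst (k + 1) = ((lst (n + (2 * k + 1))).length + 2) ⊔ baseOf n lst k := by
    simp only [baseOf, Finset.range_add_one, Finset.sup_insert, sup_assoc]
  rw [h]
  rcases le_total ((lst (n + (2 * k + 1))).length + 2) (baseOf n lst k) with h | h
  · rw [sup_eq_right.2 h]; omega
  · rw [sup_eq_left.2 h]; omega

theorem baseOf_mono (n : ℕ) (lst : ℕ → List ℕ) : Monotone (baseOf n lst) :=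
  monotone_nat_of_le_succ fun k => by rw [baseOf_succ]; omega

theorem length_bag_le {n N i : ℕ} {lst : ℕ → List ℕ} (hi : i < N) :
    (lst (n + (2 * i + 1))).length + 2 ≤ baseOf n lst N :=
  le_sup_of_le_left (Finset.le_sup (f := fun i => (lst (n + (2 * i + 1))).length + 2)
    (Finset.mem_range.2 hi))

/-- The contents of the memory after the computation of the powers of two. -/
def withPows (n N root : ℕ) (lst : ℕ → List ℕ) (m : ℕ) : List ℕ :=
  withPtrs n N root lst ++ (List.range m).map (2 ^ ·)

/-- Computes `B`, `F = B ^ r` and `S = 2 ^ (2 * F)` into the registers `9`, `10` and `1`, and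
appends the table of the powers of two. -/
def powCmd (r : ℕ) : Cmd :=
  .seq (setTm 9 (.const 2)) <|
  .seq (forLoop 11 3 (setTm 9 (.add (.var 9)
    (.sub (.add (.load (bagTm (.var 11))) (.const 2)) (.var 9))))) <|
  .seq (setTm 10 (powTm r)) <| .seq (setTm 5 (.add (.var 4) (.var 15))) <|
  .seq (setTm 1 (.const 1)) <| .seq (setTm 15 (.mul (.const 2) (.var 10))) <|
  forLoop 11 15 <| .seq (putTm (.add (.var 5) (.var 11)) (.var 1)) <|
    setTm 1 (.mul (.var 1) (.const 2))

/-- Appends the queue of the breadth-first search. -/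
def bfsCmd : Cmd :=
  .seq (setTm 6 (.add (.var 5) (.var 15))) <| .seq (putTm (.var 6) (.load (.const 2))) <|
  .seq (setTm 13 (.const 1)) <|
  forLoop 11 3 <| .seq (setTm 14 (kidsTm (.load (.add (.var 6) (.var 11))))) <|
    .seq (setTm 15 (.load (.var 14))) <|
    .seq (forLoop 12 15 (putTm (.add (.var 6) (.add (.var 13) (.var 12)))
      (entryTm (.var 14) (.var 12)))) <|
    setTm 13 (.add (.var 13) (.var 15))

/-- Marks the edges in the adjacency matrix, all other entries of which are `0` from the start. -/
def adjCmd : Cmd :=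
  .seq (setTm 7 (.add (.var 6) (.var 3))) <|
  .seq (setTm 8 (.add (.var 7) (.mul (.var 2) (.var 2)))) <|
  forLoop 11 2 <| .seq (setTm 14 (.load (.add (.var 4) (.var 11)))) <|
    .seq (setTm 15 (.load (.var 14))) <|
    forLoop 12 15 <| putTm (.add (.var 7) (.add (.mul (.var 11) (.var 2))
      (entryTm (.var 14) (.var 12)))) (.const 1)

section Phases

variable {w Q n N root : ℕ} {lst : ℕ → List ℕ} {σ : Config}

theorem ht_powCmd (hw : Wide w Q) {r : ℕ} (hr : 0 < r) (hwr : Q ^ (powTm r).deg < 2 ^ w)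
    (hσ : Bdd Q numVars σ) (hm : MemIs σ (withPtrs n N root lst)) (h2 : σ.reg 2 = n)
    (h3 : σ.reg 3 = N) (h4 : σ.reg 4 = ptr lst (n + 2 * N)) (h15 : σ.reg 15 = n + 2 * N)
    {B : ℕ} (hB : B = baseOf n lst N)
    (hQ : ptr lst (n + 2 * N) + (n + 2 * N) + 2 * B ^ r ≤ Q) (hS : 2 ^ (2 * B ^ r) ≤ Q) :
    HT w Q (powCmd r) (N * 40 + 2 * B ^ r * 30 + (powTm r).time + 60) σ fun σ' =>
      Same [1, 5, 9, 10, 11, 14, 15] σ σ' ∧ σ'.reg 1 = 2 ^ (2 * B ^ r) ∧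
        σ'.reg 5 = ptr lst (n + 2 * N) + (n + 2 * N) ∧ σ'.reg 9 = B ∧ σ'.reg 10 = B ^ r ∧
        σ'.reg 15 = 2 * B ^ r ∧ MemIs σ' (withPows n N root lst (2 * B ^ r)) := by
  have hin := MemIs.holdsInput (l := []) (by simpa using hm)
  have hBF : B ≤ B ^ r := Nat.le_self_pow hr.ne' B
  have hB2 : 2 ≤ B := hB ▸ le_sup_right
  have hbase : ∀ k ≤ N, baseOf n lst k ≤ B := fun k hk => hB ▸ baseOf_mono n lst hk
  have hQ2 := hw.two_le
  refine HT.le (hw.set_seq 2 hσ rfl hQ2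
    fun b1 => hw.loop_seq N (fun _ => 32) (fun k σ' => Same [9, 11] σ σ' ∧
        σ'.reg 9 = baseOf n lst k ∧ σ'.mem = σ.mem)
      b1 (by simp [h3]) ⟨((Same.refl _ _).setReg (by decide) _).setReg (by decide) _,
        by simp [baseOf], rfl⟩
      (fun k σ' hk b x1 y1 ⟨is, i9, im⟩ => (hw.set (baseOf n lst (k + 1)) b (by
          have e1 := hin.ptr_eq (n + (2 * k + 1)) (by omega)
          have e2 := hin.len_eq (n + (2 * k + 1)) (by omega)
          simp [BinOp.eval, bagTm, im, is.eq h4, is.eq h2, x1, e1, e2, i9, baseOf_succ])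
        (by have := hbase (k + 1) hk; omega)
        ⟨by simp [x1], by simp [y1], (is.setReg (by decide) _).setReg (by decide) _,
          by simp, by simpa using im⟩ (by decide) (by simp [bagTm]) (by simp [bagTm])).le
        (by simp [bagTm]))
    fun σ2 b2 ⟨is, i9, im⟩ => HT.seq (P := setTm 10 (powTm r))
      (Post' := fun σ' => σ' = σ2.setReg 10 (B ^ r))
      (by
        have e : (powTm r).eval σ2.reg σ2.mem = B ^ r := eval_powTm (i9.trans hB.symm) r
        exact HT.setTm hQ2 b2 (by decide) (powTm_wf (by decide) r) hwr (by rw [e]; omega)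
          (by rw [e]))
    fun σ3 b3 e3 => hw.set_seq (ptr lst (n + 2 * N) + (n + 2 * N)) b3
      (by simp [BinOp.eval, e3, is.eq h4, is.eq h15]) (by omega)
    fun b4 => hw.set_seq 1 b4 rfl (by omega)
    fun b5 => hw.set_seq (2 * B ^ r) b5 (by simp [BinOp.eval, e3]) (by omega)
    fun b6 => hw.loop (2 * B ^ r) (fun _ => 22) (fun k σ' =>
        Same [1, 5, 9, 10, 11, 14, 15] σ σ' ∧ σ'.reg 1 = 2 ^ k ∧
        σ'.reg 5 = ptr lst (n + 2 * N) + (n + 2 * N) ∧ σ'.reg 9 = B ∧ σ'.reg 10 = B ^ r ∧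
        σ'.reg 15 = 2 * B ^ r ∧ MemIs σ' (withPows n N root lst k))
      b6 (by simp) ⟨by
          have := ((is.mono (by decide) : Same [1, 5, 9, 10, 11, 14, 15] σ σ2).setReg
            (x := 10) (by decide) (B ^ r))
          subst e3
          exact (((this.setReg (by decide) _).setReg (by decide) _).setReg (by decide) _).setReg
            (by decide) _, by simp, by simp, by simp [e3, i9, hB], by simp [e3], by simp,
          by simpa [e3, im, MemIs, withPows] using hm⟩
      (fun k σ' hk b x1 y1 ⟨is, i1, i5, i9, i10, i15, im⟩ => (hw.put_seq
        (ptr lst (n + 2 * N) + (n + 2 * N) + k) (2 ^ k) b (by simp [BinOp.eval, i5, x1])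
        (by simp [i1]) ((Nat.pow_le_pow_right (by omega) hk.le).trans hS)
        fun b' => hw.set (2 ^ (k + 1)) b' (by simp [BinOp.eval, i1, pow_succ])
          ((Nat.pow_le_pow_right (by omega) hk).trans hS)
          ⟨by simp [x1], by simp [i15], ((is.setMem _ _).setReg (by decide) _).setReg (by decide) _,
            by simp, by simp [i5], by simp [i9], by simp [i10], by simp [i15], by
              have := im.append (a := ptr lst (n + 2 * N) + (n + 2 * N) + k)
                (by simp [withPows, length_withPtrs]) (2 ^ k)
              rw [withPows, List.append_assoc] at this
              simpa [withPows, List.range_succ, MemIs] using this⟩).le (by simp))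
      (fun σ' _ h => h)) ?_
  simp; omega

theorem ht_bfsCmd (hw : Wide w Q) {m : ℕ} (hσ : Bdd Q numVars σ)
    (hm : MemIs σ (withPows n N root lst m)) (h2 : σ.reg 2 = n) (h3 : σ.reg 3 = N)
    (h4 : σ.reg 4 = ptr lst (n + 2 * N)) (h5 : σ.reg 5 = ptr lst (n + 2 * N) + (n + 2 * N))
    (h15 : σ.reg 15 = m) (htree : IsTreeOn N root fun i => lst (n + 2 * i))
    (hkids : ∀ i < N, (lst (n + 2 * i)).length ≤ 2)
    (hQ : ptr lst (n + 2 * N) + (n + 2 * N) + m + N ≤ Q) :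
    HT w Q bfsCmd (N * 150 + 60) σ fun σ' =>
      Same [6, 11, 12, 13, 14, 15] σ σ' ∧
        σ'.reg 6 = ptr lst (n + 2 * N) + (n + 2 * N) + m ∧
        MemIs σ' (withPows n N root lst m ++ bfs (fun i => lst (n + 2 * i)) root N) := by
  have hin : ∀ {σ' : Config} {l : List ℕ}, MemIs σ' (withPows n N root lst m ++ l) →
      HoldsInput n N root lst σ'.mem := fun h => by
    rw [withPows, List.append_assoc] at h
    exact h.holdsInput
  have hlen : (withPows n N root lst m).length = ptr lst (n + 2 * N) + (n + 2 * N) + m := by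
    simp [withPows, length_withPtrs]
  have hm' : MemIs σ (withPows n N root lst m ++ []) := by simpa using hm
  have hroot := htree.root_lt
  set kids : ℕ → List ℕ := fun i => lst (n + 2 * i) with hkd
  refine HT.le (hw.set_seq (ptr lst (n + 2 * N) + (n + 2 * N) + m) hσ
      (by simp [BinOp.eval, h5, h15]) (by omega)
    fun b1 => hw.put_seq (ptr lst (n + 2 * N) + (n + 2 * N) + m) root b1 (by simp)
      (by simp [(hin hm').root_eq]) (by omega)
    fun b2 => hw.set_seq 1 b2 rfl (by omega)
    fun b3 => hw.loop N (fun _ => 142) (fun k σ' => Same [6, 11, 12, 13, 14, 15] σ σ' ∧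
        σ'.reg 6 = ptr lst (n + 2 * N) + (n + 2 * N) + m ∧ σ'.reg 13 = (bfs kids root k).length ∧
        MemIs σ' (withPows n N root lst m ++ bfs kids root k))
      b3 (by simp [h3])
      ⟨((((Same.refl _ _).setReg (by decide) _).setMem _ _).setReg (by decide) _).setReg
        (by decide) _, by simp, by simp [bfs], by
          exact MemIs.append (σ := σ.setReg 6 _) hm hlen.symm root⟩
      (fun k σ' hk b x1 y1 ⟨is, i6, i13, im⟩ => by
        have hkl := (htree.bfs_inv hk.le).2.2.2.2 hk
        set i := (bfs kids root k).getD k 0 with hi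
        have hiN : i < N := by
          rw [hi, List.getD_eq_getElem _ _ hkl]
          exact (htree.bfs_inv hk.le).2.1 _ (List.getElem_mem hkl)
        have hmi : σ'.mem (ptr lst (n + 2 * N) + (n + 2 * N) + m + k) = i := by
          rw [im, List.getD_append_right _ _ _ _ (by omega), hlen, Nat.add_sub_cancel_left]
        have hlist := ptr_add_lt (show n + 2 * i < n + 2 * N by omega)
          (Nat.zero_le (lst (n + 2 * i)).length)
        have hki : (kids i).length ≤ 2 := hkids i hiN
        have hnext : (bfs kids root k).length + (kids i).length ≤ N := by
          have := htree.length_bfs_le (show k + 1 ≤ N by omega)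
          simpa only [bfs, List.length_append] using this
        have e1 := (hin im).ptr_eq (n + 2 * i) (by omega)
        have e2 := (hin im).len_eq (n + 2 * i) (by omega)
        refine HT.le (hw.set_seq (ptr lst (n + 2 * i)) b
            (by simp [BinOp.eval, kidsTm, i6, x1, hmi, is.eq h4, is.eq h2, e1]) (by omega)
          (fun b4 => hw.set_seq (kids i).length b4 (by simp [e2, hkd]) (by omega)
          fun b5 => hw.loop_seq (kids i).length (fun _ => 20) (fun c σ'' =>
              Same [12] ((σ'.setReg 14 (ptr lst (n + 2 * i))).setReg 15 (kids i).length) σ'' ∧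
              MemIs σ'' (withPows n N root lst m ++ (bfs kids root k ++ (kids i).take c)))
            b5 (by simp) ⟨(Same.refl _ _).setReg (by decide) _, by simpa [MemIs] using im⟩
            (fun c τ hc b x2 y2 ⟨js, jm⟩ => (hw.put
              (ptr lst (n + 2 * N) + (n + 2 * N) + m + ((bfs kids root k).length + c))
              ((kids i).getD c 0) b
              (by
                have e6 : τ.reg 6 = ptr lst (n + 2 * N) + (n + 2 * N) + m :=
                  js.eq (by simpa using i6)
                have e13 : τ.reg 13 = (bfs kids root k).length := js.eq (by simpa using i13)
                simp [BinOp.eval, e6, e13, x2])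
              (by
                have e14 : τ.reg 14 = ptr lst (n + 2 * i) := js.eq (by simp)
                have := (hin jm).entry_eq (n + 2 * i) (by omega) c hc
                simp only [entryTm, Tm.eval, BinOp.eval, e14, x2, this, hkd])
              (by
                have := htree.kids_lt i hiN ((kids i).getD c 0)
                  (by rw [List.getD_eq_getElem _ _ hc]; exact List.getElem_mem hc)
                omega)
              ⟨by simp [x2], by simp [y2], (js.setMem _ _).setReg (by decide) _, by
                have := jm.append (a := ptr lst (n + 2 * N) + (n + 2 * N) + m +
                  ((bfs kids root k).length + c))
                  (by simp only [List.length_append, hlen, List.length_take]; omega)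
                  ((kids i).getD c 0)
                rw [List.append_assoc, List.append_assoc, List.getD_eq_getElem _ _ hc,
                  ← List.take_succ_eq_append_getElem hc] at this
                rw [List.getD_eq_getElem _ _ hc]
                exact this⟩ (by simp) (by simp [entryTm]) (by simp) (by simp [entryTm])).le
                (by simp [entryTm]))
          fun τ b6 ⟨js, jm⟩ => hw.set ((bfs kids root k).length + (kids i).length) b6
            (by
              have e13 : τ.reg 13 = (bfs kids root k).length := js.eq (by simpa using i13)
              have e15 : τ.reg 15 = (kids i).length := js.eq (by simp)
              simp [BinOp.eval, e13, e15])
            (by omega)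
            ⟨by
              have e11 : τ.reg 11 = k := js.eq (by simpa using x1)
              simp [e11], by
              have e3 : τ.reg 3 = N := js.eq (by simpa using y1)
              simp [e3],
              ((((is.setReg (by decide) _).setReg (by decide) _).trans
                (js.mono (by decide))).setReg (by decide) _).setReg (by decide) _, by
              have e6 : τ.reg 6 = ptr lst (n + 2 * N) + (n + 2 * N) + m := js.eq (by simpa using i6)
              simp [e6], by
              rw [bfs, List.length_append, ← hi]
              simp, by
              rw [List.take_length] at jm
              rw [bfs, ← hi]
              exact jm⟩)
          (by decide) (by simp [kidsTm]) (by simp [kidsTm])) ?_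
        simp [kidsTm]; omega)
      (fun σ' _ ⟨is, i6, _, im⟩ => ⟨is, i6, im⟩)) ?_
  simp; omega

theorem pair_inj {u v u' v' : ℕ} (hv : v < n) (hv' : v' < n) (h : u * n + v = u' * n + v') :
    u = u' ∧ v = v' := by
  have hn : 0 < n := by omega
  have h1 : (u * n + v) / n = u := by
    rw [mul_comm, Nat.mul_add_div hn, Nat.div_eq_of_lt hv, add_zero]
  have h2 : (u' * n + v') / n = u' := by
    rw [mul_comm, Nat.mul_add_div hn, Nat.div_eq_of_lt hv', add_zero]
  have : u = u' := by rw [← h1, ← h2, h]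
  subst this
  exact ⟨rfl, by omega⟩

/-- Entering the edges takes time proportional to the total length of the adjacency lists, although
the matrix has `n * n` entries. -/
theorem ht_adjCmd (hw : Wide w Q) {m A : ℕ} {l : List ℕ} (hσ : Bdd Q numVars σ)
    (hm : MemIs σ (withPtrs n N root lst ++ l)) (hA : (withPtrs n N root lst ++ l).length = A)
    (h2 : σ.reg 2 = n) (h3 : σ.reg 3 = N) (h4 : σ.reg 4 = ptr lst (n + 2 * N))
    (h6 : σ.reg 6 = m) (hmA : m + N = A) (hlst : ∀ u < n, ∀ v ∈ lst u, v < n)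
    (hQ : A + n * n ≤ Q) :
    HT w Q adjCmd (∑ u ∈ Finset.range n, ((lst u).length * 40 + 40) + 60) σ fun σ' =>
      Same [7, 8, 11, 12, 14, 15] σ σ' ∧ σ'.reg 7 = A ∧ σ'.reg 8 = A + n * n ∧
        (∀ a < A, σ'.mem a = σ.mem a) ∧
        ∀ u < n, ∀ v < n, σ'.mem (A + (u * n + v)) ≠ 0 ↔ v ∈ lst u := by
  have hptr := length_withPtrs n N root lst
  have hle : ptr lst (n + 2 * N) + (n + 2 * N) ≤ A := by
    rw [← hA, List.length_append, hptr]; omega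
  have hin : ∀ {μ : ℕ → ℕ}, (∀ a < A, μ a = σ.mem a) → HoldsInput n N root lst μ := fun h =>
    holdsInput_of_withPtrs fun a ha => by
      rw [h a (by omega), hm a, List.getD_append _ _ _ _ ha]
  have hzero : ∀ a, A ≤ a → σ.mem a = 0 := fun a ha => by
    rw [hm a, List.getD_eq_default _ _ (by omega)]
  refine HT.le (hw.set_seq A hσ (by simp [BinOp.eval, h6, h3, hmA]) (by omega)
    fun b1 => hw.set_seq (A + n * n) b1 (by simp [BinOp.eval, h2]) hQ
    fun b2 => hw.loop n (fun u => (lst u).length * 40 + 32) (fun k σ' =>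
        Same [7, 8, 11, 12, 14, 15] σ σ' ∧ σ'.reg 7 = A ∧ σ'.reg 8 = A + n * n ∧
        (∀ a < A, σ'.mem a = σ.mem a) ∧
        ∀ u < n, ∀ v < n, σ'.mem (A + (u * n + v)) ≠ 0 ↔ u < k ∧ v ∈ lst u)
      b2 (by simp [h2]) ⟨(((Same.refl _ _).setReg (by decide) _).setReg (by decide) _).setReg
        (by decide) _, by simp, by simp, fun _ _ => rfl, fun u hu v hv => by
          simp [hzero (A + (u * n + v)) (by omega)]⟩
      (fun k σ' hk b x1 y1 ⟨is, i7, i8, im, ia⟩ => by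
        have e1 := (hin im).ptr_eq k (by omega)
        have e2 := (hin im).len_eq k (by omega)
        have hk1 := ptr_add_lt (show k < n + 2 * N by omega) (le_refl (lst k).length)
        refine HT.le (hw.set_seq (ptr lst k) b (by simp [BinOp.eval, is.eq h4, x1, e1]) (by omega)
          fun b3 => hw.set_seq (lst k).length b3 (by simp [e2]) (by omega)
          fun b4 => hw.loop (lst k).length (fun _ => 32) (fun c τ =>
              Same [12] ((σ'.setReg 14 (ptr lst k)).setReg 15 (lst k).length) τ ∧
              (∀ a < A, τ.mem a = σ.mem a) ∧
              ∀ u < n, ∀ v < n, τ.mem (A + (u * n + v)) ≠ 0 ↔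
                (u < k ∧ v ∈ lst u) ∨ (u = k ∧ v ∈ (lst k).take c))
            b4 (by simp) ⟨(Same.refl _ _).setReg (by decide) _, im, fun u hu v hv => by
              simpa using ia u hu v hv⟩
            (fun c τ hc b x2 y2 ⟨js, jm, ja⟩ => (hw.put (A + (k * n + (lst k).getD c 0)) 1 b
              (by
                have e7 : τ.reg 7 = A := js.eq (by simpa using i7)
                have e11 : τ.reg 11 = k := js.eq (by simpa using x1)
                have e2' : τ.reg 2 = n := js.eq (by simpa using y1)
                have e14 : τ.reg 14 = ptr lst k := js.eq (by simp)
                have := (hin jm).entry_eq k (by omega) c hc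
                simp only [entryTm, Tm.eval, BinOp.eval, e7, e11, e2', e14, x2, this])
              rfl (by have := hw.two_le; omega)
              ⟨by simp [x2], by simp [y2], (js.setMem _ _).setReg (by decide) _, fun a ha => by
                rw [Config.setReg_mem, Config.setMem_mem, if_neg (by omega), jm a ha],
                fun u hu v hv => by
                  have hvn : (lst k).getD c 0 < n := by
                    rw [List.getD_eq_getElem _ _ hc]
                    exact hlst k hk _ (List.getElem_mem hc)
                  rw [Config.setReg_mem, Config.setMem_mem, List.take_succ_eq_append_getElem hc,
                    List.mem_append, List.mem_singleton, ← List.getD_eq_getElem _ 0 hc]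
                  split_ifs with h
                  · obtain ⟨rfl, rfl⟩ := pair_inj hv hvn
                      (show u * n + v = k * n + (lst k).getD c 0 by omega)
                    simp
                  · rw [ja u hu v hv]
                    have : ¬ (u = k ∧ v = (lst k).getD c 0) := by
                      rintro ⟨rfl, rfl⟩; exact h rfl
                    tauto⟩ (by simp [entryTm]) (by simp) (by simp [entryTm]) (by simp)).le
                    (by simp [entryTm]))
            (fun τ _ ⟨js, jm, ja⟩ => ⟨js.eq (by simpa using x1), js.eq (by simpa using y1),
              ((((is.setReg (by decide) _).setReg (by decide) _).trans
                (js.mono (by decide))).setReg (by decide) _), by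
                  have e7 : τ.reg 7 = A := js.eq (by simpa using i7)
                  simp [e7], by
                  have e8 : τ.reg 8 = A + n * n := js.eq (by simpa using i8)
                  simp [e8], jm, fun u hu v hv => by
                  rw [Config.setReg_mem, ja u hu v hv, List.take_length]
                  constructor
                  · rintro (⟨h, h'⟩ | ⟨rfl, h'⟩)
                    · exact ⟨by omega, h'⟩
                    · exact ⟨by omega, h'⟩
                  · rintro ⟨h, h'⟩
                    rcases Nat.lt_succ_iff_lt_or_eq.1 h with h | rfl
                    · exact Or.inl ⟨h, h'⟩
                    · exact Or.inr ⟨rfl, h'⟩⟩)) ?_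
        simp; omega)
      (fun σ' _ ⟨is, i7, i8, im, ia⟩ => ⟨is, i7, i8, im, fun u hu v hv => by
        rw [ia u hu v hv]; simp [hu]⟩)) ?_
  simp only [Tm.time, add_assoc]
  simp; omega

end Phases

/-! ### Filling the table of the dynamic program -/

/-! The types of the node `i` with its first `c` subtrees are stored in the row whose index is the
address `ptr lst (n + 2 * i) + c` in the list of children of `i`. By `ptr_add_inj`, different pairs
have different rows. -/

/-- Row `p` of the table with rows of length `S` from address `A` on marks the types with `P`. -/
def Row (A S : ℕ) (μ : ℕ → ℕ) (p : ℕ) (P : ℕ → Prop) : Prop :=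
  ∀ s < S, μ (A + (p * S + s)) ≠ 0 ↔ P s

/-- The memories agree outside of row `p`. -/
def OffRow (A S p : ℕ) (μ μ' : ℕ → ℕ) : Prop :=
  ∀ a, a < A + p * S ∨ A + p * S + S ≤ a → μ' a = μ a

theorem Row.of_offRow {A S p p' : ℕ} {μ μ' : ℕ → ℕ} {P : ℕ → Prop} (h : Row A S μ p' P)
    (hμ : OffRow A S p μ μ') (hp : p' ≠ p) : Row A S μ' p' P := by
  intro s hs
  rw [hμ _ ?_, h s hs]
  rcases lt_or_gt_of_ne hp with hlt | hlt
  · have := Nat.mul_le_mul_right S (show p' + 1 ≤ p from hlt)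
    rw [Nat.succ_mul] at this
    omega
  · have := Nat.mul_le_mul_right S (show p + 1 ≤ p' from hlt)
    rw [Nat.succ_mul] at this
    omega

/-- The address of the current type in the row with the index `R[14] + R[12]`. -/
def cellTm : Tm := .add (.var 8) (.add (.mul (.add (.var 14) (.var 12)) (.var 1)) (.var 13))

/-- Marks the types with `φ` in the row with the index `R[14] + R[12]`. -/
def fillRow (φ : Fm) : Cmd :=
  forLoop 13 1 (iteFm φ (putTm cellTm (.const 1)) (putTm cellTm (.const 0)))

section FillRow

variable {w Q A S p : ℕ} {σ : Config}

/-- The formula `φ` may refer to the current type and to the memory outside of the row. -/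
theorem ht_fillRow (hw : Wide w Q) (hσ : Bdd Q numVars σ) {φ : Fm} (hφ : φ.WF numVars)
    (hwφ : Q ^ φ.deg < 2 ^ w) (h1 : σ.reg 1 = S) (h8 : σ.reg 8 = A)
    (hp : σ.reg 14 + σ.reg 12 = p) (P : ℕ → Prop)
    (hP : ∀ τ s, s < S → Same [13] σ τ → τ.reg 13 = s → OffRow A S p σ.mem τ.mem →
      (φ.Eval τ.mem τ.reg ↔ P s)) :
    HT w Q (fillRow φ) (S * (φ.time S + 40) + 5) σ fun σ' =>
      Same [13] σ σ' ∧ OffRow A S p σ.mem σ'.mem ∧ Row A S σ'.mem p P := by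
  have hput : ∀ k v τ, k < S → v ≤ 1 → Bdd Q numVars τ → τ.reg 13 = k → Same [13] σ τ →
      OffRow A S p σ.mem τ.mem → (∀ s < k, τ.mem (A + (p * S + s)) ≠ 0 ↔ P s) →
      (v ≠ 0 ↔ P k) →
      HT w Q (putTm cellTm (.const v)) 22 τ fun τ' => τ'.reg 13 = k ∧ τ'.reg 1 = S ∧
        Same [13] σ (τ'.setReg 13 (k + 1)) ∧ OffRow A S p σ.mem (τ'.setReg 13 (k + 1)).mem ∧
        ∀ s < k + 1, (τ'.setReg 13 (k + 1)).mem (A + (p * S + s)) ≠ 0 ↔ P s := by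
    intro k v τ hk hv b x1 is im ir hvP
    refine (hw.put (A + (p * S + k)) v b ?_ rfl (by have := hw.two_le; omega)
      ⟨x1, is.eq h1, (is.setMem _ _).setReg (by decide) _, fun a ha => ?_, fun s hs => ?_⟩
      (by simp [cellTm]) (by simp) (by simp [cellTm]) (by simp; omega)).le (by simp [cellTm])
    · have e14 := is 14 (by decide)
      have e12 := is 12 (by decide)
      simp [cellTm, BinOp.eval, is.eq h8, is.eq h1, x1, e14, e12, hp]
    · rw [Config.setReg_mem, Config.setMem_mem, if_neg (by omega), im a ha]
    · rw [Config.setReg_mem, Config.setMem_mem]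
      rcases Nat.lt_succ_iff_lt_or_eq.1 hs with h | rfl
      · rw [if_neg (by omega), ir s h]
      · rw [if_pos rfl, hvP]
  refine HT.le (hw.loop S (fun _ => φ.time S + 23)
    (fun k τ => Same [13] σ τ ∧ OffRow A S p σ.mem τ.mem ∧
      ∀ s < k, τ.mem (A + (p * S + s)) ≠ 0 ↔ P s) hσ h1
    ⟨(Same.refl _ _).setReg (by decide) _, fun _ _ => rfl, fun s hs => by omega⟩
    (fun k τ hk b x1 y1 ⟨is, im, ir⟩ => ?_) (fun τ _ h => h)) ?_
  · have hev := hP τ k hk is x1 im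
    have := HT.iteFm (T := 22) hw.two_le b hφ hwφ (by omega)
      (fun h => hput k 1 τ hk le_rfl b x1 is im ir (by simpa using hev.1 h))
      (fun h => hput k 0 τ hk (by omega) b x1 is im ir (by simpa using mt hev.2 h))
    rwa [y1] at this
  · rw [Finset.sum_const, Finset.card_range, smul_eq_mul]
    have : S * (φ.time S + 23 + 8) ≤ S * (φ.time S + 40) := Nat.mul_le_mul_left _ (by omega)
    omega

end FillRow

/-- The memory and the registers after the preparations. The table starts at address `A`. -/
structure Prepared (r n N root : ℕ) (lst : ℕ → List ℕ) (B A : ℕ) (σ : Config) : Prop where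
  ctx : Ctx r B σ.reg σ.mem
  verts : σ.reg 2 = n
  nodes : σ.reg 3 = N
  ptrs : σ.reg 4 = ptr lst (n + 2 * N)
  table : σ.reg 8 = A
  input : HoldsInput n N root lst σ.mem
  queue : ∀ k < N, σ.mem (σ.reg 6 + k) = (bfs (fun i => lst (n + 2 * i)) root N).getD k 0
  adj : ∀ u < n, ∀ v < n, σ.mem (σ.reg 7 + (u * n + v)) ≠ 0 ↔ v ∈ lst u
  le₁ : ptr lst (n + 2 * N) + (n + 2 * N) ≤ σ.reg 5
  le₂ : σ.reg 5 + 2 * B ^ r ≤ σ.reg 6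
  le₃ : σ.reg 6 + N ≤ σ.reg 7
  le₄ : σ.reg 7 + n * n ≤ A

/-- The temporary registers. -/
abbrev temps : List ℕ := [11, 12, 13, 14, 15, 16, 17, 18, 19]

theorem mul_add_lt_mul_self {n u v : ℕ} (hu : u < n) (hv : v < n) : u * n + v < n * n := by
  have := Nat.mul_le_mul_right n (show u + 1 ≤ n from hu)
  rw [Nat.succ_mul] at this
  omega

section Prepared

variable {r n N root B A : ℕ} {lst : ℕ → List ℕ} {σ σ' : Config}

/-- What has been prepared is kept in registers that are not temporary and in cells below the
table. -/
theorem Prepared.congr (h : Prepared r n N root lst B A σ) (hs : Same temps σ σ')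
    (hm : ∀ a < A, σ'.mem a = σ.mem a) : Prepared r n N root lst B A σ' := by
  have e := fun y (hy : y ∉ temps) => hs y hy
  have l1 := h.le₁
  have l2 := h.le₂
  have l3 := h.le₃
  have l4 := h.le₄
  have hp : ∀ q < n + 2 * N, ∀ c ≤ (lst q).length, ptr lst q + c < A := fun q hq c hc => by
    have := ptr_add_lt hq hc
    omega
  refine ⟨⟨?_, ?_, ?_, fun g hg => ?_⟩, ?_, ?_, ?_, ?_, ⟨?_, fun q hq => ?_, fun q hq => ?_,
    fun q hq c hc => ?_⟩, fun k hk => ?_, fun u hu v hv => ?_, ?_, ?_, ?_, ?_⟩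
  · rw [e 1 (by decide), h.ctx.types]
  · rw [e 9 (by decide), h.ctx.base]
  · rw [e 10 (by decide), h.ctx.pats]
  · rw [e 5 (by decide), hm _ (by omega), h.ctx.pow g hg]
  · rw [e 2 (by decide), h.verts]
  · rw [e 3 (by decide), h.nodes]
  · rw [e 4 (by decide), h.ptrs]
  · rw [e 8 (by decide), h.table]
  · have : 3 ≤ ptr lst (n + 2 * N) := by simp [ptr]
    rw [hm _ (by omega), h.input.root_eq]
  · rw [hm _ (by omega), h.input.ptr_eq q hq]
  · rw [hm _ (by have := hp q hq 0 (by omega); omega), h.input.len_eq q hq]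
  · rw [hm _ (by have := hp q hq (1 + c) (by omega); omega), h.input.entry_eq q hq c hc]
  · rw [e 6 (by decide), hm _ (by omega), h.queue k hk]
  · have := mul_add_lt_mul_self hu hv
    rw [e 7 (by decide), hm _ (by omega), h.adj u hu v hv]
  · rwa [e 5 (by decide)]
  · rwa [e 5 (by decide), e 6 (by decide)]
  · rwa [e 6 (by decide), e 7 (by decide)]
  · rwa [e 7 (by decide)]

end Prepared

/-- `R i c` satisfies the recursion of the dynamic program for the types of node `i` with its first
`c` subtrees. -/
structure IsRecursive {r : ℕ} (H : SimpleGraph (Fin r)) (B n N : ℕ) (lst : ℕ → List ℕ)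
    (R : ℕ → ℕ → ℕ → Prop) : Prop where
  base : ∀ i < N, ∀ adj : ℕ → ℕ → Prop,
    (∀ p < (lst (n + (2 * i + 1))).length, ∀ q < (lst (n + (2 * i + 1))).length,
      (adj p q ↔ (lst (n + (2 * i + 1))).getD q 0 ∈ lst ((lst (n + (2 * i + 1))).getD p 0))) →
    ∀ s < 2 ^ (2 * B ^ r), (R i 0 s ↔ BaseP H B (lst (n + (2 * i + 1))).length adj s)
  step : ∀ i < N, ∀ c < (lst (n + 2 * i)).length, ∀ j, j = (lst (n + 2 * i)).getD c 0 →
    ∀ eqv : ℕ → ℕ → Prop,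
    (∀ p < (lst (n + (2 * i + 1))).length, ∀ q < (lst (n + (2 * j + 1))).length,
      (eqv p q ↔ (lst (n + (2 * i + 1))).getD p 0 = (lst (n + (2 * j + 1))).getD q 0)) →
    ∀ s < 2 ^ (2 * B ^ r), (R i (c + 1) s ↔ ∃ s₁ < 2 ^ (2 * B ^ r), ∃ s₂ < 2 ^ (2 * B ^ r),
      R i c s₁ ∧ R j (lst (n + 2 * j)).length s₂ ∧
      GlueP H B (lst (n + (2 * i + 1))).length (lst (n + (2 * j + 1))).length eqv s₁ s₂ s)

/-- Fills row number `R[12]` of the current node: from the bag if `R[12] = 0`, and otherwise from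
the previous row and the last row of child number `R[12] - 1`. -/
noncomputable def rowCmd {r : ℕ} (H : SimpleGraph (Fin r)) : Cmd :=
  iteFm (.nz (.var 12))
    (.seq (setTm 18 (.sub (.add (.var 14) (.var 12)) (.const 1))) <|
      .seq (setTm 17 (.load (.add (.var 14) (.var 12)))) <|
      .seq (setTm 19 (kidsTm (.var 17))) <| .seq (setTm 19 (.add (.var 19) (.load (.var 19)))) <|
      .seq (setTm 17 (bagTm (.var 17))) (fillRow (joinFm H)))
    (fillRow (baseFm H))

/-- Fills the table, from the last node of the breadth-first order to the first one. -/
noncomputable def dpCmd {r : ℕ} (H : SimpleGraph (Fin r)) : Cmd :=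
  forLoop 11 3 <|
    .seq (setTm 16 (.load (.add (.var 6) (.sub (.sub (.var 3) (.const 1)) (.var 11))))) <|
    .seq (setTm 14 (kidsTm (.var 16))) <| .seq (setTm 16 (bagTm (.var 16))) <|
    .seq (setTm 15 (.add (.load (.var 14)) (.const 1))) <| forLoop 12 15 (rowCmd H)

section Dp

variable {w Q r n N root B A : ℕ} {lst : ℕ → List ℕ} {σ : Config} {H : SimpleGraph (Fin r)}
  {R : ℕ → ℕ → ℕ → Prop}

theorem ht_baseRow (hw : Wide w Q) (hr : 0 < r) (hwb : Q ^ (baseFm H).deg < 2 ^ w)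
    (hσ : Bdd Q numVars σ) (hp : Prepared r n N root lst B A σ)
    (hbag : ∀ i < N, ∀ v ∈ lst (n + (2 * i + 1)), v < n)
    (hB : ∀ i < N, (lst (n + (2 * i + 1))).length + 2 ≤ B) (hR : IsRecursive H B n N lst R)
    {i : ℕ} (hi : i < N) (h14 : σ.reg 14 = ptr lst (n + 2 * i))
    (h16 : σ.reg 16 = ptr lst (n + (2 * i + 1))) (h12 : σ.reg 12 = 0) :
    HT w Q (fillRow (baseFm H))
      (2 ^ (2 * B ^ r) * ((baseFm H).time (2 ^ (2 * B ^ r)) + 40) + 5) σ fun σ' =>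
      Same [13] σ σ' ∧ OffRow A (2 ^ (2 * B ^ r)) (ptr lst (n + 2 * i)) σ.mem σ'.mem ∧
        Row A (2 ^ (2 * B ^ r)) σ'.mem (ptr lst (n + 2 * i)) (R i 0) := by
  refine ht_fillRow hw hσ (baseFm_wf H) hwb hp.ctx.types hp.table (by rw [h14, h12, add_zero]) _
    fun τ s hs is x1 im => ?_
  have hpτ := hp.congr (is.mono (by decide)) fun a ha => im a (by omega)
  have e16 : τ.reg 16 = ptr lst (n + (2 * i + 1)) := is.eq h16
  have hlen := hpτ.input.len_eq (n + (2 * i + 1)) (by omega)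
  have hent := hpτ.input.entry_eq (n + (2 * i + 1)) (by omega)
  rw [eval_baseFm H hr hpτ.ctx (by rw [e16, hlen]; exact hB i hi), e16, hlen, x1]
  refine (hR.base i hi _ (fun p hp q hq => ?_) s hs).symm
  have hv : ∀ p < (lst (n + (2 * i + 1))).length, (lst (n + (2 * i + 1))).getD p 0 < n :=
    fun p hp => hbag i hi _ (by rw [List.getD_eq_getElem _ _ hp]; exact List.getElem_mem hp)
  rw [hent p hp, hent q hq, hpτ.verts]
  exact hpτ.adj _ (hv p hp) _ (hv q hq)

theorem ht_joinRow (hw : Wide w Q) (hr : 0 < r) (hwj : Q ^ (joinFm H).deg < 2 ^ w)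
    (hσ : Bdd Q numVars σ) (hp : Prepared r n N root lst B A σ)
    (hB : ∀ i < N, (lst (n + (2 * i + 1))).length + 2 ≤ B) (hR : IsRecursive H B n N lst R)
    {i j c : ℕ} (hi : i < N) (hj : j < N) (hc : c < (lst (n + 2 * i)).length)
    (hij : j = (lst (n + 2 * i)).getD c 0) (hne : i ≠ j)
    (h14 : σ.reg 14 = ptr lst (n + 2 * i)) (h16 : σ.reg 16 = ptr lst (n + (2 * i + 1)))
    (h12 : σ.reg 12 = c + 1) (h17 : σ.reg 17 = ptr lst (n + (2 * j + 1)))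
    (h18 : σ.reg 18 = ptr lst (n + 2 * i) + c)
    (h19 : σ.reg 19 = ptr lst (n + 2 * j) + (lst (n + 2 * j)).length)
    (hRi : Row A (2 ^ (2 * B ^ r)) σ.mem (ptr lst (n + 2 * i) + c) (R i c))
    (hRj : Row A (2 ^ (2 * B ^ r)) σ.mem (ptr lst (n + 2 * j) + (lst (n + 2 * j)).length)
      (R j (lst (n + 2 * j)).length)) :
    HT w Q (fillRow (joinFm H))
      (2 ^ (2 * B ^ r) * ((joinFm H).time (2 ^ (2 * B ^ r)) + 40) + 5) σ fun σ' =>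
      Same [13] σ σ' ∧ OffRow A (2 ^ (2 * B ^ r)) (ptr lst (n + 2 * i) + (c + 1)) σ.mem σ'.mem ∧
        Row A (2 ^ (2 * B ^ r)) σ'.mem (ptr lst (n + 2 * i) + (c + 1)) (R i (c + 1)) := by
  refine ht_fillRow hw hσ (joinFm_wf H) hwj hp.ctx.types hp.table (by rw [h14, h12]) _
    fun τ s hs is x1 im => ?_
  have hpτ := hp.congr (is.mono (by decide)) fun a ha => im a (by omega)
  have e16 : τ.reg 16 = ptr lst (n + (2 * i + 1)) := is.eq h16
  have e17 : τ.reg 17 = ptr lst (n + (2 * j + 1)) := is.eq h17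
  have e18 : τ.reg 18 = ptr lst (n + 2 * i) + c := is.eq h18
  have e19 : τ.reg 19 = ptr lst (n + 2 * j) + (lst (n + 2 * j)).length := is.eq h19
  have hlen := hpτ.input.len_eq (n + (2 * i + 1)) (by omega)
  have hlen' := hpτ.input.len_eq (n + (2 * j + 1)) (by omega)
  have hent := hpτ.input.entry_eq (n + (2 * i + 1)) (by omega)
  have hent' := hpτ.input.entry_eq (n + (2 * j + 1)) (by omega)
  have hRi' := hRi.of_offRow im (by omega)
  have hRj' := hRj.of_offRow im fun e => hne (by
    have := (ptr_add_inj le_rfl hc e).1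
    omega)
  rw [eval_joinFm H hr hpτ.ctx (by rw [e16, hlen]; exact hB i hi)
    (by rw [e17, hlen']; exact hB j hj), e16, e17, e18, e19, hlen, hlen', x1, hpτ.ctx.types,
    hpτ.table, hR.step i hi c hc j hij (fun p q => τ.mem (ptr lst (n + (2 * i + 1)) + 1 + p) =
      τ.mem (ptr lst (n + (2 * j + 1)) + 1 + q))
      (fun p hp q hq => by rw [hent p hp, hent' q hq]) s hs]
  refine exists_congr fun s₁ => and_congr_right fun h₁ => exists_congr fun s₂ =>
    and_congr_right fun h₂ => ?_
  rw [hRi' s₁ h₁, hRj' s₂ h₂]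

theorem ht_rowCmd (hw : Wide w Q) (hr : 0 < r) (hwb : Q ^ (baseFm H).deg < 2 ^ w)
    (hwj : Q ^ (joinFm H).deg < 2 ^ w)
    (hσ : Bdd Q numVars σ) (hp : Prepared r n N root lst B A σ)
    (hbag : ∀ i < N, ∀ v ∈ lst (n + (2 * i + 1)), v < n)
    (hB : ∀ i < N, (lst (n + (2 * i + 1))).length + 2 ≤ B) (hR : IsRecursive H B n N lst R)
    (hQ : ptr lst (n + 2 * N) ≤ Q)
    {i c : ℕ} (hi : i < N) (hc : c ≤ (lst (n + 2 * i)).length)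
    (hkid : ∀ j ∈ lst (n + 2 * i), j < N ∧ i ≠ j)
    (h14 : σ.reg 14 = ptr lst (n + 2 * i)) (h16 : σ.reg 16 = ptr lst (n + (2 * i + 1)))
    (h12 : σ.reg 12 = c)
    (hRi : ∀ c' < c, Row A (2 ^ (2 * B ^ r)) σ.mem (ptr lst (n + 2 * i) + c') (R i c'))
    (hRj : ∀ j ∈ lst (n + 2 * i), Row A (2 ^ (2 * B ^ r)) σ.mem
      (ptr lst (n + 2 * j) + (lst (n + 2 * j)).length) (R j (lst (n + 2 * j)).length)) :
    HT w Q (rowCmd H) (2 ^ (2 * B ^ r) * ((baseFm H).time (2 ^ (2 * B ^ r)) +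
      (joinFm H).time (2 ^ (2 * B ^ r)) + 40) + 100) σ fun σ' =>
      Same [13, 17, 18, 19] σ σ' ∧
        OffRow A (2 ^ (2 * B ^ r)) (ptr lst (n + 2 * i) + c) σ.mem σ'.mem ∧
        Row A (2 ^ (2 * B ^ r)) σ'.mem (ptr lst (n + 2 * i) + c) (R i c) := by
  have hS : 1 ≤ σ.reg 1 := by rw [hp.ctx.types]; exact Nat.one_le_two_pow
  refine HT.le (HT.iteFm (T := 2 ^ (2 * B ^ r) * ((baseFm H).time (2 ^ (2 * B ^ r)) +
      (joinFm H).time (2 ^ (2 * B ^ r)) + 40) + 80) hw.two_le hσ (by simp)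
      (hw.pow_lt _ (by simp)) hS (fun h => ?_) fun h => ?_) (by simp; omega)
  · obtain ⟨c, rfl⟩ : ∃ d, c = d + 1 := Nat.exists_eq_succ_of_ne_zero (by simpa [h12] using h)
    have hmem : (lst (n + 2 * i)).getD c 0 ∈ lst (n + 2 * i) := by
      rw [List.getD_eq_getElem _ _ hc]; exact List.getElem_mem hc
    obtain ⟨hj, hne⟩ := hkid _ hmem
    have hRj' := hRj _ hmem
    set j := (lst (n + 2 * i)).getD c 0 with hjd
    have hptr : ∀ q < n + 2 * N, ∀ e ≤ (lst q).length, ptr lst q + e ≤ Q := fun q hq e he => by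
      have := ptr_add_lt hq he
      omega
    have e1 := hp.input.ptr_eq (n + 2 * j) (by omega)
    have e2 := hp.input.len_eq (n + 2 * j) (by omega)
    have e3 := hp.input.ptr_eq (n + (2 * j + 1)) (by omega)
    have e4 : σ.mem (ptr lst (n + 2 * i) + (c + 1)) = j := by
      rw [add_comm c 1, ← add_assoc, hp.input.entry_eq (n + 2 * i) (by omega) c hc]
    refine HT.le (hw.set_seq (ptr lst (n + 2 * i) + c) hσ (by simp [BinOp.eval, h14, h12])
      (hptr _ (by omega) _ (by omega))
      fun b1 => hw.set_seq j b1 (by simp [BinOp.eval, h14, h12, e4]) (by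
        have := hp.nodes ▸ hσ.1 3 (by decide) (by decide)
        omega)
      fun b2 => hw.set_seq (ptr lst (n + 2 * j)) b2
        (by simp [BinOp.eval, kidsTm, hp.ptrs, hp.verts, e1]) (hptr _ (by omega) 0 (by omega))
        (fun b3 => hw.set_seq (ptr lst (n + 2 * j) + (lst (n + 2 * j)).length) b3
          (by simp [BinOp.eval, e2]) (hptr _ (by omega) _ le_rfl)
        fun b4 => hw.set_seq (ptr lst (n + (2 * j + 1))) b4
          (by simp [BinOp.eval, bagTm, hp.ptrs, hp.verts, e3]) (hptr _ (by omega) 0 (by omega))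
        (fun b5 => HT.mono (ht_joinRow (i := i) (j := j) (c := c) hw hr hwj b5
            (hp.congr (((((((Same.refl _ _).setReg (by decide) _).setReg (by decide) _).setReg
              (by decide) _).setReg (by decide) _).setReg (by decide) _)) fun _ _ => rfl)
            hB hR hi hj hc hjd hne (by simp [h14]) (by simp [h16]) (by simp [h12])
            (by simp) (by simp) (by simp) (hRi c (by omega)) hRj') le_rfl
          fun σ' _ ⟨is, im, ir⟩ => ⟨Same.trans (((((((Same.refl _ _).setReg (by decide) _).setReg
            (by decide) _).setReg (by decide) _).setReg (by decide) _).setReg (by decide) _))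
              (is.mono (by decide)), im, ir⟩)
        (by decide) (by simp [bagTm]) (by simp [bagTm]))
        (by decide) (by simp [kidsTm]) (by simp [kidsTm])) ?_
    have : 2 ^ (2 * B ^ r) * ((joinFm H).time (2 ^ (2 * B ^ r)) + 40) ≤
        2 ^ (2 * B ^ r) * ((baseFm H).time (2 ^ (2 * B ^ r)) +
          (joinFm H).time (2 ^ (2 * B ^ r)) + 40) := Nat.mul_le_mul_left _ (by omega)
    simp only [Tm.time, kidsTm, bagTm]
    omega
  · obtain rfl : c = 0 := by simpa [h12] using h
    refine HT.mono (ht_baseRow hw hr hwb hσ hp hbag hB hR hi h14 h16 h12) ?_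
      fun σ' _ ⟨is, im, ir⟩ => ⟨is.mono (by decide), im, ir⟩
    have : 2 ^ (2 * B ^ r) * ((baseFm H).time (2 ^ (2 * B ^ r)) + 40) ≤
        2 ^ (2 * B ^ r) * ((baseFm H).time (2 ^ (2 * B ^ r)) +
          (joinFm H).time (2 ^ (2 * B ^ r)) + 40) := Nat.mul_le_mul_left _ (by omega)
    omega

theorem ht_dpCmd (hw : Wide w Q) (hr : 0 < r) (hwb : Q ^ (baseFm H).deg < 2 ^ w)
    (hwj : Q ^ (joinFm H).deg < 2 ^ w)
    (hσ : Bdd Q numVars σ) (hp : Prepared r n N root lst B A σ)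
    (htree : IsTreeOn N root fun i => lst (n + 2 * i))
    (hkids : ∀ i < N, (lst (n + 2 * i)).length ≤ 2)
    (hbag : ∀ i < N, ∀ v ∈ lst (n + (2 * i + 1)), v < n)
    (hB : ∀ i < N, (lst (n + (2 * i + 1))).length + 2 ≤ B) (hR : IsRecursive H B n N lst R)
    (hQ : ptr lst (n + 2 * N) ≤ Q) {C : ℕ}
    (hC : 2 ^ (2 * B ^ r) * ((baseFm H).time (2 ^ (2 * B ^ r)) +
      (joinFm H).time (2 ^ (2 * B ^ r)) + 40) + 100 ≤ C) :
    HT w Q (dpCmd H) (N * (3 * (C + 8) + 100) + 5) σ fun σ' =>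
      Prepared r n N root lst B A σ' ∧ Row A (2 ^ (2 * B ^ r)) σ'.mem
        (ptr lst (n + 2 * root) + (lst (n + 2 * root)).length)
        (R root (lst (n + 2 * root)).length) := by
  have hq := htree.bfs_lt
  have hinj : ∀ k < N, ∀ k' < N, (bfs (fun i => lst (n + 2 * i)) root N).getD k 0 =
      (bfs (fun i => lst (n + 2 * i)) root N).getD k' 0 → k = k' := by
    intro k hk k' hk' h
    rw [← htree.length_bfs] at hk hk'
    rw [List.getD_eq_getElem _ _ hk, List.getD_eq_getElem _ _ hk'] at h
    exact ((htree.bfs_inv le_rfl).1.getElem_inj_iff).1 h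
  have hkid := fun k j (hk : k < N) => htree.exists_bfs_kid (k := k) (j := j) hk
  obtain ⟨k0, hk0, hroot⟩ := htree.mem_bfs htree.root_lt
  set q : ℕ → ℕ := fun k => (bfs (fun i => lst (n + 2 * i)) root N).getD k 0 with hqd
  have hptr : ∀ p < n + 2 * N, ∀ e ≤ (lst p).length, ptr lst p + e ≤ Q := fun p hp e he => by
    have := ptr_add_lt hp he
    omega
  refine HT.le (hw.loop N (fun _ => 3 * (C + 8) + 90) (fun k σ' =>
      Prepared r n N root lst B A σ' ∧ ∀ k' < N, N ≤ k' + k → ∀ c ≤ (lst (n + 2 * q k')).length,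
        Row A (2 ^ (2 * B ^ r)) σ'.mem (ptr lst (n + 2 * q k') + c) (R (q k') c))
    hσ hp.nodes ⟨hp.congr ((Same.refl _ _).setReg (by decide) _) fun _ _ => rfl,
      fun k' _ _ => by omega⟩
    (fun k σ' hk b x1 y1 ⟨ip, ir⟩ => ?_)
    -- After the last round the rows of all nodes are filled, in particular that of the root.
    (fun σ' _ ⟨ip, ir⟩ => ⟨ip, by
      have := ir k0 hk0 (by omega)
      simp only [hqd, hroot] at this
      exact this _ le_rfl⟩)) ?_
  · set k1 := N - 1 - k with hk1
    have hi := hq k1 (by omega)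
    have hki := hkids _ hi
    have hmem := ip.queue k1 (by omega)
    set i := (bfs (fun i => lst (n + 2 * i)) root N).getD k1 0 with hid
    have e1 := ip.input.ptr_eq (n + 2 * i) (by omega)
    have e2 := ip.input.len_eq (n + 2 * i) (by omega)
    have e3 := ip.input.ptr_eq (n + (2 * i + 1)) (by omega)
    have hlen := hptr (n + 2 * i) (by omega) _ le_rfl
    have h3 : 3 ≤ ptr lst (n + 2 * i) := by simp [ptr]
    refine HT.le (hw.set_seq i b (by simp [BinOp.eval, x1, ip.nodes, ← hk1, hmem]) (by
          have := ip.nodes ▸ b.1 3 (by decide) (by decide)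
          omega)
      fun b1 => hw.set_seq (ptr lst (n + 2 * i)) b1
        (by simp [BinOp.eval, kidsTm, ip.ptrs, ip.verts, e1]) (by omega)
      (fun b2 => hw.set_seq (ptr lst (n + (2 * i + 1))) b2
        (by simp [BinOp.eval, bagTm, ip.ptrs, ip.verts, e3]) (hptr _ (by omega) 0 (by omega))
      (fun b3 => hw.set_seq ((lst (n + 2 * i)).length + 1) b3
        (by simp [BinOp.eval, e2]) (by omega)
      fun b4 => hw.loop ((lst (n + 2 * i)).length + 1) (fun _ => C) (fun c τ =>
          Prepared r n N root lst B A τ ∧ τ.reg 11 = k ∧ τ.reg 14 = ptr lst (n + 2 * i) ∧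
          τ.reg 16 = ptr lst (n + (2 * i + 1)) ∧
          (∀ k' < N, N ≤ k' + k → ∀ c ≤ (lst (n + 2 * q k')).length,
            Row A (2 ^ (2 * B ^ r)) τ.mem (ptr lst (n + 2 * q k') + c) (R (q k') c)) ∧
          ∀ c' < c, Row A (2 ^ (2 * B ^ r)) τ.mem (ptr lst (n + 2 * i) + c') (R i c'))
        b4 (by simp)
        ⟨ip.congr (((((((Same.refl _ _).setReg (by decide) _).setReg (by decide) _).setReg
          (by decide) _).setReg (by decide) _).setReg (by decide) _)) fun _ _ => rfl,
          by simp [x1], by simp, by simp, ir, fun c' _ => by omega⟩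
        (fun c τ hc b x2 y2 ⟨jp, j11, j14, j16, jr, jc⟩ => HT.mono (ht_rowCmd hw hr hwb hwj b jp
            hbag hB hR hQ hi (by omega) (fun j hj => by
              obtain ⟨k', h1, h2, h3⟩ := hkid k1 j (by omega) hj
              refine ⟨htree.kids_lt i hi j hj, fun e => ?_⟩
              have := hinj k1 (by omega) k' h2 (by rw [← hid, h3, e])
              omega) j14 j16 x2 jc fun j hj => by
              obtain ⟨k', h1, h2, h3⟩ := hkid k1 j (by omega) hj
              have := jr k' h2 (by omega) _ le_rfl
              simp only [hqd, h3] at this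
              exact this) hC
          fun τ' _ ⟨is, im, irow⟩ => ⟨is.eq x2, is.eq y2,
            jp.congr ((is.mono (by decide)).setReg (by decide) _) fun a ha => im a (by omega),
            by simpa using is.eq j11, by simpa using is.eq j14, by simpa using is.eq j16,
            fun k' hk' hle c' hc' => (jr k' hk' hle c' hc').of_offRow im fun e => by
              have h1 := (ptr_add_inj hc' (by omega) e).1
              have := hinj k' hk' k1 (by omega) (show q k' = i by omega)
              omega,
            fun c' hc' => by
              rcases Nat.lt_succ_iff_lt_or_eq.1 hc' with h | rfl
              · exact (jc c' h).of_offRow im (by omega)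
              · exact irow⟩)
        (fun τ _ ⟨jp, j11, j14, j16, jr, jc⟩ => ⟨j11, jp.nodes,
          jp.congr ((Same.refl _ _).setReg (by decide) _) fun _ _ => rfl,
          fun k' hk' hle c hc => by
            rcases Nat.lt_or_ge k' (N - k) with h | h
            · obtain rfl : k' = k1 := by omega
              exact jc c (Nat.lt_succ_of_le hc)
            · exact jr k' hk' (by omega) c hc⟩))
      (by decide) (by simp [bagTm]) (by simp [bagTm]))
      (by decide) (by simp [kidsTm]) (by simp [kidsTm])) ?_
    have : ((lst (n + 2 * i)).length + 1) * (C + 8) ≤ 3 * (C + 8) :=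
      Nat.mul_le_mul_right _ (by omega)
    simp only [Tm.time, kidsTm, bagTm, Finset.sum_const, Finset.card_range, smul_eq_mul]
    omega
  · rw [Finset.sum_const, Finset.card_range, smul_eq_mul]
    have : N * (3 * (C + 8) + 90 + 8) ≤ N * (3 * (C + 8) + 100) := Nat.mul_le_mul_left _ (by omega)
    omega

end Dp

/-! ### The program -/

/-- Decides whether the last row of the root contains a type with `FinalP`; the answer is left in
register `1`. -/
def answerCmd (r : ℕ) : Cmd :=
  .seq (setTm 14 (kidsTm (.load (.const 2)))) <|
  .seq (setTm 18 (.add (.var 14) (.load (.var 14)))) <|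
  iteFm (finalFm r) (setTm 1 (.const 1)) (setTm 1 (.const 0))

/-- The program up to the output. -/
noncomputable def mainCmd {r : ℕ} (H : SimpleGraph (Fin r)) : Cmd :=
  .seq ptrCmd <| .seq (powCmd r) <| .seq bfsCmd <| .seq adjCmd <| .seq (dpCmd H) (answerCmd r)

/-- Copies register `1` into the output register. -/
def outputCmd : Cmd := .seq (.const 0 0) (.arith .add 0 1 0)

theorem HT.outputs {w Q T out : ℕ} {P : Cmd} {input : List ℕ} (hQ : Q < 2 ^ w)
    (h : HT w Q P T (Config.init input) fun σ => σ.reg 1 = out) :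
    Cmd.Outputs (.seq P outputCmd) w input (T + 2) out := by
  obtain ⟨σ', h1, h2, h3⟩ := h
  obtain ⟨k, s, hk, e, hs⟩ := h3 _ ⟨rfl, fun _ _ _ => rfl⟩
  have hs1 : s.reg 1 = out := by rw [hs.2 1 (by decide) (by decide), h1]
  have hout : out ≤ Q := h1 ▸ h2.1 1 (by decide) (by decide)
  refine ⟨_, _, ?_, Exec.seq e (Exec.seq (Exec.const s 0 0 (by positivity))
    (Exec.arith _ .add 0 1 0 ?_)), ?_⟩
  · omega
  · simp [BinOp.eval, hs1]; omega
  · simp [BinOp.eval, hs1]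

section Main

variable {w Q r n N root B A : ℕ} {lst : ℕ → List ℕ} {σ : Config} {H : SimpleGraph (Fin r)}
  {R : ℕ → ℕ → ℕ → Prop}

theorem mem_inputOf_le (hroot : root < N) (hlst : ∀ q < n + 2 * N, ∀ v ∈ lst q, v < n + N) {x : ℕ}
    (hx : x ∈ inputOf n N root lst) : x ≤ ptr lst (n + 2 * N) + (n + 2 * N) := by
  rw [inputOf, List.mem_append, List.mem_flatMap] at hx
  rcases hx with hx | ⟨q, hq, hx⟩
  · simp at hx; omega
  · rw [List.mem_range] at hq
    rcases List.mem_cons.1 hx with rfl | hx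
    · have := ptr_add_lt hq (le_refl (lst q).length)
      omega
    · have := hlst q hq x hx
      omega

theorem bdd_init (hroot : root < N) (hlst : ∀ q < n + 2 * N, ∀ v ∈ lst q, v < n + N)
    (hQ : ptr lst (n + 2 * N) + (n + 2 * N) ≤ Q) :
    Bdd Q numVars (Config.init (inputOf n N root lst)) := by
  refine ⟨fun x _ _ => Nat.zero_le _, fun a => ?_⟩
  change (inputOf n N root lst).getD a 0 ≤ Q
  rcases lt_or_ge a (inputOf n N root lst).length with h | h
  · rw [List.getD_eq_getElem _ _ h]
    exact (mem_inputOf_le hroot hlst (List.getElem_mem h)).trans hQ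
  · rw [List.getD_eq_default _ _ h]; exact Nat.zero_le _

theorem ht_answerCmd (hw : Wide w Q) (hr : 0 < r) (hwf : Q ^ (finalFm r).deg < 2 ^ w)
    (hσ : Bdd Q numVars σ) (hp : Prepared r n N root lst B A σ) (hroot : root < N)
    (hQ : ptr lst (n + 2 * N) ≤ Q) {P : ℕ → Prop} {out : ℕ}
    (hrow : Row A (2 ^ (2 * B ^ r)) σ.mem (ptr lst (n + 2 * root) + (lst (n + 2 * root)).length) P)
    (h1 : (∃ s < 2 ^ (2 * B ^ r), P s ∧ FinalP r B s) → out = 1)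
    (h0 : (¬ ∃ s < 2 ^ (2 * B ^ r), P s ∧ FinalP r B s) → out = 0) :
    HT w Q (answerCmd r) ((finalFm r).time (2 ^ (2 * B ^ r)) + 40) σ fun σ' => σ'.reg 1 = out := by
  have e1 := hp.input.ptr_eq (n + 2 * root) (by omega)
  have e2 := hp.input.len_eq (n + 2 * root) (by omega)
  have hlt := ptr_add_lt (show n + 2 * root < n + 2 * N by omega)
    (le_refl (lst (n + 2 * root)).length)
  have hQ2 := hw.two_le
  have hS : 1 ≤ σ.reg 1 := by rw [hp.ctx.types]; exact Nat.one_le_two_pow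
  refine HT.le (T := (kidsTm (.load (.const 2))).time + 2 + ((Tm.add (.var 14)
      (.load (.var 14))).time + 2 + ((finalFm r).time (2 ^ (2 * B ^ r)) + 4)))
    (hw.set_seq (ptr lst (n + 2 * root)) hσ
      (by simp [BinOp.eval, kidsTm, hp.ptrs, hp.verts, hp.input.root_eq, e1]) (by omega)
    (fun b1 => hw.set_seq (ptr lst (n + 2 * root) + (lst (n + 2 * root)).length) b1
      (by simp [BinOp.eval, e2]) (by omega)
    fun b2 => ?_) (by decide) (by simp [kidsTm]) (by simp [kidsTm]))
    (by simp [kidsTm]; omega)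
  set τ := (σ.setReg 14 (ptr lst (n + 2 * root))).setReg 18
    (ptr lst (n + 2 * root) + (lst (n + 2 * root)).length) with hτ
  have hpτ : Prepared r n N root lst B A τ :=
    hp.congr (((Same.refl _ _).setReg (by decide) _).setReg (by decide) _) fun _ _ => rfl
  have e18 : τ.reg 18 = ptr lst (n + 2 * root) + (lst (n + 2 * root)).length := by simp [hτ]
  have hev : (finalFm r).Eval τ.mem τ.reg ↔ ∃ s < 2 ^ (2 * B ^ r), P s ∧ FinalP r B s := by
    rw [eval_finalFm hr hpτ.ctx, e18, hpτ.ctx.types, hpτ.table]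
    exact exists_congr fun s => and_congr_right fun hs => by rw [← hrow s hs]; rfl
  have := HT.iteFm (T := 3) (P := setTm 1 (.const 1)) (R := setTm 1 (.const 0))
    (Post := fun σ' => σ'.reg 1 = out) hQ2 b2 (finalFm_wf r) hwf
    (by rw [hpτ.ctx.types]; exact Nat.one_le_two_pow)
    (fun h => hw.set 1 b2 rfl (by omega) (by simp [h1 (hev.1 h)]))
    (fun h => hw.set 0 b2 rfl (by omega) (by simp [h0 (mt hev.2 h)]))
  rw [hpτ.ctx.types] at this
  exact this.le (by omega)

theorem ht_mainCmd (hw : Wide w Q) (hr : 0 < r) (hwp : Q ^ (powTm r).deg < 2 ^ w)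
    (hwb : Q ^ (baseFm H).deg < 2 ^ w) (hwj : Q ^ (joinFm H).deg < 2 ^ w)
    (hwf : Q ^ (finalFm r).deg < 2 ^ w)
    (htree : IsTreeOn N root fun i => lst (n + 2 * i))
    (hkids : ∀ i < N, (lst (n + 2 * i)).length ≤ 2)
    (hbag : ∀ i < N, ∀ v ∈ lst (n + (2 * i + 1)), v < n) (hnbr : ∀ u < n, ∀ v ∈ lst u, v < n)
    (hB : B = baseOf n lst N) (hR : IsRecursive H B n N lst R)
    (hQ : ptr lst (n + 2 * N) + (n + 2 * N) + 2 * B ^ r + N + n * n ≤ Q)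
    (hS : 2 ^ (2 * B ^ r) ≤ Q) {C out : ℕ}
    (hC : 2 ^ (2 * B ^ r) * ((baseFm H).time (2 ^ (2 * B ^ r)) +
      (joinFm H).time (2 ^ (2 * B ^ r)) + 40) + 100 ≤ C)
    (h1 : (∃ s < 2 ^ (2 * B ^ r), R root (lst (n + 2 * root)).length s ∧ FinalP r B s) → out = 1)
    (h0 : (¬ ∃ s < 2 ^ (2 * B ^ r), R root (lst (n + 2 * root)).length s ∧ FinalP r B s) →
      out = 0) :
    HT w Q (mainCmd H) (n * 45 + N * (3 * C + 404) + 2 * B ^ r * 30 +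
      (∑ u ∈ Finset.range n, ((lst u).length * 40 + 40)) + (powTm r).time +
      (finalFm r).time (2 ^ (2 * B ^ r)) + 300) (Config.init (inputOf n N root lst))
      fun σ' => σ'.reg 1 = out := by
  have hlst : ∀ q < n + 2 * N, ∀ v ∈ lst q, v < n + N := by
    intro q hq v hv
    rcases lt_or_ge q n with h | h
    · have := hnbr q h v hv
      omega
    · obtain ⟨e, rfl⟩ := Nat.exists_eq_add_of_le h
      rcases Nat.even_or_odd' e with ⟨i, rfl | rfl⟩
      · have := htree.kids_lt i (by omega) v hv
        omega
      · have := hbag i (by omega) v hv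
        omega
  have hlen : (withPows n N root lst (2 * B ^ r) ++
      bfs (fun i => lst (n + 2 * i)) root N).length =
        ptr lst (n + 2 * N) + (n + 2 * N) + 2 * B ^ r + N := by
    rw [List.length_append, htree.length_bfs]
    simp [withPows, length_withPtrs]
  refine HT.le (HT.seq (ht_ptrCmd (root := root) (lst := lst) (n := n) (N := N) hw
      (bdd_init htree.root_lt hlst (by omega)) (fun _ => rfl) (by omega))
    fun σ1 b1 ⟨a2, a3, a4, a15, am⟩ => HT.seq
      (ht_powCmd hw hr hwp b1 am a2 a3 a4 a15 hB (by omega) hS)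
    fun σ2 b2 ⟨cs, c1, c5, c9, c10, c15, cm⟩ => HT.seq (ht_bfsCmd hw b2 cm (cs.eq a2) (cs.eq a3)
      (cs.eq a4) c5 c15 htree hkids (by omega))
    fun σ3 b3 ⟨ds, d6, dm⟩ => HT.seq (ht_adjCmd (root := root) (lst := lst) (N := N)
      (A := ptr lst (n + 2 * N) + (n + 2 * N) + 2 * B ^ r + N)
      (l := (List.range (2 * B ^ r)).map (2 ^ ·) ++ bfs (fun i => lst (n + 2 * i)) root N) hw b3
      (by rw [withPows, List.append_assoc] at dm; exact dm)
      (by rw [withPows, List.append_assoc] at hlen; exact hlen)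
      (ds.eq (cs.eq a2)) (ds.eq (cs.eq a3)) (ds.eq (cs.eq a4)) d6 rfl hnbr (by omega))
    fun σ4 b4 ⟨es, e7, e8, em, ea⟩ => HT.seq (ht_dpCmd hw hr hwb hwj b4
      (A := ptr lst (n + 2 * N) + (n + 2 * N) + 2 * B ^ r + N + n * n) (B := B) (n := n)
      (root := root)
      ?_ htree hkids hbag (fun i hi => hB ▸ length_bag_le hi) hR (by omega) hC)
    fun σ5 b5 ⟨fp, frow⟩ => ht_answerCmd hw hr hwf b5 fp htree.root_lt (by omega) frow h1 h0) ?_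
  · have hmem : ∀ a < ptr lst (n + 2 * N) + (n + 2 * N) + 2 * B ^ r + N, σ4.mem a =
        (withPows n N root lst (2 * B ^ r) ++ bfs (fun i => lst (n + 2 * i)) root N).getD a 0 :=
      fun a ha => by rw [em a ha, dm a]
    have g5 : σ4.reg 5 = ptr lst (n + 2 * N) + (n + 2 * N) := es.eq (ds.eq c5)
    have g6 : σ4.reg 6 = ptr lst (n + 2 * N) + (n + 2 * N) + 2 * B ^ r := es.eq d6
    have hlp : (withPows n N root lst (2 * B ^ r)).length =
        ptr lst (n + 2 * N) + (n + 2 * N) + 2 * B ^ r := by simp [withPows, length_withPtrs]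
    refine ⟨⟨es.eq (ds.eq c1), es.eq (ds.eq c9), es.eq (ds.eq c10), fun g hg => ?_⟩,
      es.eq (ds.eq (cs.eq a2)), es.eq (ds.eq (cs.eq a3)), es.eq (ds.eq (cs.eq a4)), e8,
      holdsInput_of_withPtrs fun a ha => ?_, fun k hk => ?_, ?_, by omega, by omega, by omega,
      by omega⟩
    · rw [g5, hmem _ (by omega), List.getD_append _ _ _ _ (by omega), withPows,
        List.getD_append_right _ _ _ _ (by rw [length_withPtrs]; omega), length_withPtrs,
        Nat.add_sub_cancel_left]
      simp [List.getD_eq_getElem?_getD, List.getElem?_range hg]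
    · have ha' := ha
      rw [length_withPtrs] at ha'
      rw [hmem a (by omega), List.getD_append _ _ _ _ (by omega), withPows,
        List.getD_append _ _ _ _ ha]
    · rw [g6, hmem _ (by omega), List.getD_append_right _ _ _ _ (by omega), hlp,
        Nat.add_sub_cancel_left]
    · rw [e7]; exact ea
  · rw [show N * (3 * (C + 8) + 100) = N * (3 * C) + N * 124 by ring,
      show N * (3 * C + 404) = N * (3 * C) + N * 404 by ring]
    omega

end Main

/-! ### The input of the program -/

section Lists

variable {n N : ℕ} (nbrs : Fin n → List (Fin n)) (kids : Fin N → List (Fin N))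
  (bags : Fin N → List (Fin n))

/-- The lists of the input in their order: the neighbours of the vertices and, for each node, its
children and its bag. -/
def listsOf (q : ℕ) : List ℕ :=
  if h : q < n then (nbrs ⟨q, h⟩).map Fin.val
  else if h : (q - n) / 2 < N then
    if (q - n) % 2 = 0 then (kids ⟨(q - n) / 2, h⟩).map Fin.val
    else (bags ⟨(q - n) / 2, h⟩).map Fin.val
  else []

theorem listsOf_vertex {u : ℕ} (hu : u < n) :
    listsOf nbrs kids bags u = (nbrs ⟨u, hu⟩).map Fin.val := by
  simp [listsOf, hu]

theorem listsOf_kids {i : ℕ} (hi : i < N) :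
    listsOf nbrs kids bags (n + 2 * i) = (kids ⟨i, hi⟩).map Fin.val := by
  have h1 : ¬ n + 2 * i < n := by omega
  simp [listsOf, hi]

theorem listsOf_bag {i : ℕ} (hi : i < N) :
    listsOf nbrs kids bags (n + (2 * i + 1)) = (bags ⟨i, hi⟩).map Fin.val := by
  have h1 : ¬ n + (2 * i + 1) < n := by omega
  have h2 : (2 * i + 1) / 2 = i := by omega
  simp [listsOf, h1, h2, hi, Nat.add_mod]

theorem flatMap_range_two_mul (f : ℕ → List ℕ) (m : ℕ) :
    (List.range (2 * m)).flatMap f =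
      (List.range m).flatMap fun i => f (2 * i) ++ f (2 * i + 1) := by
  induction m with
  | zero => rfl
  | succ m ih =>
    rw [Nat.mul_succ, List.range_succ, List.range_succ, List.range_succ]
    simp [ih]

theorem flatMap_range_eq_finRange {m : ℕ} (f : ℕ → List ℕ) (g : Fin m → List ℕ)
    (h : ∀ i (hi : i < m), f i = g ⟨i, hi⟩) :
    (List.range m).flatMap f = (List.finRange m).flatMap g := by
  obtain rfl : g = fun i : Fin m => f i := funext fun i => (h i i.2).symm
  rw [← List.map_coe_finRange_eq_range, List.flatMap_map]

theorem inputOf_listsOf (root : ℕ) : inputOf n N root (listsOf nbrs kids bags) =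
    [n, N, root] ++ (List.finRange n).flatMap (fun v => encodeList (nbrs v)) ++
      (List.finRange N).flatMap (fun i => encodeList (kids i) ++ encodeList (bags i)) := by
  rw [inputOf, List.range_add, List.flatMap_append, List.append_assoc, List.flatMap_map,
    flatMap_range_two_mul]
  congr 1
  congr 1
  · exact flatMap_range_eq_finRange _ _ fun i hi => by
      simp [listsOf_vertex nbrs kids bags hi, encodeList]
  · exact flatMap_range_eq_finRange _ _ fun i hi => by
      rw [listsOf_kids nbrs kids bags hi, listsOf_bag nbrs kids bags hi]
      simp [encodeList]

end Lists

section Represents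

variable {n N r t B : ℕ} {G : SimpleGraph (Fin n)} {D : RootedTreeDecomposition G (Fin N)}
  {H : SimpleGraph (Fin r)} {nbrs : Fin n → List (Fin n)} {kids : Fin N → List (Fin N)}
  {bags : Fin N → List (Fin n)}

theorem isTreeOn_listsOf (hk : ∀ i, Enumerates (kids i) (D.children i)) :
    IsTreeOn N D.root fun i => listsOf nbrs kids bags (n + 2 * i) := by
  have hmem : ∀ i (hi : i < N) j, j ∈ listsOf nbrs kids bags (n + 2 * i) ↔
      ∃ h : j < N, ⟨j, h⟩ ∈ D.children ⟨i, hi⟩ := by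
    intro i hi j
    rw [listsOf_kids nbrs kids bags hi, List.mem_map]
    constructor
    · rintro ⟨x, hx, rfl⟩
      exact ⟨x.2, ((hk _).2 _).1 hx⟩
    · rintro ⟨h, hx⟩
      exact ⟨_, ((hk _).2 _).2 hx, rfl⟩
  refine ⟨D.root.2, fun i hi j hj => ((hmem i hi j).1 hj).1, fun i hi => ?_, fun i hi hj => ?_,
    fun i hi i' hi' j hj hj' => ?_, fun S h0 hS i hi => ?_⟩
  · rw [listsOf_kids nbrs kids bags hi]
    exact (hk _).1.map Fin.val_injective
  · obtain ⟨_, h⟩ := (hmem i hi _).1 hj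
    exact RootedTreeDecomposition.root_notMem_children _ h
  · obtain ⟨_, h⟩ := (hmem i hi _).1 hj
    obtain ⟨_, h'⟩ := (hmem i' hi' _).1 hj'
    simpa using RootedTreeDecomposition.parent_unique h h'
  · have := RootedTreeDecomposition.mem_desc_root (D := D) ⟨i, hi⟩
    change Relation.ReflTransGen _ _ _ at this
    suffices h : ∀ x, Relation.ReflTransGen (fun a b => b ∈ D.children a) D.root x →
        (x : ℕ) ∈ S from h _ this
    intro x hx
    induction hx with
    | refl => exact h0
    | @tail a b _ hc ih => exact hS a a.2 ih b ((hmem a a.2 b).2 ⟨b.2, hc⟩)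

/-- The types of the node `i` with its first `c` subtrees. -/
def TypesAt (D : RootedTreeDecomposition G (Fin N)) (H : SimpleGraph (Fin r)) (B : ℕ)
    (kids : Fin N → List (Fin N)) (bags : Fin N → List (Fin n)) (i c s : ℕ) : Prop :=
  ∃ hi : i < N, Realizable G H B (D.covered (D.partialSubtree ⟨i, hi⟩ ((kids ⟨i, hi⟩).take c)))
    (bags ⟨i, hi⟩) s

theorem isRecursive_typesAt (hr : 0 < r) (hn : ∀ v, Enumerates (nbrs v) (G.neighborSet v))
    (hk : ∀ i, Enumerates (kids i) (D.children i)) (hb : ∀ i, Enumerates (bags i) (D.bag i))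
    (hB : ∀ i, (bags i).length + 2 ≤ B) :
    IsRecursive H B n N (listsOf nbrs kids bags) (TypesAt D H B kids bags) := by
  refine ⟨fun i hi adj hadj s hs => ?_, fun i hi c hc j hj eqv heqv s hs => ?_⟩
  · rw [listsOf_bag nbrs kids bags hi] at hadj ⊢
    rw [List.length_map] at hadj ⊢
    have hset : D.covered (D.partialSubtree ⟨i, hi⟩ ((kids ⟨i, hi⟩).take 0)) =
        {v | v ∈ bags ⟨i, hi⟩} := by
      rw [List.take_zero, RootedTreeDecomposition.covered_partialSubtree_nil]
      ext v
      exact ((hb _).2 v).symm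
    rw [← realizable_bag (G := G) hr (hb _).1 (hB _) (fun p q hp hq => ?_) hs, ← hset]
    · exact ⟨fun ⟨_, h⟩ => h, fun h => ⟨hi, h⟩⟩
    · have e : ∀ p (hp : p < (bags ⟨i, hi⟩).length),
          ((bags ⟨i, hi⟩).map Fin.val).getD p 0 = ((bags ⟨i, hi⟩)[p] : ℕ) := fun p hp => by
        rw [List.getD_eq_getElem _ _ (by simpa), List.getElem_map]
      rw [hadj p hp q hq, e p hp, e q hq, listsOf_vertex nbrs kids bags (Fin.is_lt _)]
      rw [List.mem_map_of_injective Fin.val_injective]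
      exact (hn _).2 _
  · rw [listsOf_kids nbrs kids bags hi] at hc hj
    rw [List.length_map] at hc
    obtain rfl : j = ((kids ⟨i, hi⟩)[c] : ℕ) := by
      rw [hj, List.getD_eq_getElem _ _ (by simpa), List.getElem_map]
    have hjN := ((kids ⟨i, hi⟩)[c]).2
    rw [listsOf_bag nbrs kids bags hi, listsOf_bag nbrs kids bags hjN] at heqv ⊢
    rw [listsOf_kids nbrs kids bags hjN]
    simp only [List.length_map, Fin.eta] at heqv ⊢
    set j := (kids ⟨i, hi⟩)[c] with hjd
    have hjc : j ∈ D.children ⟨i, hi⟩ := ((hk _).2 j).1 (List.getElem_mem hc)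
    have htake : (kids ⟨i, hi⟩).take (c + 1) = (kids ⟨i, hi⟩).take c ++ [j] :=
      List.take_succ_eq_append_getElem hc
    have hnot : j ∉ (kids ⟨i, hi⟩).take c := fun h => by
      have := ((hk ⟨i, hi⟩).1.sublist (List.take_sublist (c + 1) _))
      rw [htake] at this
      exact (List.nodup_append.1 this).2.2 j h j (by simp) rfl
    have hdesc : D.covered (D.partialSubtree j ((kids j).take (kids j).length)) =
        D.covered (D.Desc j) := by
      rw [List.take_length, RootedTreeDecomposition.partialSubtree_eq_desc (hk j).2]
    have h1 : ∀ c s, TypesAt D H B kids bags i c s ↔ Realizable G H B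
        (D.covered (D.partialSubtree ⟨i, hi⟩ ((kids ⟨i, hi⟩).take c))) (bags ⟨i, hi⟩) s :=
      fun c s => ⟨fun ⟨_, h⟩ => h, fun h => ⟨hi, h⟩⟩
    have h2 : ∀ s, TypesAt D H B kids bags j (kids j).length s ↔
        Realizable G H B (D.covered (D.Desc j)) (bags j) s :=
      fun s => by rw [← hdesc]; exact ⟨fun ⟨_, h⟩ => h, fun h => ⟨j.2, h⟩⟩
    simp only [h1, h2]
    rw [htake, RootedTreeDecomposition.covered_partialSubtree_append]
    refine realizable_union
      (U₁ := D.covered (D.partialSubtree ⟨i, hi⟩ ((kids ⟨i, hi⟩).take c)))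
      (U₂ := D.covered (D.Desc j)) hr (hb _).1 (hb _).1 (hB _) (hB _)
      (fun v hv => ⟨_, Or.inl rfl, ((hb _).2 v).1 hv⟩)
      (fun v hv => ⟨j, Relation.ReflTransGen.refl, ((hb _).2 v).1 hv⟩) (fun v hv hv' => ?_)
      (fun u _ hu v hv hv' =>
        RootedTreeDecomposition.not_adj_of_covered hjc hu hv hv') (fun p q hp hq => ?_) hs
    · obtain ⟨h, h'⟩ := RootedTreeDecomposition.covered_partialSubtree_inter
        (fun k hk' => ((hk _).2 k).1 (List.mem_of_mem_take hk')) hjc hnot hv hv'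
      exact ⟨((hb _).2 v).2 h, ((hb _).2 v).2 h'⟩
    · rw [heqv p hp q hq, List.getD_eq_getElem _ _ (by simpa), List.getD_eq_getElem _ _ (by simpa),
        List.getElem_map, List.getElem_map, Fin.val_inj]

theorem hasHFreeBipartition_iff_typesAt (hr : 0 < r)
    (hk : ∀ i, Enumerates (kids i) (D.children i)) (hB : ∀ i, (bags i).length + 2 ≤ B) :
    HasHFreeBipartition H G ↔ ∃ s < 2 ^ (2 * B ^ r), TypesAt D H B kids bags D.root
      (listsOf nbrs kids bags (n + 2 * D.root)).length s ∧ FinalP r B s := by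
  rw [listsOf_kids nbrs kids bags D.root.2, List.length_map, hasHFreeBipartition_iff hr (hB D.root)]
  refine exists_congr fun s => and_congr_right fun _ => and_congr_left fun _ => ?_
  have : D.covered (D.partialSubtree D.root ((kids D.root).take (kids D.root).length)) =
      Set.univ := by
    rw [List.take_length, RootedTreeDecomposition.partialSubtree_eq_desc (hk _).2,
      RootedTreeDecomposition.covered_desc_root]
  rw [← this]
  exact ⟨fun h => ⟨D.root.2, h⟩, fun ⟨_, h⟩ => h⟩

theorem length_kids_le (hD : D.IsNice) (hk : ∀ i, Enumerates (kids i) (D.children i)) (i : Fin N) :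
    (kids i).length ≤ 2 := by
  have key : ∀ l : List (Fin N), (∀ j ∈ D.children i, j ∈ l) → (kids i).length ≤ l.length :=
    fun l hl => ((hk i).1.subperm fun j hj => hl j (((hk i).2 j).1 hj)).length_le
  rcases hD i with ⟨h, _⟩ | ⟨j, _, h, _⟩ | ⟨j, _, h, _⟩ | ⟨j, j', _, h, _⟩
  · exact (key [] (by simp [h])).trans (by simp)
  · exact (key [j] (by simp [h])).trans (by simp)
  · exact (key [j] (by simp [h])).trans (by simp)
  · exact key [j, j'] (by simp [h])

theorem length_bag_eq (hb : ∀ i, Enumerates (bags i) (D.bag i)) (i : Fin N) :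
    (bags i).length = (D.bag i).card := by
  rw [← List.toFinset_card_of_nodup (hb i).1]
  congr 1
  ext v
  simpa using (hb i).2 v

/-- All edges are inside of bags, so that there are few of them. -/
theorem sum_length_nbrs_le (hw : D.WidthAtMost t)
    (hn : ∀ v, Enumerates (nbrs v) (G.neighborSet v)) :
    ∑ v, (nbrs v).length ≤ N * (t + 1) ^ 2 := by
  have h1 : ∑ v, (nbrs v).length = (Finset.univ.sigma fun v => (nbrs v).toFinset).card := by
    rw [Finset.card_sigma]
    exact Finset.sum_congr rfl fun v _ => (List.toFinset_card_of_nodup (hn v).1).symm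
  have h2 : (Finset.univ.sigma fun v => (nbrs v).toFinset).card ≤
      (Finset.univ.biUnion fun i => D.bag i ×ˢ D.bag i).card := by
    refine Finset.card_le_card_of_injOn (fun x => (x.1, x.2)) (fun x hx => ?_) ?_
    · simp only [Finset.coe_sigma, Set.mem_sigma_iff, Finset.mem_coe, List.mem_toFinset] at hx
      obtain ⟨i, hi, hi'⟩ := D.exists_edge_bag _ _ (((hn _).2 _).1 hx.2)
      simpa using ⟨i, hi, hi'⟩
    · rintro ⟨u, v⟩ _ ⟨u', v'⟩ _ h
      simpa using h
  have h3 := Finset.card_biUnion_le_card_mul (Finset.univ : Finset (Fin N))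
    (fun i => D.bag i ×ˢ D.bag i) ((t + 1) ^ 2) fun i _ => by
      rw [Finset.card_product, pow_two]
      exact Nat.mul_le_mul (hw i) (hw i)
  rw [Finset.card_univ, Fintype.card_fin] at h3
  omega

end Represents

/-! ### Estimates -/

theorem lt_two_pow_mul {a b y : ℕ} (hy : 1 ≤ y) (h : a ≤ b) : a < 2 ^ (b * y) :=
  lt_of_lt_of_le (Nat.lt_two_pow_self (n := a))
    (Nat.pow_le_pow_right (by omega) (h.trans (Nat.le_mul_of_pos_right b hy)))

/-- A bound for the numbers that are stored in the computation; `L` is the length of the input. -/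
theorem bound_numbers {K t n N r B L y : ℕ} (hr : 0 < r) (ht : 1 ≤ t) (hy : y = t ^ r + Nat.log 2 n)
    (hN : N ≤ K * t * n) (hB : B ≤ t + 3) (hL : L ≤ 3 + (n + 2 * N) * (n + t + 4)) :
    L + (n + 2 * N) + 2 * B ^ r + N + n * n ≤ 2 ^ ((4 * (K + 2) + 2 * 4 ^ r) * y) ∧
      2 ^ (2 * B ^ r) ≤ 2 ^ ((4 * (K + 2) + 2 * 4 ^ r) * y) := by
  have hT : 1 ≤ t ^ r := Nat.one_le_pow _ _ ht
  have htT : t ≤ t ^ r := Nat.le_self_pow hr.ne' t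
  have hF : B ^ r ≤ 4 ^ r * t ^ r := by
    rw [← Nat.mul_pow]
    exact Nat.pow_le_pow_left (by omega) r
  set S := 2 ^ (2 * B ^ r) with hS
  set Z := 2 ^ ((K + 2) * y) with hZ
  have hn : n ≤ 2 ^ y :=
    (Nat.lt_pow_succ_log_self (by decide) n).le.trans (Nat.pow_le_pow_right (by omega) (by omega))
  have ht' : t ≤ 2 ^ y := (Nat.lt_two_pow_self (n := t)).le.trans
    (Nat.pow_le_pow_right (by omega) (by omega))
  have hK : K ≤ 2 ^ (K * y) := (lt_two_pow_mul (by omega) le_rfl).le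
  have hyZ : 2 ^ y ≤ Z := Nat.pow_le_pow_right (by omega) (Nat.le_mul_of_pos_left y (by omega))
  have hNZ : N ≤ Z := by
    calc N ≤ K * t * n := hN
      _ ≤ 2 ^ (K * y) * 2 ^ y * 2 ^ y := Nat.mul_le_mul (Nat.mul_le_mul hK ht') hn
      _ = Z := by rw [hZ, ← pow_add, ← pow_add]; ring_nf
  have h4 : 4 ≤ Z := by
    calc 4 = 2 ^ 2 := rfl
      _ ≤ Z := Nat.pow_le_pow_right (by omega)
        (le_trans (by omega) (Nat.mul_le_mul (show 2 ≤ K + 2 by omega) (show 1 ≤ y by omega)))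
  have hS1 : 2 * B ^ r + 1 ≤ S := Nat.lt_two_pow_self
  have hSle : S ≤ 2 ^ (2 * 4 ^ r * y) := by
    refine Nat.pow_le_pow_right (by omega) ?_
    rw [mul_assoc]
    exact Nat.mul_le_mul_left 2 (hF.trans (Nat.mul_le_mul_left _ (by omega)))
  have hpow : 2 ^ ((4 * (K + 2) + 2 * 4 ^ r) * y) = Z ^ 4 * 2 ^ (2 * 4 ^ r * y) := by
    rw [hZ, ← pow_mul, ← pow_add]; ring_nf
  have hZ4 : 1 ≤ Z ^ 4 := Nat.one_le_pow _ _ (by omega)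
  rw [hpow]
  have hS' : S ≤ Z ^ 4 * 2 ^ (2 * 4 ^ r * y) := hSle.trans (Nat.le_mul_of_pos_left _ hZ4)
  refine ⟨?_, hS'⟩
  have hn' : n ≤ Z := hn.trans hyZ
  have ht'' : t ≤ Z := ht'.trans hyZ
  have hL' : L ≤ 3 + (Z + 2 * Z) * (Z + Z + 4) :=
    hL.trans (Nat.add_le_add_left (Nat.mul_le_mul (by omega) (by omega)) 3)
  have hnn : n * n ≤ Z * Z := Nat.mul_le_mul hn' hn'
  have h16 : 16 ≤ Z * Z := Nat.mul_le_mul h4 h4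
  have hZZ : 4 * Z ≤ Z * Z := Nat.mul_le_mul_right Z h4
  have hZ4' : 16 * (Z * Z) ≤ Z ^ 4 := by
    calc 16 * (Z * Z) ≤ Z * Z * (Z * Z) := Nat.mul_le_mul_right _ h16
      _ = Z ^ 4 := by ring
  have hexp : (Z + 2 * Z) * (Z + Z + 4) = 6 * (Z * Z) + 12 * Z := by ring
  clear_value S Z
  have hsum : L + (n + 2 * N) + 2 * B ^ r + N + n * n ≤ Z ^ 4 + S := by omega
  -- A sum of two numbers that are at least `2` is at most their product.
  have h2 : 2 ≤ 2 ^ (2 * 4 ^ r * y) := Nat.le_self_pow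
    (Nat.mul_pos (Nat.mul_pos (by omega) (Nat.pow_pos (by omega))) (by omega)).ne' 2
  exact (hsum.trans (Nat.add_le_add_left hSle _)).trans (Nat.add_le_mul (by omega) h2)

/-- A bound for the running time; `deg` is the sum of the degrees, and `d`, `f` and `p` are the
times for the evaluation of the formulas and of the power `B ^ r`. -/
theorem bound_time {K t n N r B a e p d f deg x : ℕ} (hr : 0 < r) (ht : 1 ≤ t) (hn : 1 ≤ n)
    (ha : a = 2 * 4 ^ r) (hx : x = 2 ^ t ^ r) (hN : N ≤ K * t * n) (hB : B ≤ t + 3)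
    (hd : d ≤ 2 * (2 ^ (2 * B ^ r)) ^ e) (hf : f ≤ (2 ^ (2 * B ^ r)) ^ e)
    (hdeg : deg ≤ N * (t + 1) ^ 2) :
    n * 45 + N * (3 * (2 ^ (2 * B ^ r) * (d + 40) + 100) + 404) + 2 * B ^ r * 30 +
      (deg * 40 + n * 40) + p + f + 302 ≤
      x ^ (a * e + a + 3 + (900 * K + p + 460)) * n := by
  have hT : 1 ≤ t ^ r := Nat.one_le_pow _ _ ht
  have htT : t ≤ t ^ r := Nat.le_self_pow hr.ne' t
  have hx2 : 2 ≤ x := by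
    rw [hx]
    exact Nat.le_self_pow (by omega) 2
  have htx : t + 1 ≤ x := by
    rw [hx]
    exact (Nat.lt_two_pow_self (n := t)).trans_le (Nat.pow_le_pow_right (by omega) htT)
  have hF : B ^ r ≤ 4 ^ r * t ^ r := by
    rw [← Nat.mul_pow]
    exact Nat.pow_le_pow_left (by omega) r
  have hS : 2 ^ (2 * B ^ r) ≤ x ^ a := by
    rw [hx, ← pow_mul]
    refine Nat.pow_le_pow_right (by omega) ?_
    calc 2 * B ^ r ≤ 2 * (4 ^ r * t ^ r) := Nat.mul_le_mul_left 2 hF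
      _ = t ^ r * a := by rw [ha]; ring
  set S := 2 ^ (2 * B ^ r) with hSd
  have hFS : 2 * B ^ r ≤ S := (Nat.lt_two_pow_self (n := 2 * B ^ r)).le
  have hSe : S ^ e ≤ x ^ (a * e) := by
    rw [pow_mul]; exact Nat.pow_le_pow_left hS e
  have one_le : ∀ k, 1 ≤ x ^ k := fun k => Nat.one_le_pow _ _ (by omega)
  set b := a * e + a with hb
  have hSb : S ≤ x ^ b := hS.trans (Nat.pow_le_pow_right (by omega) (by omega))
  have hfb : f ≤ x ^ b :=
    hf.trans (hSe.trans (Nat.pow_le_pow_right (by omega) (by omega)))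
  have h1 := one_le b
  have hC : S * (d + 40) ≤ 42 * x ^ b := by
    have : d + 40 ≤ 42 * x ^ (a * e) := by have := one_le (a * e); omega
    calc S * (d + 40) ≤ x ^ a * (42 * x ^ (a * e)) := Nat.mul_le_mul hS this
      _ = 42 * x ^ b := by rw [hb, pow_add]; ring
  have hNx : N ≤ K * x * n := hN.trans (Nat.mul_le_mul_right n (Nat.mul_le_mul_left K (by omega)))
  have hterm1 : N * (3 * (S * (d + 40) + 100) + 404) ≤ 830 * K * (x ^ (b + 3) * n) := by
    calc N * (3 * (S * (d + 40) + 100) + 404) ≤ (K * x * n) * (830 * x ^ b) :=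
          Nat.mul_le_mul hNx (by omega)
      _ = 830 * K * (x ^ (b + 1) * n) := by ring
      _ ≤ _ := Nat.mul_le_mul_left _ (Nat.mul_le_mul_right n
        (Nat.pow_le_pow_right (by omega) (by omega)))
  have hterm2 : deg ≤ K * (x ^ (b + 3) * n) := by
    calc deg ≤ N * (t + 1) ^ 2 := hdeg
      _ ≤ (K * x * n) * x ^ 2 := Nat.mul_le_mul hNx (Nat.pow_le_pow_left htx 2)
      _ = K * (x ^ 3 * n) := by ring
      _ ≤ _ := Nat.mul_le_mul_left _ (Nat.mul_le_mul_right n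
        (Nat.pow_le_pow_right (by omega) (by omega)))
  have hX : x ^ b ≤ x ^ (b + 3) * n :=
    (Nat.pow_le_pow_right (by omega) (by omega)).trans (Nat.le_mul_of_pos_right _ hn)
  have hXn : n ≤ x ^ (b + 3) * n := Nat.le_mul_of_pos_left _ (one_le _)
  have hpX : p ≤ p * (x ^ (b + 3) * n) := Nat.le_mul_of_pos_right p (by omega)
  set X := x ^ (b + 3) * n with hXd
  have hexp : 900 * K + p + 460 ≤ x ^ (900 * K + p + 460) :=
    (Nat.lt_two_pow_self).le.trans (Nat.pow_le_pow_left hx2 _)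
  have hsplit : (900 * K + p + 460) * X = 900 * (K * X) + p * X + 460 * X := by ring
  rw [mul_assoc 830 K X] at hterm1
  clear_value S X b
  calc _ ≤ (900 * K + p + 460) * X := by omega
    _ ≤ x ^ (900 * K + p + 460) * X := Nat.mul_le_mul_right X hexp
    _ = _ := by rw [hXd, pow_add x (b + 3)]; ring

theorem not_hasHFreeBipartition_zero {V : Type*} (H : SimpleGraph (Fin 0)) (G : SimpleGraph V) :
    ¬ HasHFreeBipartition H G := fun ⟨_, _, _, _, _, _, h, _⟩ => h .of_isEmpty

theorem ptr_le {lst : ℕ → List ℕ} {m l : ℕ} (h : ∀ q < m, (lst q).length ≤ l) :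
    ptr lst m ≤ 3 + m * (l + 1) := by
  have := Finset.sum_le_card_nsmul (Finset.range m) (fun q => (lst q).length + 1) (l + 1)
    fun q hq => by have := h q (Finset.mem_range.1 hq); omega
  rw [Finset.card_range, smul_eq_mul] at this
  rw [ptr]; omega

theorem baseOf_le {n N l : ℕ} {lst : ℕ → List ℕ}
    (h : ∀ i < N, (lst (n + (2 * i + 1))).length ≤ l) : baseOf n lst N ≤ l + 2 :=
  sup_le (Finset.sup_le fun i hi => by have := h i (Finset.mem_range.1 hi); omega) (by omega)

end HFreeBipartitioning

theorem mainTheorem2 (r : ℕ) (H : SimpleGraph (Fin r)) :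
    ∃ P : Cmd, ∀ K : ℕ, ∃ c : ℕ,
      ∀ (t n N : ℕ) (G : SimpleGraph (Fin n)) (D : RootedTreeDecomposition G (Fin N))
        (input : List ℕ),
        1 ≤ t → 1 ≤ n → D.IsNice → D.WidthAtMost t → N ≤ K * t * n → Represents input G D →
        ∃ out : ℕ,
          P.Outputs (c * (t ^ r + Nat.log 2 n)) input (2 ^ (c * t ^ r) * n) out ∧
          (HasHFreeBipartition H G → out = 1) ∧ (¬ HasHFreeBipartition H G → out = 0) := by
  classical
  rcases Nat.eq_zero_or_pos r with rfl | hr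
  · -- Every graph contains the graph without vertices.
    refine ⟨.const 0 0, fun K => ⟨0, fun t n N G D input _ hn _ _ _ _ => ⟨0, ?_,
      fun h => absurd h (not_hasHFreeBipartition_zero H G), fun _ => rfl⟩⟩⟩
    exact ⟨1, _, by simpa using hn, Exec.const _ 0 0 (by positivity), by simp⟩
  obtain ⟨e₁, he₁⟩ := (baseFm H).exists_time_le
  obtain ⟨e₂, he₂⟩ := (joinFm H).exists_time_le
  obtain ⟨e₃, he₃⟩ := (finalFm r).exists_time_le
  refine ⟨.seq (mainCmd H) outputCmd, fun K => ?_⟩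
  obtain ⟨q, hq⟩ : ∃ q, q = 4 * (K + 2) + 2 * 4 ^ r := ⟨_, rfl⟩
  -- All stored numbers are at most `2 ^ (q * y)`, where `y = t ^ r + log n`, and the values of all
  -- terms are at most the `d`-th power of that. The running time is at most `2 ^ (m * t ^ r) * n`.
  obtain ⟨d, hd⟩ : ∃ d, d = 40 + (powTm r).deg + (baseFm H).deg + (joinFm H).deg +
    (finalFm r).deg := ⟨_, rfl⟩
  obtain ⟨e, he⟩ : ∃ e, e = e₁ + e₂ + e₃ := ⟨_, rfl⟩
  obtain ⟨m, hm⟩ : ∃ m, m = 2 * 4 ^ r * e + 2 * 4 ^ r + 3 + (900 * K + (powTm r).time + 460) :=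
    ⟨_, rfl⟩
  refine ⟨q * d + 1 + m, fun t n N G D input ht hn hD hwd hN hrep => ?_⟩
  obtain ⟨nbrs, kids, bags, hnb, hk, hb, rfl⟩ := hrep
  rw [← inputOf_listsOf nbrs kids bags]
  set lst := listsOf nbrs kids bags with hlst
  set y := t ^ r + Nat.log 2 n with hy
  have hT : 1 ≤ t ^ r := Nat.one_le_pow _ _ ht
  have hvertex : ∀ u (hu : u < n), lst u = (nbrs ⟨u, hu⟩).map Fin.val :=
    fun u hu => listsOf_vertex nbrs kids bags hu
  have hkid : ∀ i (hi : i < N), lst (n + 2 * i) = (kids ⟨i, hi⟩).map Fin.val :=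
    fun i hi => listsOf_kids nbrs kids bags hi
  have hbag : ∀ i (hi : i < N), lst (n + (2 * i + 1)) = (bags ⟨i, hi⟩).map Fin.val :=
    fun i hi => listsOf_bag nbrs kids bags hi
  have hbl : ∀ i, (bags i).length ≤ t + 1 := fun i => (length_bag_eq hb i).trans_le (hwd i)
  have hlb : ∀ i < N, (lst (n + (2 * i + 1))).length ≤ t + 1 := fun i hi => by
    rw [hbag i hi, List.length_map]; exact hbl _
  have hlk : ∀ i < N, (lst (n + 2 * i)).length ≤ 2 := fun i hi => by
    rw [hkid i hi, List.length_map]; exact length_kids_le hD hk _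
  have hln : ∀ u < n, (lst u).length ≤ n := fun u hu => by
    rw [hvertex u hu, List.length_map]
    exact (hnb _).1.length_le_card.trans_eq (Fintype.card_fin n)
  have hB : baseOf n lst N ≤ t + 3 := baseOf_le hlb
  have hL : ptr lst (n + 2 * N) ≤ 3 + (n + 2 * N) * (n + t + 4) := by
    refine ptr_le (l := n + t + 3) fun p hp => ?_
    rcases lt_or_ge p n with h | h
    · have := hln p h
      omega
    · obtain ⟨k, rfl⟩ := Nat.exists_eq_add_of_le h
      rcases Nat.even_or_odd' k with ⟨i, rfl | rfl⟩
      · have := hlk i (by omega)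
        omega
      · have := hlb i (by omega)
        omega
  obtain ⟨hQ, hS⟩ := bound_numbers hr ht hy hN hB hL
  rw [← hq] at hQ hS
  have hyq : 1 ≤ q * y := Nat.mul_pos (by omega) (by omega)
  have hpow : ∀ k ≤ d, (2 ^ (q * y)) ^ k < 2 ^ ((q * d + 1 + m) * y) := fun k hkd => by
    rw [← pow_mul]
    refine Nat.pow_lt_pow_right (by decide) ?_
    calc q * y * k ≤ q * y * d := Nat.mul_le_mul_left _ hkd
      _ = q * d * y := by ring
      _ < (q * d + 1 + m) * y := Nat.mul_lt_mul_of_pos_right (by omega) (by omega)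
  have hwide : Wide ((q * d + 1 + m) * y) (2 ^ (q * y)) :=
    ⟨Nat.le_self_pow (by omega) 2, fun k hk => hpow k (by omega)⟩
  have hBb : ∀ i, (bags i).length + 2 ≤ baseOf n lst N := fun i => by
    have := length_bag_le (n := n) (lst := lst) i.2
    rwa [hbag i i.2, List.length_map] at this
  have hiff := hasHFreeBipartition_iff_typesAt (G := G) (H := H) (nbrs := nbrs) hr hk hBb
  have hrun := fun out => ht_mainCmd (out := out) hwide hr (hpow _ (by omega))
    (hpow _ (by omega)) (hpow _ (by omega)) (hpow _ (by omega)) (isTreeOn_listsOf hk) hlk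
    (fun i hi v hv => by
      rw [← hlst, hbag i hi] at hv
      obtain ⟨x, -, rfl⟩ := List.mem_map.1 hv
      exact x.2)
    (fun u hu v hv => by
      rw [← hlst, hvertex u hu] at hv
      obtain ⟨x, -, rfl⟩ := List.mem_map.1 hv
      exact x.2) rfl (isRecursive_typesAt (H := H) hr hnb hk hb hBb) hQ hS le_rfl
  have hS2 : 2 ≤ 2 ^ (2 * baseOf n lst N ^ r) :=
    Nat.le_self_pow (by
      have : 0 < baseOf n lst N ^ r := Nat.pow_pos (lt_of_lt_of_le (by omega) (hBb D.root))
      omega) 2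
  have hexp : ∀ k ≤ e, (2 ^ (2 * baseOf n lst N ^ r)) ^ k ≤ (2 ^ (2 * baseOf n lst N ^ r)) ^ e :=
    fun k hk => Nat.pow_le_pow_right (by omega) hk
  have h1 := (he₁ _ hS2).trans (hexp e₁ (by omega))
  have h2 := (he₂ _ hS2).trans (hexp e₂ (by omega))
  have h3 := (he₃ _ hS2).trans (hexp e₃ (by omega))
  have hsum : ∑ u ∈ Finset.range n, ((lst u).length * 40 + 40) =
      (∑ v, (nbrs v).length) * 40 + n * 40 := by
    rw [Finset.sum_range, Finset.sum_add_distrib, ← Finset.sum_mul]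
    simp [hvertex]
  have htime := bound_time (p := (powTm r).time) hr ht hn rfl rfl hN hB
    (show _ ≤ _ from (Nat.add_le_add h1 h2).trans_eq (two_mul _).symm) h3
    (sum_length_nbrs_le hwd hnb)
  rw [← hm] at htime
  have hfinal : 2 ^ (t ^ r * m) ≤ 2 ^ ((q * d + 1 + m) * t ^ r) :=
    Nat.pow_le_pow_right (by omega) (by
      rw [mul_comm]; exact Nat.mul_le_mul_right _ (by omega))
  rw [← pow_mul] at htime
  have hQw : 2 ^ (q * y) < 2 ^ ((q * d + 1 + m) * y) := by simpa using hpow 1 (by omega)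
  refine ⟨if HasHFreeBipartition H G then 1 else 0, ?_, fun h => if_pos h, fun h => if_neg h⟩
  obtain ⟨k, s, hks, hex, hout⟩ := HT.outputs hQw (hrun _ (fun h => if_pos (hiff.2 h))
    (fun h => if_neg (mt hiff.1 h)))
  refine ⟨k, s, hks.trans (le_trans ?_ (htime.trans (Nat.mul_le_mul_right n hfinal))), hex, hout⟩
  rw [← hlst, hsum]
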